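/- **Setting.** Fix public parameters: a prime $q$, numbers $n_P,n_S,n_T$ (parties, sessions per party, stages per session), a key length $\kappa$, fixed lengths of encodings, distinct user identifiers $\mathrm{id}_u$ and key identifiers $kid_u$ for the parties $u$. Let $G=\langle g\rangle$ be a group of order $q$ whose elements are injectively encoded as bit strings of fixed length, $H:\{0,1\}^*\to\{0,1\}^\kappa$ a hash function (SHA-256 in the deployed protocol), and AEAD a correct scheme with deterministic $\mathsf{Enc}(k,N,AD,m)$, $\mathsf{Dec}(k,N,AD,c)\in\{0,1\}^*\cup\{\bot\}$ and uniform keys $k\in\{0,1\}^\kappa$. **LINEv2.** Party $u$ has secret key $x_u\leftarrow\mathbb Z_q$ and public key $g^{x_u}$. A session of $u$ with peer $v\neq u$ computes $pms=(g^{x_v})^{x_u}$ and a 32-bit counter $ctr=0$. To send $m$ with metadata $(vers,ctype)$ it uses fresh random $s\in\{0,1\}^{128}$, $rand\in\{0,1\}^{32}$, sets $k_e=H(pms\|s\|\texttt{Key})$, $n=ctr\|rand$, $AD=\mathrm{id}_v\|\mathrm{id}_u\|kid_u\|kid_v\|vers\|ctype$, $c=\mathsf{Enc}(k_e,n,AD,m)$,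 increments $ctr$ and sends the packet $(vers,ctype,s,c,n,kid_u,kid_v)$. On receiving a packet it derives $k_e$ from the packet's $s$, forms $AD$ (receiver first) from the packet's fields and the two identities, and accepts iff $\mathsf{Dec}(k_e,n,AD,c)\ne\bot$. Every sent packet and every received packet (accepted or rejected) is one stage; the key of an accepted (or sending) stage is $k_e$. **Authentication experiment.** The adversary $\mathcal A$ (probabilistic, with no bound on its resources) gets all public keys and may query: $\mathsf{Send}(u,i,\cdot)$ (start session $i$ of $u$ with a role and a peer; make it encrypt a chosen plaintext; deliver a packet to it, whereupon $\mathcal A$ sees the plaintext or $\bot$); $\mathsf{RevSessKey}(u,i,s)$; $\mathsf{RevLongTermKey}(u)$; $\mathsf{RevRand}(u,i,s)$ (the randomness of all stages is drawn when the session starts, and may be revealed in advance); $\mathsf{RevState}(u,i,s)$ ($pms$ and $ctr$). $\mathcal A$ wins if at some moment a session of some $u$ with peer $v$ accepts a packet that no session of $v$ with peer $u$ has sent before, and the accepting stage is fresh at that moment: neither long-term key of $u,v$ was revealed, $\mathsf{RevState}$ was asked to no session between $u$ and $v$ (owned by either), and $\mathsf{RevSessKey}$ was asked neither for this stage nor for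 any stage, of a session between $u$ and $v$, that used the same salt (and hence has the same key). Replays of sent packets are not forgeries. $\mathrm{Adv}^{auth}_{LINE}(\mathcal A)$ is the probability that $\mathcal A$ wins. **Primitives.** $\mathrm{Adv}^{coll}_H(\mathcal B)$ is the probability that $\mathcal B$ outputs $m\ne m'$ with $H(m)=H(m')$. $\mathrm{Adv}^{ddh}(\mathcal B)=|\Pr[\mathcal B(g,g^a,g^b,g^{ab})=1]-\Pr[\mathcal B(g,g^a,g^b,g^c)=1]|$ for uniform $a,b,c\in\mathbb Z_q$. $\mathrm{Adv}^{prf}(\mathcal B)$ refers to $F(k,x)=H(k\|x)$ with a uniform key $k\in G$: $\mathcal B$ may evaluate $F(k,\cdot)$ and once submit a challenge input $y$, which it never evaluates; it gets $F(k,y)$ or a uniform string in $\{0,1\}^\kappa$, and the advantage is the absolute difference of the probabilities of output $1$ in the two cases. $\mathrm{Adv}^{auth}_{AEAD}(\mathcal B)$ is the probability that $\mathcal B$, given oracles $\mathsf{Enc}(k,\cdot)$, $\mathsf{Dec}(k,\cdot)$ for a uniform $k$ (no restriction on nonces), submits to $\mathsf{Dec}$ some $(c,N,AD)$ that decrypts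 to a message and was not produced by $\mathsf{Enc}$. **Theorem (Message Authentication of LINE).** There are black-box reductions $\mathcal B_1,\dots,\mathcal B_4$, depending only on the public parameters (not on $G$, $H$, AEAD or $\mathcal A$), which access the primitives only through the operations "sample, take the generator, exponentiate, hash, AEAD-encrypt, AEAD-decrypt, query the challenger", and a constant $c$, such that: 1. (Running time.) $\mathcal B_i^{\mathcal A}$ runs $\mathcal A$ once without rewinding and, besides $\mathcal A$'s own steps, makes at most $c(n_P+1)$ of these operations before starting $\mathcal A$, at most $c(n_T+1)$ for each oracle query of $\mathcal A$, and at most $c$ after $\mathcal A$ has halted. (Each operation is one step, sampling the randomness of a session is $n_T$ steps; bookkeeping on data already held is not counted.) 2. For all $G,g,H$, AEAD and all $\mathcal A$, $$\mathrm{Adv}^{auth}_{LINE}(\mathcal A)\le \mathrm{Adv}^{coll}_H(\mathcal B_1^{\mathcal A})+n_P^2\,n_S\,n_T\Big(\mathrm{Adv}^{ddh}(\mathcal B_2^{\mathcal A})+\mathrm{Adv}^{prf}(\mathcal B_3^{\mathcal A})+\mathrm{Adv}^{auth}_{AEAD}(\mathcal B_4^{\mathcal A})+2\,n_T\,2^{-160}\Big).$$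 3. (Asymptotic form.) For any families of parameters, primitives and adversaries indexed by a security parameter $\lambda$, with $n_P,n_S,n_T$ polynomially bounded: if the four advantages $\mathrm{Adv}^{coll}_H(\mathcal B_1^{\mathcal A})$, $\mathrm{Adv}^{ddh}(\mathcal B_2^{\mathcal A})$, $\mathrm{Adv}^{prf}(\mathcal B_3^{\mathcal A})$, $\mathrm{Adv}^{auth}_{AEAD}(\mathcal B_4^{\mathcal A})$ are negligible in $\lambda$, then so is $\mathrm{Adv}^{auth}_{LINE}(\mathcal A)$. That is, LINEv2 achieves message authentication. -/

import Mathlib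

noncomputable section

/-! ## Bit strings and public parameters -/

/-- Bit strings of arbitrary length. -/
abbrev Bits := List Bool

/-- Bit strings of length `n`. -/
abbrev BStr (n : ℕ) := Fin n → Bool

/-- A fixed-length bit string as a bit string. -/
def BStr.toBits {n : ℕ} (x : BStr n) : Bits := List.ofFn x

/-- The public data of an experiment: the prime order `q` of the Diffie-Hellman group, the length of
encoded group elements, the output length `κ` of the hash function (which is the AEAD key length),
the maximal numbers of parties, of sessions per party and of stages per session, the (unique) user
identifiers and the key identifiers that the server has assigned, and the lengths of the metadata
fields. -/
structure Params where
  q : ℕ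
  q_prime : q.Prime
  elemLen : ℕ
  κ : ℕ
  nP : ℕ
  nS : ℕ
  nT : ℕ
  idLen : ℕ
  kidLen : ℕ
  versLen : ℕ
  ctypeLen : ℕ
  uid : Fin nP → BStr idLen
  uid_injective : Function.Injective uid
  kid : Fin nP → BStr kidLen

instance (pp : Params) : NeZero pp.q := ⟨pp.q_prime.ne_zero⟩

/-- An AEAD scheme with key space `{0,1}^κ` (keys are sampled uniformly). Argument order: key, nonce,
associated data, message (or ciphertext); `none` is the failure symbol. -/
structure AEADScheme (κ : ℕ) where
  encrypt : BStr κ → Bits → Bits → Bits → Bits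
  decrypt : BStr κ → Bits → Bits → Bits → Option Bits
  decrypt_encrypt : ∀ k n ad m, decrypt k n ad (encrypt k n ad m) = some m

/-- The cryptographic primitives: a cyclic group of prime order `q` with a generator and an encoding
of its elements as bit strings, a hash function `{0,1}^* → {0,1}^κ`, and an AEAD scheme. No security
property is assumed. -/
structure Primitives (pp : Params) where
  G : Type
  [group : Group G]
  card_eq : Nat.card G = pp.q
  g : G
  generates : ∀ h : G, h ∈ Subgroup.zpowers g
  encode : G → BStr pp.elemLen
  encode_injective : Function.Injective encode
  hash : Bits → BStr pp.κ
  aead : AEADScheme pp.κ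

attribute [instance] Primitives.group

/-! ## Interactive probabilistic programs and their step count -/

/-- A program that issues operations `q : Q`, each answered by an element of `R q`, and finally
returns a value of type `α`. -/
inductive OracleComp (Q : Type) (R : Q → Type) (α : Type) : Type
  | pure (a : α) : OracleComp Q R α
  | query (q : Q) (k : R q → OracleComp Q R α) : OracleComp Q R α

namespace OracleComp

variable {Q : Type} {R : Q → Type} {Q' : Type} {R' : Q' → Type} {α β σ : Type}

/-- Sequential composition. -/
def bind : OracleComp Q R α → (α → OracleComp Q R β) → OracleComp Q R β
  | .pure a, f => f a
  | .query q k, f => .query q fun r => (k r).bind f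

/-- Runs a program against a stateful randomized oracle. -/
def run (oracle : (q : Q) → σ → PMF (R q × σ)) : OracleComp Q R α → σ → PMF (α × σ)
  | .pure a, s => PMF.pure (a, s)
  | .query q k, s => (oracle q s).bind fun x => (k x.1).run oracle x.2

/-- Runs a program while each of its operations is answered by another program, which keeps a
state. -/
def simulate (answer : (q : Q) → σ → OracleComp Q' R' (R q × σ)) :
    OracleComp Q R α → σ → OracleComp Q' R' (α × σ)
  | .pure a, s => .pure (a, s)
  | .query q k, s => (answer q s).bind fun x => (k x.1).simulate answer x.2

/-- On every run, the total cost of the operations that are issued is at most `n`, where the operation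
`q` costs `w q`. -/
def CostLE (w : Q → ℕ) : OracleComp Q R α → ℕ → Prop
  | .pure _, _ => True
  | .query q k, n => w q ≤ n ∧ ∀ r, (k r).CostLE w (n - w q)

end OracleComp

/-- The uniform distribution on `{0, …, n}`. -/
def uniformUpTo (n : ℕ) : PMF (Fin (n + 1)) := PMF.uniformOfFintype _

/-- The uniform distribution on the exponents `ℤ_q`. -/
def uniformExp (pp : Params) : PMF (Fin pp.q) := PMF.uniformOfFintype _

/-! ## The protocol LINEv2 -/

section Line

variable {pp : Params}

/-- The ASCII encoding of the string `Key`. -/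
def keyLabel : Bits :=
  [false, true, false, false, true, false, true, true,
   false, true, true, false, false, true, false, true,
   false, true, true, true, true, false, false, true]

/-- The public key of the secret key `x`. -/
def Primitives.pub (P : Primitives pp) (x : Fin pp.q) : P.G := P.g ^ (x : ℕ)

/-- The message key `k_e = H(pms ‖ salt ‖ Key)`. -/
def Primitives.messageKey (P : Primitives pp) (pms : BStr pp.elemLen) (salt : BStr 128) :
    BStr pp.κ :=
  P.hash (pms.toBits ++ (salt.toBits ++ keyLabel))

/-- A network message `(vers, ctype, s, c, n, kid_A, kid_B)`; `A` is the sender, `B` the receiver. -/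
structure Packet (pp : Params) where
  vers : BStr pp.versLen
  ctype : BStr pp.ctypeLen
  salt : BStr 128
  ct : Bits
  nonce : BStr (32 + 32)
  kidA : BStr pp.kidLen
  kidB : BStr pp.kidLen

/-- The associated data `RID ‖ SID ‖ kid_A ‖ kid_B ‖ vers ‖ ctype`. -/
def assocData (receiver sender : Fin pp.nP) (kidA kidB : BStr pp.kidLen)
    (vers : BStr pp.versLen) (ctype : BStr pp.ctypeLen) : Bits :=
  (pp.uid receiver).toBits ++ (pp.uid sender).toBits ++ kidA.toBits ++ kidB.toBits ++
    vers.toBits ++ ctype.toBits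

/-- The nonce `ctr ‖ rand`. -/
def mkNonce (ctr : BitVec 32) (rand : BStr 32) : BStr (32 + 32) :=
  Fin.append (fun j : Fin 32 => ctr.getMsbD j) rand

inductive Role
  | initiator
  | responder

inductive Direction
  | sent
  | received

/-- The record of a completed stage: the packet that was sent or received (its transcript), the counter
at the beginning of the stage, and the session key, which is `none` if the stage has rejected and
`some k` if it has accepted with the key `k`. -/
structure StageRecord (pp : Params) where
  dir : Direction
  packet : Packet pp
  ctr : BitVec 32
  key : Option (BStr pp.κ)

/-- The randomness of one stage: a 128-bit salt and the 32 random bits of the nonce. -/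
abbrev StageRand := BStr 128 × BStr 32

/-- A session: role, intended peer, the randomness of all its stages, the protocol state (premaster
secret and counter), the completed stages, and the record of the reveal queries. -/
structure Session (pp : Params) where
  role : Role
  peer : Fin pp.nP
  rand : Fin pp.nT → StageRand
  pms : BStr pp.elemLen
  ctr : BitVec 32
  stages : List (StageRecord pp)
  revSessKey : Set (Fin pp.nT)
  revState : Prop

/-- What the adversary can hand to a session: the request to start it, an application message that is
to be encrypted and sent to the peer, or a packet from the network. -/
inductive Input (pp : Params)
  | start (role : Role) (peer : Fin pp.nP)
  | plaintext (vers : BStr pp.versLen) (ctype : BStr pp.ctypeLen) (m : Bits)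
  | packet (p : Packet pp)

/-- What a session outputs: a packet that it sends, or the plaintext of a packet it has accepted. -/
inductive Output (pp : Params)
  | packet (p : Packet pp)
  | plaintext (m : Bits)

/-- Session establishment: the premaster secret is the peer's public key raised to the own secret
key, the counter is `0`. -/
def Primitives.activate (P : Primitives pp) (sk : Fin pp.q) (role : Role) (peer : Fin pp.nP)
    (peerpk : P.G) (rand : Fin pp.nT → StageRand) : Session pp where
  role := role
  peer := peer
  rand := rand
  pms := P.encode (peerpk ^ (sk : ℕ))
  ctr := 0
  stages := []
  revSessKey := ∅
  revState := False

/-- One stage of a session `π` of party `u` with stage randomness `r`: encryption of an application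
message, or decryption of a packet. -/
def Primitives.runStage (P : Primitives pp) (u : Fin pp.nP) (π : Session pp) (r : StageRand) :
    Input pp → Session pp × Option (Output pp)
  | .start _ _ => (π, none)
  | .plaintext vers ctype m =>
      let k := P.messageKey π.pms r.1
      let n := mkNonce π.ctr r.2
      let ad := assocData π.peer u (pp.kid u) (pp.kid π.peer) vers ctype
      let p : Packet pp :=
        { vers := vers, ctype := ctype, salt := r.1, ct := P.aead.encrypt k n.toBits ad m,
          nonce := n, kidA := pp.kid u, kidB := pp.kid π.peer }
      ({ π with
          ctr := π.ctr + 1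
          stages := π.stages ++ [{ dir := .sent, packet := p, ctr := π.ctr, key := some k }] },
        some (.packet p))
  | .packet p =>
      let k := P.messageKey π.pms p.salt
      let ad := assocData u π.peer p.kidA p.kidB p.vers p.ctype
      match P.aead.decrypt k p.nonce.toBits ad p.ct with
      | some m =>
          ({ π with stages :=
              π.stages ++ [{ dir := .received, packet := p, ctr := π.ctr, key := some k }] },
            some (.plaintext m))
      | none =>
          ({ π with stages :=
              π.stages ++ [{ dir := .received, packet := p, ctr := π.ctr, key := none }] },
            none)

/-! ## The message authentication experiment in the multi-stage key exchange model -/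

/-- The state of the challenger. -/
structure GameState (pp : Params) where
  sk : Fin pp.nP → Fin pp.q
  sessions : Fin pp.nP → Fin pp.nS → Option (Session pp)
  revLongTermKey : Set (Fin pp.nP)
  forged : Prop

/-- The oracle queries; `u` is a party, `i` one of its sessions, `s` a stage. -/
inductive Query (pp : Params)
  | send (u : Fin pp.nP) (i : Fin pp.nS) (m : Input pp)
  | revSessKey (u : Fin pp.nP) (i : Fin pp.nS) (s : Fin pp.nT)
  | revLongTermKey (u : Fin pp.nP)
  | revRand (u : Fin pp.nP) (i : Fin pp.nS) (s : Fin pp.nT)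
  | revState (u : Fin pp.nP) (i : Fin pp.nS) (s : Fin pp.nT)

/-- The type of the answer to a query. -/
def Query.Answer : Query pp → Type
  | .send _ _ _ => Option (Output pp)
  | .revSessKey _ _ _ => Option (BStr pp.κ)
  | .revLongTermKey _ => Fin pp.q
  | .revRand _ _ _ => Option StageRand
  | .revState _ _ _ => Option (BStr pp.elemLen × BitVec 32)

namespace GameState

/-- `π` is a session of `u` with peer `v`, or of `v` with peer `u`. -/
def Between (S : GameState pp) (u v : Fin pp.nP) (π : Session pp) : Prop :=
  ∃ x j, S.sessions x j = some π ∧ ((x = u ∧ π.peer = v) ∨ (x = v ∧ π.peer = u))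

/-- Some session of `v` with peer `u` has sent the packet `p`. -/
def Produced (S : GameState pp) (v u : Fin pp.nP) (p : Packet pp) : Prop :=
  ∃ j π, S.sessions v j = some π ∧ π.peer = u ∧ ∃ r ∈ π.stages, r.dir = .sent ∧ r.packet = p

/-- Freshness of a stage with the given salt in a session between `u` and `v`: neither long-term key
is revealed, no state of a session between `u` and `v` is revealed, and the session key of no stage of a
session between `u` and `v` that uses the same salt (hence the same key) is revealed. -/
def Fresh (S : GameState pp) (u v : Fin pp.nP) (salt : BStr 128) : Prop :=
  u ∉ S.revLongTermKey ∧ v ∉ S.revLongTermKey ∧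
    ∀ π, S.Between u v π → ¬ π.revState ∧
      ∀ s ∈ π.revSessKey, ∀ r, π.stages[(s : ℕ)]? = some r → r.packet.salt ≠ salt

/-- In stage `s`, session `i` of `u` has accepted a packet which no session of its peer with `u` has
sent, and this stage is fresh. -/
def IsForgery (S : GameState pp) (u : Fin pp.nP) (i : Fin pp.nS) (s : Fin pp.nT) : Prop :=
  ∃ π r, S.sessions u i = some π ∧ π.stages[(s : ℕ)]? = some r ∧ s ∉ π.revSessKey ∧
    r.dir = .received ∧ r.key.isSome ∧
    ¬ S.Produced π.peer u r.packet ∧ S.Fresh u π.peer r.packet.salt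

/-- Replaces session `i` of party `u`. -/
def setSession (S : GameState pp) (u : Fin pp.nP) (i : Fin pp.nS) (π : Session pp) :
    GameState pp :=
  { S with sessions := Function.update S.sessions u (Function.update (S.sessions u) i (some π)) }

end GameState

/-- The state of session `π` at the beginning of stage `s`, if that stage has been reached. -/
def Session.stateAt (π : Session pp) (s : Fin pp.nT) : Option (BStr pp.elemLen × BitVec 32) :=
  if (s : ℕ) = π.stages.length then some (π.pms, π.ctr)
  else (π.stages[(s : ℕ)]?).map fun r => (π.pms, r.ctr)

/-- The oracles. A query that makes no sense (an input for a session that has not been started or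
has completed all of its stages, a party that wants to talk to itself) is answered by `none`. A
forgery is recorded in the moment in which the forged packet is accepted. -/
def gameOracle (P : Primitives pp) : (q : Query pp) → GameState pp →
    PMF (q.Answer × GameState pp)
  | .send u i m, S =>
      match S.sessions u i with
      | none =>
          match m with
          | .start role peer =>
              haveI := Classical.propDecidable (peer = u)
              if peer = u then PMF.pure (none, S)
              else
                (PMF.uniformOfFintype (Fin pp.nT → StageRand)).bind fun rand =>
                  PMF.pure (none, S.setSession u i
                    (P.activate (S.sk u) role peer (P.pub (S.sk peer)) rand))
          | _ => PMF.pure (none, S)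
      | some π =>
          if h : π.stages.length < pp.nT then
            let out := P.runStage u π (π.rand ⟨π.stages.length, h⟩) m
            let S' := S.setSession u i out.1
            PMF.pure (out.2,
              { S' with forged := S.forged ∨ S'.IsForgery u i ⟨π.stages.length, h⟩ })
          else PMF.pure (none, S)
  | .revSessKey u i s, S =>
      match S.sessions u i with
      | none => PMF.pure (none, S)
      | some π =>
          PMF.pure ((π.stages[(s : ℕ)]?).bind StageRecord.key,
            S.setSession u i { π with revSessKey := insert s π.revSessKey })
  | .revLongTermKey u, S =>
      PMF.pure (S.sk u, { S with revLongTermKey := insert u S.revLongTermKey })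
  | .revRand u i s, S =>
      PMF.pure ((S.sessions u i).map fun π => π.rand s, S)
  | .revState u i s, S =>
      match S.sessions u i with
      | none => PMF.pure (none, S)
      | some π => PMF.pure (π.stateAt s, S.setSession u i { π with revState := True })

/-- The operations of an adversary: the oracle queries, and uniform sampling from `{0, …, n}`. -/
inductive AdvOp (pp : Params)
  | coin (n : ℕ)
  | game (q : Query pp)

def AdvOp.Answer : AdvOp pp → Type
  | .coin n => Fin (n + 1)
  | .game q => q.Answer

/-- An adversary against message authentication gets all public keys and interacts with the oracles.
There is no bound on its resources. -/
abbrev Adversary (pp : Params) :=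
  (Fin pp.nP → BStr pp.elemLen) → OracleComp (AdvOp pp) AdvOp.Answer Unit

def advOracle (P : Primitives pp) : (q : AdvOp pp) → GameState pp →
    PMF (q.Answer × GameState pp)
  | .coin n, S => (uniformUpTo n).map fun x => (x, S)
  | .game q, S => gameOracle P q S

/-- The state of the challenger after the experiment. -/
def lineAuthExp (P : Primitives pp) (A : Adversary pp) : PMF (GameState pp) :=
  (PMF.uniformOfFintype (Fin pp.nP → Fin pp.q)).bind fun sk =>
    ((A fun u => P.encode (P.pub (sk u))).run (advOracle P)
      { sk := sk, sessions := fun _ _ => none, revLongTermKey := ∅, forged := False }).map Prod.snd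

/-- The probability that the adversary forges a message. -/
def lineAuthAdv (P : Primitives pp) (A : Adversary pp) : ℝ :=
  ((lineAuthExp P A).toOuterMeasure {S | S.forged}).toReal

end Line

/-! ## Algorithms against the primitives, and black-box reductions -/

section Reductions

variable {pp : Params}

/-- The operations of an algorithm against one of the primitives: sampling from `{0, …, n}`, sampling
the randomness of the stages of one session, the group generator, exponentiation, hashing, AEAD
encryption and decryption, and queries `c : C` to the challenger. -/
inductive RedOp (pp : Params) (C : Type)
  | coin (n : ℕ)
  | stageRand
  | gen
  | pow (h : BStr pp.elemLen) (x : ℕ)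
  | hash (x : Bits)
  | encrypt (k : BStr pp.κ) (n ad m : Bits)
  | decrypt (k : BStr pp.κ) (n ad c : Bits)
  | chal (c : C)

def RedOp.Answer {C : Type} (R : C → Type) : RedOp pp C → Type
  | .coin n => Fin (n + 1)
  | .stageRand => Fin pp.nT → StageRand
  | .gen => BStr pp.elemLen
  | .pow _ _ => Option (BStr pp.elemLen)
  | .hash _ => BStr pp.κ
  | .encrypt _ _ _ _ => Bits
  | .decrypt _ _ _ _ => Option Bits
  | .chal c => R c

/-- Each operation is one step; sampling the randomness of `nT` stages is `nT` steps. -/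
def RedOp.cost {C : Type} : RedOp pp C → ℕ
  | .stageRand => pp.nT
  | _ => 1

/-- Exponentiation on encoded group elements; `none` if the string encodes no group element. -/
def Primitives.powEncoded (P : Primitives pp) (h : BStr pp.elemLen) (x : ℕ) :
    Option (BStr pp.elemLen) :=
  haveI := Classical.propDecidable (∃ e, P.encode e = h)
  if hh : ∃ e, P.encode e = h then some (P.encode (hh.choose ^ x)) else none

def redOracle (P : Primitives pp) {C : Type} {R : C → Type} {σ : Type}
    (challenger : (c : C) → σ → PMF (R c × σ)) : (q : RedOp pp C) → σ → PMF (q.Answer R × σ)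
  | .coin n, s => (uniformUpTo n).map fun x => (x, s)
  | .stageRand, s => (PMF.uniformOfFintype (Fin pp.nT → StageRand)).map fun x => (x, s)
  | .gen, s => PMF.pure (P.encode P.g, s)
  | .pow h x, s => PMF.pure (P.powEncoded h x, s)
  | .hash x, s => PMF.pure (P.hash x, s)
  | .encrypt k n ad m, s => PMF.pure (P.aead.encrypt k n ad m, s)
  | .decrypt k n ad c, s => PMF.pure (P.aead.decrypt k n ad c, s)
  | .chal c, s => challenger c s

/-- An algorithm against a primitive whose challenger answers queries `c : C` by elements of `R c`. It
has access to the primitives only through the operations above. -/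
abbrev Algorithm (pp : Params) (C : Type) (R : C → Type) (Out : Type) :=
  OracleComp (RedOp pp C) (RedOp.Answer R) Out

/-- A black-box reduction with input `In` and output `Out`. It prepares the public keys for the
adversary, answers each of the adversary's oracle queries, and, when the adversary has halted,
computes its output. -/
structure Reduction (pp : Params) (In : Type) (C : Type) (R : C → Type) (Out : Type) where
  State : Type
  setup : In → Algorithm pp C R ((Fin pp.nP → BStr pp.elemLen) × State)
  answer : (q : Query pp) → State → Algorithm pp C R (q.Answer × State)
  finish : State → Algorithm pp C R Out

namespace Reduction

variable {In C Out : Type} {R : C → Type}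

/-- The answers to all operations of the adversary; its coins are passed through. -/
def answerOp (B : Reduction pp In C R Out) : (q : AdvOp pp) → B.State →
    Algorithm pp C R (q.Answer × B.State)
  | .coin n, s => .query (.coin n) fun x => .pure (x, s)
  | .game q, s => B.answer q s

/-- The algorithm `B^A`: it runs `A` once, without rewinding. -/
def apply (B : Reduction pp In C R Out) (A : Adversary pp) (x : In) : Algorithm pp C R Out :=
  (B.setup x).bind fun y =>
    ((A y.1).simulate B.answerOp y.2).bind fun z => B.finish z.2

/-- The running time of the reduction, apart from the adversary's own steps: at most `c (nP + 1)` steps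
for the preparation, at most `c (nT + 1)` for each oracle query of the adversary and at most `c` for
the output. -/
def Efficient (B : Reduction pp In C R Out) (c : ℕ) : Prop :=
  (∀ x, (B.setup x).CostLE RedOp.cost (c * (pp.nP + 1))) ∧
  (∀ q s, (B.answer q s).CostLE RedOp.cost (c * (pp.nT + 1))) ∧
  ∀ s, (B.finish s).CostLE RedOp.cost c

end Reduction

/-! ### Collision resistance -/

abbrev CollFinder (pp : Params) := Algorithm pp Empty (fun _ => Empty) (Bits × Bits)

abbrev CollReduction (pp : Params) := Reduction pp Unit Empty (fun _ => Empty) (Bits × Bits)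

def collAdv (P : Primitives pp) (B : CollFinder pp) : ℝ :=
  ((B.run (redOracle P fun c (_ : Unit) => c.elim) ()).toOuterMeasure
    {x | x.1.1 ≠ x.1.2 ∧ P.hash x.1.1 = P.hash x.1.2}).toReal

/-! ### Decisional Diffie-Hellman -/

/-- The (encoded) input `(g, g^a, g^b, z)` of a distinguisher. -/
abbrev DDHInput (pp : Params) :=
  BStr pp.elemLen × BStr pp.elemLen × BStr pp.elemLen × BStr pp.elemLen

abbrev DDHDistinguisher (pp : Params) :=
  DDHInput pp → Algorithm pp Empty (fun _ => Empty) Bool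

abbrev DDHReduction (pp : Params) := Reduction pp (DDHInput pp) Empty (fun _ => Empty) Bool

/-- The output bit of `B` on input `(g, g^a, g^b, g^z)`, where `z` is `a b` if `real` is true and is
uniform otherwise. -/
def ddhExp (P : Primitives pp) (B : DDHDistinguisher pp) (real : Bool) : PMF Bool :=
  (uniformExp pp).bind fun a => (uniformExp pp).bind fun b => (uniformExp pp).bind fun c =>
    let z : ℕ := if real then (a : ℕ) * (b : ℕ) else (c : ℕ)
    ((B (P.encode P.g, P.encode (P.g ^ (a : ℕ)), P.encode (P.g ^ (b : ℕ)),
      P.encode (P.g ^ z))).run (redOracle P fun c (_ : Unit) => c.elim) ()).map Prod.fst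

def ddhAdv (P : Primitives pp) (B : DDHDistinguisher pp) : ℝ :=
  |(ddhExp P B true true).toReal - (ddhExp P B false true).toReal|

/-! ### The keyed hash function as a pseudorandom function -/

/-- The keyed use of the hash function: the key is a group element, which is prepended to the
input. -/
def Primitives.prf (P : Primitives pp) (k : P.G) (x : Bits) : BStr pp.κ :=
  P.hash ((P.encode k).toBits ++ x)

inductive PRFQuery
  | eval (x : Bits)
  | challenge (y : Bits)

/-- The inputs that have been evaluated, and the challenge input. -/
structure PRFState where
  queried : List Bits
  challenged : Option Bits

/-- The challenge query is answered once, by the value of the function (`real`) or by a uniform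
string. The challenge input may not be evaluated. Forbidden queries are answered by `none`. -/
def prfOracle (P : Primitives pp) (k : P.G) (real : Bool) : (c : PRFQuery) → PRFState →
    PMF (Option (BStr pp.κ) × PRFState)
  | .eval x, s =>
      if s.challenged = some x then PMF.pure (none, s)
      else PMF.pure (some (P.prf k x), { s with queried := x :: s.queried })
  | .challenge y, s =>
      if s.challenged.isSome ∨ y ∈ s.queried then PMF.pure (none, s)
      else
        (if real then PMF.pure (P.prf k y) else PMF.uniformOfFintype (BStr pp.κ)).map fun z =>
          (some z, { s with challenged := some y })

abbrev PRFDistinguisher (pp : Params) :=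
  Algorithm pp PRFQuery (fun _ => Option (BStr pp.κ)) Bool

abbrev PRFReduction (pp : Params) :=
  Reduction pp Unit PRFQuery (fun _ => Option (BStr pp.κ)) Bool

/-- The output bit of `B`. The key is a uniform group element. -/
def prfExp (P : Primitives pp) (B : PRFDistinguisher pp) (real : Bool) : PMF Bool :=
  (uniformExp pp).bind fun c =>
    (B.run (redOracle P (prfOracle P (P.g ^ (c : ℕ)) real))
      { queried := [], challenged := none }).map Prod.fst

def prfAdv (P : Primitives pp) (B : PRFDistinguisher pp) : ℝ :=
  |(prfExp P B true true).toReal - (prfExp P B false true).toReal|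

/-! ### Authenticity of the AEAD scheme -/

inductive AEADQuery
  | encrypt (m ad n : Bits)
  | decrypt (c ad n : Bits)

def AEADQuery.Answer : AEADQuery → Type
  | .encrypt _ _ _ => Bits
  | .decrypt _ _ _ => Option Bits

/-- The triples (ciphertext, nonce, associated data) that have been produced, and the winning flag. -/
structure AEADState where
  produced : List (Bits × Bits × Bits)
  win : Bool

def aeadOracle {κ : ℕ} (E : AEADScheme κ) (k : BStr κ) : (q : AEADQuery) → AEADState →
    PMF (q.Answer × AEADState)
  | .encrypt m ad n, s =>
      let c := E.encrypt k n ad m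
      PMF.pure (c, { s with produced := (c, n, ad) :: s.produced })
  | .decrypt c ad n, s =>
      if (c, n, ad) ∈ s.produced then PMF.pure (none, s)
      else
        match E.decrypt k n ad c with
        | some m => PMF.pure (some m, { s with win := true })
        | none => PMF.pure (none, s)

abbrev AEADForger (pp : Params) := Algorithm pp AEADQuery AEADQuery.Answer Unit

abbrev AEADReduction (pp : Params) := Reduction pp Unit AEADQuery AEADQuery.Answer Unit

def aeadAuthAdv (P : Primitives pp) (B : AEADForger pp) : ℝ :=
  (((PMF.uniformOfFintype (BStr pp.κ)).bind fun k =>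
    B.run (redOracle P (aeadOracle P.aead k)) { produced := [], win := false }).toOuterMeasure
      {x | x.2.win = true}).toReal

end Reductions

/-- A function of the security parameter is negligible. -/
def Negligible (f : ℕ → ℝ) : Prop :=
  Asymptotics.SuperpolynomialDecay Filter.atTop (fun l : ℕ => (l : ℝ)) f

end

/-! ### Interactive programs: composition, invariants, costs and a coupled union bound. -/

namespace OracleComp

variable {Q : Type} {R : Q → Type} {Q' : Type} {R' : Q' → Type} {α β γ σ τ : Type}

/-! Suppose that a fresh stage between two parties accepts a packet that was never sent, and let `s`
be its salt. The stage worth guessing is not the forging one but the first stage between these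
parties, in a session of either of them, that uses `s`. The simulator for a guess lets the guessed
stage fix its salt (the star) and from then on answers every operation between the two parties with
that salt under one distinguished key. Repeated salts, accidental or chosen by the adversary in
delivered packets, therefore cost nothing. The simulator gives up when a long-term key or a session
state of the guessed parties is revealed, when the key of the star is revealed, or when the salt of
the guessed stage is not new. The revelations contradict freshness of the stages with the star, and
the last event means that the guess was not a first use.

With the true keys, a live simulator that has fixed `s` recognizes the forgery. The associated data
are injective in their fields (`assocData_inj`), so salt, ciphertext, nonce and associated data
determine the packet. An unsent packet with salt `s` is a triple outside the log, and its acceptance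
sets `win`. To make this precise, the experiment and the simulators for all guesses run side by side
on common randomness. The invariant `Coupled` says that the salt of every fresh stage is the star of
some live simulator, and that a simulator whose stage lies ahead is alive unless a secret is out.
`Coupled.exists_guess` extracts the relevant simulator, `Coupled.step` preserves the invariant, and
`OracleComp.run_le_sum` turns it into Pr[forged] ≤ ∑ over guesses of Pr[simulator wins]
(`forged_le_sum`). Averaging over a uniform guess costs the factor `Fintype.card (Guess pp)`.

The simulator touches the secrets of the guessed pair only through a `PairService`. Its winning
probability `simWin` depends on the keys `K` of ordinary salts and `L` of the star. With the keys
derived from `g^(ab)` this is the real DDH experiment. With the keys derived from `g^c` it is both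
the random DDH experiment and the real PRF experiment. With a uniform star key it is both the ideal
PRF experiment and the AEAD experiment, where `win` is a forgery against the challenger. The
transitions are equalities of distributions (`ddhExp_eq`, `prfExp_true`, `prfExp_false`,
`aeadExp_eq`), so the advantages telescope and no further error term arises. -/

theorem run_bind (o : (q : Q) → σ → PMF (R q × σ)) (c : OracleComp Q R α)
    (f : α → OracleComp Q R β) (s : σ) :
    (c.bind f).run o s = (c.run o s).bind fun x => (f x.1).run o x.2 := by
  induction c generalizing s with
  | pure a => simp [OracleComp.bind, run]
  | query q k ih => simp [OracleComp.bind, run, ih]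

theorem bind_assoc (c : OracleComp Q R α) (f : α → OracleComp Q R β) (g : β → OracleComp Q R γ) :
    (c.bind f).bind g = c.bind fun a => (f a).bind g := by
  induction c with
  | pure a => rfl
  | query q k ih => simp [OracleComp.bind, ih]

theorem simulate_bind (answer : (q : Q) → σ → OracleComp Q' R' (R q × σ)) (c : OracleComp Q R α)
    (f : α → OracleComp Q R β) (s : σ) :
    (c.bind f).simulate answer s = (c.simulate answer s).bind fun x => (f x.1).simulate answer x.2 := by
  induction c generalizing s with
  | pure a => rfl
  | query q k ih => simp [OracleComp.bind, simulate, ih, bind_assoc]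

/-- The oracle obtained by answering every operation with a program that runs against `o`. -/
noncomputable def compOracle (o : (q : Q') → τ → PMF (R' q × τ))
    (answer : (q : Q) → σ → OracleComp Q' R' (R q × σ)) (q : Q) (s : σ × τ) :
    PMF (R q × (σ × τ)) :=
  ((answer q s.1).run o s.2).map fun x => (x.1.1, (x.1.2, x.2))

/-- Two layers of simulation become one run against an oracle with a product state. This allows
reductions and simulators to be compared with an oracle one operation at a time. -/
theorem run_simulate (o : (q : Q') → τ → PMF (R' q × τ))
    (answer : (q : Q) → σ → OracleComp Q' R' (R q × σ)) (c : OracleComp Q R α) (s : σ) (t : τ) :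
    (c.simulate answer s).run o t =
      (c.run (compOracle o answer) (s, t)).map fun x => ((x.1, x.2.1), x.2.2) := by
  induction c generalizing s t with
  | pure a => simp [simulate, run, PMF.pure_map]
  | query q k ih =>
    simp [simulate, run, run_bind, compOracle, ih, PMF.map_bind, PMF.bind_map, Function.comp_def]

/-- A property of the state that every operation preserves is preserved by a run. -/
theorem run_support (o : (q : Q) → σ → PMF (R q × σ)) (I : σ → Prop)
    (h : ∀ q s, I s → ∀ x ∈ (o q s).support, I x.2) (c : OracleComp Q R α) (s : σ) (hs : I s) :
    ∀ x ∈ (c.run o s).support, I x.2 := by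
  induction c generalizing s with
  | pure a => simp [run, hs]
  | query q k ih =>
    intro x hx
    simp only [run, PMF.mem_support_bind_iff] at hx
    obtain ⟨y, hy, hx⟩ := hx
    exact ih _ _ (h q s hs y hy) x hx

theorem _root_.PMF.bind_congr_support {p : PMF α} {f g : α → PMF β}
    (h : ∀ a ∈ p.support, f a = g a) : p.bind f = p.bind g := by
  ext b
  simp only [PMF.bind_apply]
  refine tsum_congr fun a => ?_
  by_cases ha : a ∈ p.support
  · rw [h a ha]
  · rw [(PMF.apply_eq_zero_iff p a).2 ha]; simp

/-- If the state of one oracle is a projection of the state of another one, then so are the results of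
the runs. -/
theorem run_map_state (o : (q : Q) → σ → PMF (R q × σ)) (o' : (q : Q) → τ → PMF (R q × τ))
    (f : σ → τ) (I : σ → Prop) (h : ∀ q s, I s → ∀ x ∈ (o q s).support, I x.2)
    (hf : ∀ q s, I s → (o q s).map (fun x => (x.1, f x.2)) = o' q (f s))
    (c : OracleComp Q R α) (s : σ) (hs : I s) :
    (c.run o s).map (fun x => (x.1, f x.2)) = c.run o' (f s) := by
  induction c generalizing s with
  | pure a => simp [run, PMF.pure_map]
  | query q k ih =>
    simp only [run, PMF.map_bind, ← hf q s hs, PMF.bind_map, Function.comp_def]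
    exact PMF.bind_congr_support fun x hx => ih _ _ (h q s hs x hx)

theorem CostLE.mono {w : Q → ℕ} {c : OracleComp Q R α} {m n : ℕ} (h : c.CostLE w m)
    (hmn : m ≤ n) : c.CostLE w n := by
  induction c generalizing m n with
  | pure a => trivial
  | query q k ih =>
    exact ⟨h.1.trans hmn, fun r => ih r (h.2 r) (Nat.sub_le_sub_right hmn _)⟩

theorem CostLE.bind {w : Q → ℕ} {c : OracleComp Q R α} {f : α → OracleComp Q R β} {m n : ℕ}
    (hc : c.CostLE w m) (hf : ∀ a, (f a).CostLE w n) : (c.bind f).CostLE w (m + n) := by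
  induction c generalizing m with
  | pure a => exact (hf a).mono (by omega)
  | query q k ih =>
    refine ⟨hc.1.trans (by omega), fun r => (ih r (hc.2 r)).mono ?_⟩
    have := hc.1
    omega

theorem CostLE.bind_le {w : Q → ℕ} {c : OracleComp Q R α} {f : α → OracleComp Q R β} {m n k : ℕ}
    (hc : c.CostLE w m) (hk : m + n ≤ k) (hf : ∀ a, (f a).CostLE w n) : (c.bind f).CostLE w k :=
  (hc.bind hf).mono hk

/-- The weight of an upper operation serves as the budget of the program answering it, so budgets
pass through a layer of simulation unchanged. -/
theorem CostLE.simulate {w : Q → ℕ} {w' : Q' → ℕ}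
    {answer : (q : Q) → σ → OracleComp Q' R' (R q × σ)}
    (h : ∀ q s, (answer q s).CostLE w' (w q)) {c : OracleComp Q R α} {n : ℕ}
    (hc : c.CostLE w n) (s : σ) : (c.simulate answer s).CostLE w' n := by
  induction c generalizing n s with
  | pure a => trivial
  | query q k ih =>
    have := CostLE.bind (n := n - w q) (h q s) fun x => ih x.1 (hc.2 x.1) x.2
    rwa [Nat.add_sub_cancel' hc.1] at this

open scoped ENNReal in
/-- A union bound for coupled runs: as long as `E` has not happened, the runs indexed by `Γ` receive
the same answers as the run against `o`, and when `E` happens, one of them reaches `W`. -/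
theorem run_le_sum {ι : Type} (o : (q : Q) → σ → PMF (R q × σ)) (E : Set σ)
    (o' : ι → (q : Q) → τ → PMF (R q × τ)) (W : Set τ) (J : σ → Finset ι → (ι → τ) → Prop)
    (hW : ∀ i q t, t ∈ W → ∀ x ∈ (o' i q t).support, x.2 ∈ W)
    (hE : ∀ s Γ t, J s Γ t → s ∉ E)
    (hstep : ∀ s Γ t, J s Γ t → ∀ q, ∃ (Ω : Type) (D : PMF Ω) (f : Ω → R q × σ)
      (h : ι → Ω → R q × τ), o q s = D.map f ∧ (∀ i ∈ Γ, o' i q (t i) = D.map (h i)) ∧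
      ∀ ω, (∃ i ∈ Γ, (h i ω).2 ∈ W) ∨
        ∃ Γ' ⊆ Γ, (∀ i ∈ Γ', (h i ω).1 = (f ω).1) ∧ J (f ω).2 Γ' fun i => (h i ω).2)
    (c : OracleComp Q R α) (s : σ) (Γ : Finset ι) (t : ι → τ) (hJ : J s Γ t) :
    (c.run o s).toOuterMeasure {x | x.2 ∈ E} ≤
      ∑ i ∈ Γ, (c.run (o' i) (t i)).toOuterMeasure {x | x.2 ∈ W} := by
  induction c generalizing s Γ t with
  | pure a =>
    -- The invariant excludes `E`, so a run that stops while it holds contributes nothing on the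
    -- left.
    have h0 : ((pure a : OracleComp Q R α).run o s).toOuterMeasure {x | x.2 ∈ E} = 0 := by
      simp [run, PMF.toOuterMeasure_pure_apply, hE s Γ t hJ]
    rw [h0]; exact zero_le
  | query q k ih =>
    obtain ⟨Ω, D, f, h, hf, hh, hω⟩ := hstep s Γ t hJ q
    have h2 : ∀ i ∈ Γ, ((query q k : OracleComp Q R α).run (o' i) (t i)).toOuterMeasure
        {x | x.2 ∈ W} = ∑' ω, D ω * ((k (h i ω).1).run (o' i) (h i ω).2).toOuterMeasure
          {x | x.2 ∈ W} := by
      intro i hi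
      rw [run, hh i hi, PMF.bind_map, PMF.toOuterMeasure_bind_apply]
      rfl
    rw [Finset.sum_congr rfl h2, run, hf, PMF.bind_map, PMF.toOuterMeasure_bind_apply,
      ← Summable.tsum_finsetSum fun _ _ => ENNReal.summable]
    refine ENNReal.tsum_le_tsum fun ω => ?_
    rw [← Finset.mul_sum]
    gcongr
    rcases hω ω with ⟨i, hi, hw⟩ | ⟨Γ', hΓ, ha, hJ'⟩
    -- `W` is absorbing, so the winning run alone has probability one, which dominates whatever the
    -- left side does from here on.
    · refine le_trans ?_ (Finset.single_le_sum (fun _ _ => zero_le) hi)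
      have h1 : ((k (h i ω).1).run (o' i) (h i ω).2).toOuterMeasure {x | x.2 ∈ W} = 1 := by
        rw [PMF.toOuterMeasure_apply_eq_one_iff]
        exact run_support (o' i) (· ∈ W) (hW i) _ _ hw
      rw [h1]
      refine (MeasureTheory.measure_mono (Set.subset_univ _)).trans (le_of_eq ?_)
      rw [PMF.toOuterMeasure_apply_eq_one_iff]
      exact Set.subset_univ _
    -- The surviving runs have received the same answer and hence continue with the same program;
    -- the terms of the others are simply dropped.
    · refine (ih _ _ Γ' _ hJ').trans ?_
      rw [Finset.sum_congr rfl fun i hi => by rw [← ha i hi]]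
      exact Finset.sum_le_sum_of_subset hΓ

end OracleComp

noncomputable section

variable {pp : Params}

/-! ## The reductions -/

/-- A guess of two distinct parties, and of a stage of a session that the first one of them has with the
second one. -/
abbrev Guess (pp : Params) :=
  {p : Fin pp.nP × Fin pp.nP // p.1 ≠ p.2} × Fin pp.nS × Fin pp.nT

namespace Guess

/-- `x` and `y` are the two guessed parties. -/
def Pair (g : Guess pp) (x y : Fin pp.nP) : Prop :=
  (x = g.1.1.1 ∧ y = g.1.1.2) ∨ (x = g.1.1.2 ∧ y = g.1.1.1)

instance (g : Guess pp) (x y : Fin pp.nP) : Decidable (g.Pair x y) :=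
  inferInstanceAs (Decidable (_ ∨ _))

/-- `x` is one of the two guessed parties. -/
def Mem (g : Guess pp) (x : Fin pp.nP) : Prop := x = g.1.1.1 ∨ x = g.1.1.2

instance (g : Guess pp) (x : Fin pp.nP) : Decidable (g.Mem x) :=
  inferInstanceAs (Decidable (_ ∨ _))

/-- Stage `n` of session `i` of `u` with peer `v` is the guessed stage. -/
def IsStage (g : Guess pp) (u v : Fin pp.nP) (i : Fin pp.nS) (n : ℕ) : Prop :=
  u = g.1.1.1 ∧ v = g.1.1.2 ∧ i = g.2.1 ∧ n = (g.2.2 : ℕ)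

instance (g : Guess pp) (u v : Fin pp.nP) (i : Fin pp.nS) (n : ℕ) :
    Decidable (g.IsStage u v i n) :=
  inferInstanceAs (Decidable (_ ∧ _))

end Guess

/-- What a simulator knows of a session. The premaster secret is not used if the session is between the
guessed parties. A stage is recorded by its salt, its counter, and whether it has accepted. -/
structure SimSession (pp : Params) where
  peer : Fin pp.nP
  rand : Fin pp.nT → StageRand
  pms : BStr pp.elemLen
  ctr : BitVec 32
  stages : List (BStr 128 × BitVec 32 × Bool)

/-- The bookkeeping of a simulator. The secret keys of the guessed parties are not used. -/
structure SimState (pp : Params) where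
  guess : Guess pp
  pk : Fin pp.nP → BStr pp.elemLen
  sk : Fin pp.nP → Fin pp.q
  sessions : Fin pp.nP → Fin pp.nS → Option (SimSession pp)

def SimState.setSession (s : SimState pp) (u : Fin pp.nP) (i : Fin pp.nS) (π : SimSession pp) :
    SimState pp :=
  { s with sessions := Function.update s.sessions u (Function.update (s.sessions u) i (some π)) }

/-- The operations of a simulator. Encryption and decryption in sessions between the guessed parties
are indicated by `pairEnc` and `pairDec` (the Boolean tells whether this is the guessed stage);
`reveal` asks for the message key of such a session, and `abort` gives up. -/
inductive SimOp (pp : Params)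
  | coin (n : ℕ)
  | stageRand
  | pow (h : BStr pp.elemLen) (x : ℕ)
  | hash (x : Bits)
  | encrypt (k : BStr pp.κ) (n ad m : Bits)
  | decrypt (k : BStr pp.κ) (n ad c : Bits)
  | pairEnc (first : Bool) (salt : BStr 128) (n ad m : Bits)
  | pairDec (first : Bool) (salt : BStr 128) (n ad c : Bits)
  | reveal (salt : BStr 128)
  | abort

def SimOp.Answer : SimOp pp → Type
  | .coin n => Fin (n + 1)
  | .stageRand => Fin pp.nT → StageRand
  | .pow _ _ => Option (BStr pp.elemLen)
  | .hash _ => BStr pp.κ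
  | .encrypt _ _ _ _ => Bits
  | .decrypt _ _ _ _ => Option Bits
  | .pairEnc _ _ _ _ _ => Bits
  | .pairDec _ _ _ _ _ => Option Bits
  | .reveal _ => BStr pp.κ
  | .abort => Unit

def SimOp.cost : SimOp pp → ℕ
  | .stageRand => pp.nT
  | .pairEnc _ _ _ _ _ => 2
  | .pairDec _ _ _ _ _ => 2
  | _ => 1

/-- The input of the hash function from which a message key is derived. -/
def keyInput (pms : BStr pp.elemLen) (salt : BStr 128) : Bits :=
  pms.toBits ++ (salt.toBits ++ keyLabel)

/-- The simulation of the oracles of the authentication experiment. -/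
def simAnswer : (q : Query pp) → SimState pp →
    OracleComp (SimOp pp) SimOp.Answer (q.Answer × SimState pp)
  | .send u i m, s =>
      match s.sessions u i with
      | none =>
          match m with
          | .start _ peer =>
              if peer = u then .pure (none, s)
              else
                .query .stageRand fun rand =>
                  if s.guess.Pair u peer then
                    .pure (none, s.setSession u i ⟨peer, rand, fun _ => false, 0, []⟩)
                  else
                    .query (.pow (if s.guess.Mem u then s.pk u else s.pk peer)
                      (if s.guess.Mem u then s.sk peer else s.sk u : Fin pp.q)) fun pms =>
                      .pure (none, s.setSession u i
                        ⟨peer, rand, Option.getD pms fun _ => false, 0, []⟩)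
          | _ => .pure (none, s)
      | some π =>
          if h : π.stages.length < pp.nT then
            match m with
            | .start _ _ => .pure (none, s)
            | .plaintext vers ctype m =>
                let r := π.rand ⟨π.stages.length, h⟩
                let n := mkNonce π.ctr r.2
                let ad := assocData π.peer u (pp.kid u) (pp.kid π.peer) vers ctype
                let fin : Bits → Option (Output pp) × SimState pp := fun c =>
                  (some (.packet ⟨vers, ctype, r.1, c, n, pp.kid u, pp.kid π.peer⟩),
                    s.setSession u i { π with
                      ctr := π.ctr + 1, stages := π.stages ++ [(r.1, π.ctr, true)] })
                if s.guess.Pair u π.peer then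
                  .query (.pairEnc (s.guess.IsStage u π.peer i π.stages.length) r.1 n.toBits ad m)
                    fun c => .pure (fin c)
                else
                  .query (.hash (keyInput π.pms r.1)) fun k =>
                    .query (.encrypt k n.toBits ad m) fun c => .pure (fin c)
            | .packet p =>
                let ad := assocData u π.peer p.kidA p.kidB p.vers p.ctype
                let fin : Option Bits → Option (Output pp) × SimState pp := fun m =>
                  (m.map .plaintext, s.setSession u i { π with
                    stages := π.stages ++ [(p.salt, π.ctr, m.isSome)] })
                if s.guess.Pair u π.peer then
                  .query (.pairDec (s.guess.IsStage u π.peer i π.stages.length) p.salt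
                    p.nonce.toBits ad p.ct) fun m => .pure (fin m)
                else
                  .query (.hash (keyInput π.pms p.salt)) fun k =>
                    .query (.decrypt k p.nonce.toBits ad p.ct) fun m => .pure (fin m)
          else .pure (none, s)
  | .revSessKey u i t, s =>
      match s.sessions u i with
      | none => .pure (none, s)
      | some π =>
          match π.stages[(t : ℕ)]? with
          | some (salt, _, true) =>
              if s.guess.Pair u π.peer then .query (.reveal salt) fun k => .pure (some k, s)
              else .query (.hash (keyInput π.pms salt)) fun k => .pure (some k, s)
          | _ => .pure (none, s)
  | .revLongTermKey u, s =>
      if s.guess.Mem u then .query .abort fun _ => .pure (s.sk u, s) else .pure (s.sk u, s)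
  | .revRand u i t, s => .pure ((s.sessions u i).map fun π => π.rand t, s)
  | .revState u i t, s =>
      match s.sessions u i with
      | none => .pure (none, s)
      | some π =>
          if s.guess.Pair u π.peer then .query .abort fun _ => .pure (none, s)
          else
            .pure (if (t : ℕ) = π.stages.length then some (π.pms, π.ctr)
              else (π.stages[(t : ℕ)]?).map fun r => (π.pms, r.2.1), s)

/-- The answers to all operations of the adversary. -/
def simAdvAnswer : (q : AdvOp pp) → SimState pp →
    OracleComp (SimOp pp) SimOp.Answer (q.Answer × SimState pp)
  | .coin n, s => .query (.coin n) fun x => .pure (x, s)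
  | .game q, s => simAnswer q s

/-- The bookkeeping about the message keys of the guessed parties: the salts that have been used, the
salt of the guessed stage, the triples (ciphertext, nonce, associated data) that were produced with this
salt together with their plaintexts, and the flags for failure and for a forgery with this salt. -/
structure Track where
  used : List (BStr 128)
  star : Option (BStr 128)
  log : List ((Bits × Bits × Bits) × Bits)
  dead : Bool
  win : Bool

namespace Track

def init : Track := ⟨[], none, [], false, false⟩

/-- Success and failure are both final: every later pair operation of a simulator in such a state
gets a default answer and changes nothing. -/
def Done (s : Track) : Prop := s.dead = true ∨ s.win = true

instance (s : Track) : Decidable s.Done := inferInstanceAs (Decidable (_ ∨ _))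

def use (s : Track) (salt : BStr 128) : Track := { s with used := salt :: s.used }

def fix (s : Track) (salt : BStr 128) : Track :=
  { s with used := salt :: s.used, star := some salt }

def add (s : Track) (x : Bits × Bits × Bits) (m : Bits) : Track :=
  { s with log := (x, m) :: s.log }

def kill (s : Track) : Track := { s with dead := true }

/-- The flag is overwritten rather than accumulated; this is harmless because decryptions are
carried out only while it is still unset. -/
def accept (s : Track) (m : Option Bits) : Track := { s with win := m.isSome }

end Track

section Service

variable {C : Type} {R : C → Type}

/-- Programs for the message keys of the guessed parties: the key of a salt, the key of the guessed
salt, and encryption and decryption with the latter. -/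
structure PairService (pp : Params) (C : Type) (R : C → Type) where
  key : BStr 128 → Algorithm pp C R (BStr pp.κ)
  fix : BStr 128 → Algorithm pp C R (BStr pp.κ)
  enc : BStr pp.κ → Bits → Bits → Bits → Algorithm pp C R Bits
  dec : BStr pp.κ → Bits → Bits → Bits → Algorithm pp C R (Option Bits)

namespace PairService

def starEnc (V : PairService pp C R) (k : BStr pp.κ) (n ad m : Bits) (s : Track) :
    Algorithm pp C R (Bits × (Track × BStr pp.κ)) :=
  (V.enc k n ad m).bind fun c => .pure (c, (s.add (c, n, ad) m, k))

/-- Logged triples are answered from the log because the AEAD challenger refuses to decrypt what it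
has produced. Any other triple that decrypts is a forgery. -/
def starDec (V : PairService pp C R) (k : BStr pp.κ) (n ad c : Bits) (s : Track) :
    Algorithm pp C R (Option Bits × (Track × BStr pp.κ)) :=
  match s.log.lookup (c, n, ad) with
  | some m => .pure (some m, (s, k))
  | none => (V.dec k n ad c).bind fun m => .pure (m, (s.accept m, k))

/-- The answers to the operations of a simulator. The second component of the state is the key of the
guessed salt, as far as it is known. -/
def answer (V : PairService pp C R) : (op : SimOp pp) → Track × BStr pp.κ →
    Algorithm pp C R (op.Answer × (Track × BStr pp.κ))
  | .coin n, s => .query (.coin n) fun x => .pure (x, s)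
  | .stageRand, s => .query .stageRand fun x => .pure (x, s)
  | .pow h x, s => .query (.pow h x) fun x => .pure (x, s)
  | .hash x, s => .query (.hash x) fun x => .pure (x, s)
  | .encrypt k n ad m, s => .query (.encrypt k n ad m) fun x => .pure (x, s)
  | .decrypt k n ad c, s => .query (.decrypt k n ad c) fun x => .pure (x, s)
  | .pairEnc first salt n ad m, (s, k) =>
      if s.Done then .pure ([], (s, k))
      else if first then
        if s.star = none ∧ salt ∉ s.used then
          (V.fix salt).bind fun k' => V.starEnc k' n ad m (s.fix salt)
        else .pure ([], (s.kill, k))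
      else if s.star = some salt then V.starEnc k n ad m s
      else (V.key salt).bind fun k' =>
        .query (.encrypt k' n ad m) fun c => .pure (c, (s.use salt, k))
  | .pairDec first salt n ad c, (s, k) =>
      if s.Done then .pure (none, (s, k))
      else if first then
        if s.star = none ∧ salt ∉ s.used then
          (V.fix salt).bind fun k' => V.starDec k' n ad c (s.fix salt)
        else .pure (none, (s.kill, k))
      else if s.star = some salt then V.starDec k n ad c s
      else (V.key salt).bind fun k' =>
        .query (.decrypt k' n ad c) fun m => .pure (m, (s.use salt, k))
  | .reveal salt, (s, k) =>
      if s.Done then .pure (fun _ => false, (s, k))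
      else if s.star = some salt then .pure (fun _ => false, (s.kill, k))
      else (V.key salt).bind fun k' => .pure (k', (s.use salt, k))
  | .abort, (s, k) => .pure ((), (if s.Done then s else s.kill, k))

end PairService

/-- Samples the secret keys of the first `n` parties and computes their public keys. -/
def sampleKeys (C : Type) (R : C → Type) (g : BStr pp.elemLen) :
    (n : ℕ) → Algorithm pp C R ((Fin n → Fin pp.q) × (Fin n → BStr pp.elemLen))
  | 0 => .pure (Fin.elim0, Fin.elim0)
  | n + 1 =>
      -- `coin n` samples from `n + 1` values, whence `q - 1` and the cast along `q - 1 + 1 = q`.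
      .query (.coin (pp.q - 1)) fun x =>
        .query (.pow g (Fin.val (n := pp.q - 1 + 1) x)) fun h =>
          (sampleKeys C R g n).bind fun y =>
            .pure (Fin.cons (Fin.cast (Nat.sub_add_cancel pp.q_prime.one_le) x) y.1,
              Fin.cons (Option.getD h fun _ => false) y.2)

/-- The secret keys that a simulator uses. -/
def Guess.mask (g : Guess pp) (sk : Fin pp.nP → Fin pp.q) : Fin pp.nP → Fin pp.q :=
  fun x => if g.Mem x then 0 else sk x

/-- The initial bookkeeping of a simulator. -/
def simInit (g : Guess pp) (sk : Fin pp.nP → Fin pp.q) (pk : Fin pp.nP → BStr pp.elemLen) :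
    SimState pp := ⟨g, pk, g.mask sk, fun _ _ => none⟩

/-- Uniform sampling of a guess. -/
def decodeGuess [Nonempty (Guess pp)] (x : Fin (Fintype.card (Guess pp) - 1 + 1)) : Guess pp :=
  (Fintype.equivFin (Guess pp)).symm
    (Fin.cast (Nat.sub_add_cancel Fintype.card_pos) x)

/-- The reduction that guesses a stage and uses the service `V z`, where `z` is a group element that
is computed in the preparation. -/
def pairReduction {In Out : Type} [Nonempty (Guess pp)]
    (V : BStr pp.elemLen → PairService pp C R) (out : Bool → Out)
    (setup : In → Algorithm pp C R
      (((Fin pp.nP → Fin pp.q) × (Fin pp.nP → BStr pp.elemLen)) × BStr pp.elemLen))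
    (embed : In → Guess pp → (Fin pp.nP → BStr pp.elemLen) → (Fin pp.nP → BStr pp.elemLen)) :
    Reduction pp In C R Out where
  State := SimState pp × (Track × BStr pp.κ) × BStr pp.elemLen
  setup x := .query (.coin (Fintype.card (Guess pp) - 1)) fun g =>
    (setup x).bind fun y =>
      let pk := embed x (decodeGuess g) y.1.2
      .pure (pk, (simInit (decodeGuess g) y.1.1 pk, (Track.init, fun _ => false), y.2))
  answer q s :=
    ((simAnswer q s.1).simulate (V s.2.2).answer s.2.1).bind fun x =>
      .pure (x.1.1, (x.1.2, x.2, s.2.2))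
  finish s := .pure (out s.2.1.1.win)

end Service

/-- The message keys are computed from the group element `z`. -/
def hashService (z : BStr pp.elemLen) : PairService pp Empty (fun _ => Empty) where
  key salt := .query (.hash (keyInput z salt)) .pure
  fix salt := .query (.hash (keyInput z salt)) .pure
  enc k n ad m := .query (.encrypt k n ad m) .pure
  dec k n ad c := .query (.decrypt k n ad c) .pure

/-- The message keys are values of the pseudorandom function, and the key of the guessed salt is the
answer to the challenge. -/
def prfService : PairService pp PRFQuery (fun _ => Option (BStr pp.κ)) where
  key salt := .query (.chal (.eval (salt.toBits ++ keyLabel))) fun k =>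
    .pure (Option.getD k fun _ => false)
  fix salt := .query (.chal (.challenge (salt.toBits ++ keyLabel))) fun k =>
    .pure (Option.getD k fun _ => false)
  enc k n ad m := .query (.encrypt k n ad m) .pure
  dec k n ad c := .query (.decrypt k n ad c) .pure

/-- The message keys are computed from the group element `z`, except that the key of the guessed salt
is the one of the challenger. -/
def aeadService (z : BStr pp.elemLen) : PairService pp AEADQuery AEADQuery.Answer where
  key salt := .query (.hash (keyInput z salt)) .pure
  fix _ := .pure fun _ => false
  enc _ n ad m := .query (.chal (.encrypt m ad n)) .pure
  dec _ n ad c := .query (.chal (.decrypt c ad n)) .pure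

/-- The reduction to the decisional Diffie-Hellman problem: `g^a` and `g^b` become the public keys of
the guessed parties. -/
def ddhReduction (pp : Params) [Nonempty (Guess pp)] : DDHReduction pp :=
  pairReduction hashService id
    (fun x => (sampleKeys _ _ x.1 pp.nP).bind fun y => .pure (y, x.2.2.2))
    fun x g pk => Function.update (Function.update pk g.1.1.1 x.2.1) g.1.1.2 x.2.2.1

/-- The reduction to the pseudorandomness of the keyed hash function. -/
def prfReduction (pp : Params) [Nonempty (Guess pp)] : PRFReduction pp :=
  pairReduction (fun _ => prfService) id
    (fun _ => .query .gen fun g =>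
      (sampleKeys _ _ g pp.nP).bind fun y => .pure (y, fun _ => false))
    fun _ _ pk => pk

/-- The reduction to the authenticity of the AEAD scheme. -/
def aeadReduction (pp : Params) [Nonempty (Guess pp)] : AEADReduction pp :=
  pairReduction aeadService (fun _ => ())
    (fun _ => .query .gen fun g => .query (.coin (pp.q - 1)) fun c =>
      .query (.pow g (Fin.val (n := pp.q - 1 + 1) c)) fun z =>
        (sampleKeys _ _ g pp.nP).bind fun y => .pure (y, Option.getD z fun _ => false))
    fun _ _ pk => pk

/-- A reduction that gives up at once. -/
def trivialReduction {pp : Params} {In C Out : Type} {R : C → Type} (o : Out) :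
    Reduction pp In C R Out where
  State := Unit
  setup _ := .pure (fun _ _ => false, ())
  answer q _ := .pure (match q with
    | .send _ _ _ => none
    | .revSessKey _ _ _ => none
    | .revLongTermKey _ => (0 : Fin pp.q)
    | .revRand _ _ _ => none
    | .revState _ _ _ => none, ())
  finish _ := .pure o

/-! ### Running times -/

theorem trivialReduction_efficient {In C Out : Type} {R : C → Type} (o : Out) (c : ℕ) :
    (trivialReduction (pp := pp) (In := In) (R := R) o).Efficient c :=
  ⟨fun _ => trivial, fun _ _ => trivial, fun _ => trivial⟩

section Cost

variable {C : Type} {R : C → Type}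

/-- Starting a session takes at most `nT + 1` steps (randomness and one exponentiation), a stage at
most 2 (key and AEAD operation); `nT + 2` covers both. -/
theorem simAnswer_costLE (q : Query pp) (s : SimState pp) :
    (simAnswer q s).CostLE SimOp.cost (pp.nT + 2) := by
  cases q with
  | send u i m =>
    cases hs : s.sessions u i with
    | none =>
      cases m with
      | start role peer =>
        simp only [simAnswer, hs]
        split
        · trivial
        · refine ⟨Nat.le_add_right _ _, fun r => ?_⟩
          split <;> simp [OracleComp.CostLE, SimOp.cost]
      | plaintext _ _ _ => simp only [simAnswer, hs, OracleComp.CostLE]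
      | packet _ => simp only [simAnswer, hs, OracleComp.CostLE]
    | some π =>
      cases m <;> simp only [simAnswer, hs] <;> split_ifs <;>
        simp [OracleComp.CostLE, SimOp.cost]
  | revSessKey u i t =>
    simp only [simAnswer]
    split
    · trivial
    · split
      · split_ifs <;> simp [OracleComp.CostLE, SimOp.cost]
      · trivial
  | revLongTermKey u =>
    simp only [simAnswer]
    split_ifs <;> simp [OracleComp.CostLE, SimOp.cost]
  | revRand u i t => trivial
  | revState u i t =>
    simp only [simAnswer]
    split
    · trivial
    · split_ifs <;> simp [OracleComp.CostLE, SimOp.cost]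

/-- Every program of the service makes at most one step. -/
structure PairService.Cheap (V : PairService pp C R) : Prop where
  key : ∀ salt, (V.key salt).CostLE RedOp.cost 1
  fix : ∀ salt, (V.fix salt).CostLE RedOp.cost 1
  enc : ∀ k n ad m, (V.enc k n ad m).CostLE RedOp.cost 1
  dec : ∀ k n ad c, (V.dec k n ad c).CostLE RedOp.cost 1

theorem ite_costLE {Q α : Type} {R : Q → Type} {w : Q → ℕ} {p : Prop} [Decidable p]
    {c d : OracleComp Q R α} {n : ℕ} (hc : c.CostLE w n) (hd : d.CostLE w n) :
    (if p then c else d).CostLE w n := by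
  split
  · exact hc
  · exact hd

theorem PairService.Cheap.answer {V : PairService pp C R} (hV : V.Cheap) (op : SimOp pp)
    (s : Track × BStr pp.κ) : (V.answer op s).CostLE RedOp.cost op.cost := by
  have henc : ∀ k n ad m s, (V.starEnc k n ad m s).CostLE RedOp.cost 1 := fun k n ad m s =>
    (hV.enc k n ad m).bind (n := 0) fun _ => trivial
  have hdec : ∀ k n ad c s, (V.starDec k n ad c s).CostLE RedOp.cost 1 := fun k n ad c s => by
    unfold starDec
    split
    · trivial
    · exact (hV.dec k n ad c).bind (n := 0) fun _ => trivial
  obtain ⟨s, k⟩ := s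
  cases op with
  | pairEnc first salt n ad m =>
    simp only [PairService.answer, SimOp.cost]
    refine ite_costLE (by trivial) (ite_costLE (ite_costLE ?_ (by trivial)) (ite_costLE ?_ ?_))
    · exact (hV.fix salt).bind (n := 1) fun k' => henc _ _ _ _ _
    · exact (henc _ _ _ _ _).mono one_le_two
    · refine (hV.key salt).bind_le (n := 1) le_rfl fun k' => ?_
      exact ⟨le_rfl, fun _ => trivial⟩
  | pairDec first salt n ad c =>
    simp only [PairService.answer, SimOp.cost]
    refine ite_costLE (by trivial) (ite_costLE (ite_costLE ?_ (by trivial)) (ite_costLE ?_ ?_))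
    · exact (hV.fix salt).bind (n := 1) fun k' => hdec _ _ _ _ _
    · exact (hdec _ _ _ _ _).mono one_le_two
    · refine (hV.key salt).bind_le (n := 1) le_rfl fun k' => ?_
      exact ⟨le_rfl, fun _ => trivial⟩
  | reveal salt =>
    simp only [PairService.answer, SimOp.cost]
    split_ifs
    · trivial
    · trivial
    · exact (hV.key salt).bind (n := 0) fun k' => trivial
  | _ => simp [PairService.answer, OracleComp.CostLE, RedOp.cost, SimOp.cost]

theorem sampleKeys_costLE (g : BStr pp.elemLen) (n : ℕ) :
    (sampleKeys C R g n).CostLE RedOp.cost (2 * n) := by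
  induction n with
  | zero => trivial
  | succ n ih =>
    refine ⟨by simp [RedOp.cost]; omega, fun x => ⟨by simp [RedOp.cost]; omega, fun h => ?_⟩⟩
    exact ih.bind_le (n := 0) (by simp [RedOp.cost]; omega) fun _ => by trivial

theorem pairReduction_efficient {In Out : Type} [Nonempty (Guess pp)]
    {V : BStr pp.elemLen → PairService pp C R} (hV : ∀ z, (V z).Cheap) (out : Bool → Out)
    {setup : In → Algorithm pp C R
      (((Fin pp.nP → Fin pp.q) × (Fin pp.nP → BStr pp.elemLen)) × BStr pp.elemLen)}
    (hs : ∀ x, (setup x).CostLE RedOp.cost (2 * pp.nP + 3))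
    (embed : In → Guess pp → (Fin pp.nP → BStr pp.elemLen) → (Fin pp.nP → BStr pp.elemLen)) :
    (pairReduction V out setup embed).Efficient 4 := by
  -- The constant 4 comes from the preparation: one coin for the guess and `2 * nP + 3` further
  -- steps. A query needs `nT + 2 ≤ 4 * (nT + 1)`, and the output needs no step.
  refine ⟨fun x => ⟨by simp [RedOp.cost]; omega, fun g => ?_⟩, fun q s => ?_, fun _ => trivial⟩
  · exact (hs x).bind_le (n := 0) (by simp [RedOp.cost]; omega) fun _ => by trivial
  · exact ((simAnswer_costLE q s.1).simulate (hV s.2.2).answer s.2.1).bind_le (n := 0)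
      (by omega) fun _ => by trivial

end Cost

theorem ddhReduction_efficient (pp : Params) [Nonempty (Guess pp)] :
    (ddhReduction pp).Efficient 4 := by
  refine pairReduction_efficient (fun z => ?_) _ (fun x => ?_) _
  · constructor <;> intros <;> simp [hashService, OracleComp.CostLE, RedOp.cost]
  · exact (sampleKeys_costLE _ _).bind_le (n := 0) (by omega) fun _ => by trivial

theorem prfReduction_efficient (pp : Params) [Nonempty (Guess pp)] :
    (prfReduction pp).Efficient 4 := by
  refine pairReduction_efficient (fun z => ?_) _ (fun x => ?_) _
  · constructor <;> intros <;> simp [prfService, OracleComp.CostLE, RedOp.cost]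
  · refine ⟨by simp [RedOp.cost], fun g => ?_⟩
    exact (sampleKeys_costLE _ _).bind_le (n := 0) (by simp [RedOp.cost]) fun _ => by trivial

theorem aeadReduction_efficient (pp : Params) [Nonempty (Guess pp)] :
    (aeadReduction pp).Efficient 4 := by
  refine pairReduction_efficient (fun z => ?_) _ (fun x => ?_) _
  · constructor <;> intros <;> simp [aeadService, OracleComp.CostLE, RedOp.cost]
  · refine ⟨by simp [RedOp.cost], fun g => ⟨by simp [RedOp.cost], fun c =>
      ⟨by simp [RedOp.cost], fun z => ?_⟩⟩⟩
    exact (sampleKeys_costLE _ _).bind_le (n := 0) (by simp [RedOp.cost]) fun _ => by trivial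

end

noncomputable section

variable {pp : Params}

/-! ### The idealized run of a simulator -/

def Track.starEnc (P : Primitives pp) (k : BStr pp.κ) (n ad m : Bits) (s : Track) : Bits × Track :=
  (P.aead.encrypt k n ad m, s.add (P.aead.encrypt k n ad m, n, ad) m)

def Track.starDec (P : Primitives pp) (k : BStr pp.κ) (n ad c : Bits) (s : Track) :
    Option Bits × Track :=
  match s.log.lookup (c, n, ad) with
  | some m => (some m, s)
  | none => (P.aead.decrypt k n ad c, s.accept (P.aead.decrypt k n ad c))

/-- The answers to the operations of a simulator if the message keys of the guessed parties are given
by `K`, except that the key of the guessed salt is given by `L`. -/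
def simOracle (P : Primitives pp) (K L : BStr 128 → BStr pp.κ) : (op : SimOp pp) → Track →
    PMF (op.Answer × Track)
  | .coin n, s => (uniformUpTo n).map fun x => (x, s)
  | .stageRand, s => (PMF.uniformOfFintype (Fin pp.nT → StageRand)).map fun x => (x, s)
  | .pow h x, s => PMF.pure (P.powEncoded h x, s)
  | .hash x, s => PMF.pure (P.hash x, s)
  | .encrypt k n ad m, s => PMF.pure (P.aead.encrypt k n ad m, s)
  | .decrypt k n ad c, s => PMF.pure (P.aead.decrypt k n ad c, s)
  | .pairEnc first salt n ad m, s =>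
      PMF.pure <|
        if s.Done then ([], s)
        else if first then
          if s.star = none ∧ salt ∉ s.used then (s.fix salt).starEnc P (L salt) n ad m
          else ([], s.kill)
        else if s.star = some salt then s.starEnc P (L salt) n ad m
        else (P.aead.encrypt (K salt) n ad m, s.use salt)
  | .pairDec first salt n ad c, s =>
      PMF.pure <|
        if s.Done then (none, s)
        else if first then
          if s.star = none ∧ salt ∉ s.used then (s.fix salt).starDec P (L salt) n ad c
          else (none, s.kill)
        else if s.star = some salt then s.starDec P (L salt) n ad c
        else (P.aead.decrypt (K salt) n ad c, s.use salt)
  | .reveal salt, s =>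
      PMF.pure <|
        if s.Done then (fun _ => false, s)
        else if s.star = some salt then (fun _ => false, s.kill)
        else (K salt, s.use salt)
  | .abort, s => PMF.pure ((), if s.Done then s else s.kill)

section Realizes

variable {C : Type} {R : C → Type} {σ : Type}

/-- Against the challenger `chal`, the programs of the service `V` compute the keys `K`, and encrypt and
decrypt with the keys `L`, as long as the invariant `I` holds. -/
structure PairService.Realizes (V : PairService pp C R) (P : Primitives pp)
    (chal : (c : C) → σ → PMF (R c × σ)) (K L : BStr 128 → BStr pp.κ)
    (I : Track → BStr pp.κ → σ → Prop) : Prop where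
  kill : ∀ s k t, I s k t → I s.kill k t
  key : ∀ s k t salt, I s k t → s.star ≠ some salt → ∃ t',
    (V.key salt).run (redOracle P chal) t = PMF.pure (K salt, t') ∧ I (s.use salt) k t'
  fix : ∀ s k t salt, I s k t → s.star = none → salt ∉ s.used → ∃ k' t',
    (V.fix salt).run (redOracle P chal) t = PMF.pure (k', t') ∧ I (s.fix salt) k' t'
  enc : ∀ s k t salt n ad m, I s k t → s.star = some salt → ∃ t',
    (V.enc k n ad m).run (redOracle P chal) t = PMF.pure (P.aead.encrypt (L salt) n ad m, t') ∧
      I (s.add (P.aead.encrypt (L salt) n ad m, n, ad) m) k t'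
  dec : ∀ s k t salt n ad c, I s k t → s.star = some salt → ¬ s.Done →
    s.log.lookup (c, n, ad) = none → ∃ t',
    (V.dec k n ad c).run (redOracle P chal) t = PMF.pure (P.aead.decrypt (L salt) n ad c, t') ∧
      I (s.accept (P.aead.decrypt (L salt) n ad c)) k t'

variable {V : PairService pp C R} {P : Primitives pp} {chal : (c : C) → σ → PMF (R c × σ)}
  {K L : BStr 128 → BStr pp.κ} {I : Track → BStr pp.κ → σ → Prop}

/-- The invariant and the projected distribution for the answer to one operation. -/
def AnswerOK (P : Primitives pp) (chal : (c : C) → σ → PMF (R c × σ))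
    (I : Track → BStr pp.κ → σ → Prop) {α : Type} (p : Algorithm pp C R (α × (Track × BStr pp.κ)))
    (t : σ) (μ : PMF (α × Track)) : Prop :=
  (p.run (redOracle P chal) t).map (fun x => (x.1.1, x.1.2.1)) = μ ∧
    ∀ x ∈ (p.run (redOracle P chal) t).support, I x.1.2.1 x.1.2.2 x.2

theorem AnswerOK.pure {α : Type} {a : α} {s : Track} {k : BStr pp.κ} {t : σ} (h : I s k t) :
    AnswerOK (C := C) (R := R) P chal I (.pure (a, (s, k))) t (PMF.pure (a, s)) := by
  refine ⟨by simp [OracleComp.run, PMF.pure_map], fun x hx => ?_⟩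
  simp only [OracleComp.run, PMF.support_pure, Set.mem_singleton_iff] at hx
  subst hx
  exact h

theorem AnswerOK.sample {α : Type} {p : Algorithm pp C R (α × (Track × BStr pp.κ))} {μ : PMF α}
    {s : Track} {k : BStr pp.κ} {t : σ}
    (hp : p.run (redOracle P chal) t = μ.bind fun x => PMF.pure ((x, (s, k)), t)) (h : I s k t) :
    AnswerOK P chal I p t (μ.map fun x => (x, s)) := by
  unfold AnswerOK
  rw [hp]
  refine ⟨by simp [PMF.map, Function.comp_def], fun x hx => ?_⟩
  simp only [PMF.mem_support_bind_iff, PMF.support_pure, Set.mem_singleton_iff] at hx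
  obtain ⟨y, -, rfl⟩ := hx
  exact h

theorem AnswerOK.bind {α β : Type} {p : Algorithm pp C R β}
    {f : β → Algorithm pp C R (α × (Track × BStr pp.κ))} {t t' : σ} {b : β} {μ : PMF (α × Track)}
    (hp : p.run (redOracle P chal) t = PMF.pure (b, t')) (h : AnswerOK P chal I (f b) t' μ) :
    AnswerOK P chal I (p.bind f) t μ := by
  unfold AnswerOK
  rw [OracleComp.run_bind, hp, PMF.pure_bind]
  exact h

theorem AnswerOK.ite {α : Type} {p p' : Algorithm pp C R (α × (Track × BStr pp.κ))} {t : σ}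
    {b b' : α × Track} {q : Prop} [Decidable q] (h : q → AnswerOK P chal I p t (PMF.pure b))
    (h' : ¬ q → AnswerOK P chal I p' t (PMF.pure b')) :
    AnswerOK P chal I (if q then p else p') t (PMF.pure (if q then b else b')) := by
  split
  · exact h ‹_›
  · exact h' ‹_›

namespace PairService.Realizes

theorem starEnc_ok (hV : V.Realizes P chal K L I) {s k t salt} (h : I s k t)
    (hs : s.star = some salt) (n ad m : Bits) :
    AnswerOK P chal I (V.starEnc k n ad m s) t (PMF.pure (s.starEnc P (L salt) n ad m)) := by
  obtain ⟨t', h1, h2⟩ := hV.enc s k t salt n ad m h hs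
  exact .bind h1 (.pure h2)

theorem starDec_ok (hV : V.Realizes P chal K L I) {s k t salt} (h : I s k t)
    (hs : s.star = some salt) (hd : ¬ s.Done) (n ad c : Bits) :
    AnswerOK P chal I (V.starDec k n ad c s) t (PMF.pure (s.starDec P (L salt) n ad c)) := by
  unfold starDec Track.starDec
  cases hl : s.log.lookup (c, n, ad) with
  | some m => exact .pure h
  | none =>
    obtain ⟨t', h1, h2⟩ := hV.dec s k t salt n ad c h hs hd hl
    exact .bind h1 (.pure h2)

/-- The branches of `PairService.answer` meet exactly the preconditions in `Realizes`: `key` is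
called for salts other than the star, `fix` once and for an unused salt, and `dec` before success or
failure on triples outside the log. -/
theorem answer_ok (hV : V.Realizes P chal K L I) (op : SimOp pp) {s k t} (h : I s k t) :
    AnswerOK P chal I (V.answer op (s, k)) t (simOracle P K L op s) := by
  cases op with
  | pairEnc first salt n ad m =>
    refine .ite (fun _ => .pure h) fun _ => .ite (fun _ => .ite (fun h1 => ?_) fun _ =>
      .pure (hV.kill _ _ _ h)) fun _ => .ite (fun h1 => hV.starEnc_ok h h1 _ _ _) fun h1 => ?_
    · obtain ⟨k', t', h2, h3⟩ := hV.fix s k t salt h h1.1 h1.2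
      exact .bind h2 (hV.starEnc_ok h3 rfl _ _ _)
    · obtain ⟨t', h2, h3⟩ := hV.key s k t salt h h1
      refine .bind h2 (.bind (p := .query (.encrypt _ n ad m) .pure)
        (f := fun c => .pure (c, (s.use salt, k))) (t' := t') (b := P.aead.encrypt (K salt) n ad m)
        ?_ (.pure h3))
      simp [OracleComp.run, redOracle]
  | pairDec first salt n ad c =>
    refine .ite (fun _ => .pure h) fun hd => .ite (fun _ => .ite (fun h1 => ?_) fun _ =>
      .pure (hV.kill _ _ _ h)) fun _ => .ite (fun h1 => hV.starDec_ok h h1 hd _ _ _) fun h1 => ?_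
    · obtain ⟨k', t', h2, h3⟩ := hV.fix s k t salt h h1.1 h1.2
      exact .bind h2 (hV.starDec_ok h3 rfl hd _ _ _)
    · obtain ⟨t', h2, h3⟩ := hV.key s k t salt h h1
      refine .bind h2 (.bind (p := .query (.decrypt _ n ad c) .pure)
        (f := fun c => .pure (c, (s.use salt, k))) (t' := t') (b := P.aead.decrypt (K salt) n ad c)
        ?_ (.pure h3))
      simp [OracleComp.run, redOracle]
  | reveal salt =>
    refine .ite (fun _ => .pure h) fun hd => .ite (fun _ => .pure (hV.kill _ _ _ h)) fun h1 => ?_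
    obtain ⟨t', h2, h3⟩ := hV.key s k t salt h h1
    exact .bind h2 (.pure h3)
  | abort =>
    refine AnswerOK.pure ?_
    split
    · exact h
    · exact hV.kill _ _ _ h
  | coin n => exact .sample (PMF.bind_map _ _ _) h
  | stageRand => exact .sample (PMF.bind_map _ _ _) h
  | _ =>
    refine .bind (p := .query _ .pure) (f := fun x => .pure (x, (s, k))) ?_ (.pure h)
    simp only [OracleComp.run, redOracle, PMF.pure_bind]

/-- Running a simulator with a service that realizes `K` and `L` amounts to the idealized run. -/
theorem run_simulate (hV : V.Realizes P chal K L I) {α : Type}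
    (c : OracleComp (SimOp pp) SimOp.Answer α) {s k t} (h : I s k t) :
    AnswerOK P chal I (c.simulate V.answer (s, k)) t (c.run (simOracle P K L) s) := by
  have h1 : ∀ (op : SimOp pp) (x : (Track × BStr pp.κ) × σ), I x.1.1 x.1.2 x.2 →
      ∀ y ∈ (OracleComp.compOracle (redOracle P chal) V.answer op x).support,
        I y.2.1.1 y.2.1.2 y.2.2 := by
    rintro op ⟨⟨s, k⟩, t⟩ h y hy
    simp only [OracleComp.compOracle, PMF.mem_support_map_iff] at hy
    obtain ⟨z, hz, rfl⟩ := hy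
    exact (hV.answer_ok op h).2 z hz
  refine ⟨?_, fun x hx => ?_⟩
  · rw [OracleComp.run_simulate, PMF.map_comp]
    refine OracleComp.run_map_state (OracleComp.compOracle (redOracle P chal) V.answer)
      (simOracle P K L) (fun x => x.1.1) (fun x => I x.1.1 x.1.2 x.2) h1 ?_ c ((s, k), t) h
    rintro op ⟨⟨s, k⟩, t⟩ h
    rw [← (hV.answer_ok op h).1, OracleComp.compOracle, PMF.map_comp]
    rfl
  · rw [OracleComp.run_simulate, PMF.mem_support_map_iff] at hx
    obtain ⟨y, hy, rfl⟩ := hx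
    exact OracleComp.run_support _ (fun x => I x.1.1 x.1.2 x.2) h1 c ((s, k), t) h y hy

end PairService.Realizes

end Realizes

/-! ### The three services -/

theorem BStr.toBits_injective {n : ℕ} : Function.Injective (BStr.toBits (n := n)) :=
  List.ofFn_injective

/-- The common suffix cancels, so PRF inputs of different salts differ; a challenge input can clash
only with an earlier use of its own salt. -/
theorem toBits_append_keyLabel_inj {a b : BStr 128} :
    a.toBits ++ keyLabel = b.toBits ++ keyLabel ↔ a = b := by
  rw [List.append_left_inj, BStr.toBits_injective.eq_iff]

/-- All keys are honest hash values here, so it is enough to remember that the stored key belongs to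
the star. -/
theorem hashService_realizes (P : Primitives pp)
    (chal : (c : Empty) → Unit → PMF (Empty × Unit)) (z : BStr pp.elemLen) :
    (hashService z).Realizes P chal (P.messageKey z) (P.messageKey z)
      (fun s k _ => ∀ salt, s.star = some salt → k = P.messageKey z salt) where
  kill s k t h := h
  key s k t salt h hs := ⟨(), by simp [hashService, OracleComp.run, redOracle]; rfl, h⟩
  fix s k t salt h hs hu := ⟨P.messageKey z salt, (),
    by simp [hashService, OracleComp.run, redOracle]; rfl, by simp [Track.fix]⟩
  enc s k t salt n ad m h hs := ⟨(), by
    simp [hashService, OracleComp.run, redOracle, h salt hs], h⟩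
  dec s k t salt n ad c h hs hd hl := ⟨(), by
    simp [hashService, OracleComp.run, redOracle, h salt hs], h⟩

/-- The challenger of a pseudorandom function that answers the challenge query by `f`. -/
def prfOracleWith (P : Primitives pp) (k : P.G) (f : Bits → BStr pp.κ) : (c : PRFQuery) → PRFState →
    PMF (Option (BStr pp.κ) × PRFState)
  | .eval x, s =>
      if s.challenged = some x then PMF.pure (none, s)
      else PMF.pure (some (P.prf k x), { s with queried := x :: s.queried })
  | .challenge y, s =>
      if s.challenged.isSome ∨ y ∈ s.queried then PMF.pure (none, s)
      else PMF.pure (some (f y), { s with challenged := some y })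

/-- The challenger never refuses: evaluated inputs come from used salts and the challenge input from
the star, while an unused salt is fixed and only other salts are evaluated. With the encoded `g` as
premaster secret, PRF values are message keys. -/
theorem prfService_realizes (P : Primitives pp) (g : P.G) (f : Bits → BStr pp.κ) :
    prfService.Realizes P (prfOracleWith P g f) (P.messageKey (P.encode g))
      (fun salt => f (salt.toBits ++ keyLabel))
      (fun s k t => (∀ salt, s.star = some salt → k = f (salt.toBits ++ keyLabel)) ∧
        t.challenged = s.star.map (fun salt => salt.toBits ++ keyLabel) ∧
        ∀ x ∈ t.queried, ∃ salt ∈ s.used, x = salt.toBits ++ keyLabel) where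
  kill s k t h := h
  key s k t salt h hs := by
    refine ⟨⟨(salt.toBits ++ keyLabel) :: t.queried, t.challenged⟩, ?_, h.1, h.2.1, ?_⟩
    · have : t.challenged ≠ some (salt.toBits ++ keyLabel) := by
        rw [h.2.1]
        cases hst : s.star with
        | none => simp
        | some a =>
          simp only [Option.map_some, ne_eq, Option.some.injEq, toBits_append_keyLabel_inj]
          rintro rfl; exact hs hst
      simp only [prfService, OracleComp.run, redOracle, prfOracleWith, if_neg this]
      exact PMF.pure_bind _ _
    · simp only [List.mem_cons, Track.use]
      rintro x (rfl | hx)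
      · exact ⟨salt, by simp, rfl⟩
      · obtain ⟨a, ha, rfl⟩ := h.2.2 x hx
        exact ⟨a, by simp [ha], rfl⟩
  fix s k t salt h hs hu := by
    refine ⟨f (salt.toBits ++ keyLabel), ⟨t.queried, some (salt.toBits ++ keyLabel)⟩, ?_, ?_, ?_, ?_⟩
    · have h1 : t.challenged = none := by rw [h.2.1, hs]; rfl
      have h2 : salt.toBits ++ keyLabel ∉ t.queried := fun hx => by
        obtain ⟨a, ha, e⟩ := h.2.2 _ hx
        rw [toBits_append_keyLabel_inj] at e
        exact hu (e ▸ ha)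
      simp only [prfService, OracleComp.run, redOracle, prfOracleWith, h1, h2, Option.isSome_none,
        Bool.false_eq_true, or_self, if_false]
      exact PMF.pure_bind _ _
    · simp [Track.fix]
    · simp [Track.fix]
    · intro x hx
      obtain ⟨a, ha, rfl⟩ := h.2.2 x hx
      exact ⟨a, by simp [Track.fix, ha], rfl⟩
  enc s k t salt n ad m h hs := ⟨t, by
    simp [prfService, OracleComp.run, redOracle, h.1 salt hs], h⟩
  dec s k t salt n ad c h hs hd hl := ⟨t, by
    simp [prfService, OracleComp.run, redOracle, h.1 salt hs], h⟩

/-- The log mirrors the list of the challenger and the two flags agree. The stored key is a dummy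
that `aeadService` ignores. -/
theorem aeadService_realizes (P : Primitives pp) (z : BStr pp.elemLen) (key : BStr pp.κ) :
    (aeadService z).Realizes P (aeadOracle P.aead key) (P.messageKey z) (fun _ => key)
      (fun s _ t => t.produced = s.log.map Prod.fst ∧ t.win = s.win) where
  kill s k t h := h
  key s k t salt h hs := ⟨t, by simp [aeadService, OracleComp.run, redOracle]; rfl, h⟩
  fix s k t salt h hs hu := ⟨_, t, by simp [aeadService, OracleComp.run]; rfl, h⟩
  enc s k t salt n ad m h hs :=
    ⟨{ t with produced := (P.aead.encrypt key n ad m, n, ad) :: t.produced },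
      PMF.pure_bind _ _, by simp [Track.add, h.1], h.2⟩
  dec s k t salt n ad c h hs hd hl := by
    have h1 : (c, n, ad) ∉ t.produced := by
      rw [h.1]
      intro hm
      obtain ⟨x, hx, e⟩ := List.mem_map.1 hm
      rw [List.lookup_eq_none_iff] at hl
      simpa [e] using hl x hx
    -- Needed for a rejected ciphertext: the simulator sets its flag to false there, while the
    -- challenger leaves its own unchanged.
    have h2 : s.win = false := by
      simp only [Track.Done, not_or] at hd
      simpa using hd.2
    cases hc : P.aead.decrypt key n ad c with
    | none =>
      refine ⟨t, ?_, h.1, by simp [Track.accept, h.2, h2]⟩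
      simp only [aeadService, OracleComp.run, redOracle, aeadOracle, if_neg h1, hc]
      exact PMF.pure_bind _ _
    | some m =>
      refine ⟨{ t with win := true }, ?_, h.1, by simp [Track.accept]⟩
      simp only [aeadService, OracleComp.run, redOracle, aeadOracle, if_neg h1, hc]
      exact PMF.pure_bind _ _

end

noncomputable section

variable {pp : Params}

/-! ### Uniform distributions -/

theorem PMF.uniformOfFintype_map_equiv {α β : Type} [Fintype α] [Nonempty α] [Fintype β]
    [Nonempty β] (e : α ≃ β) : (PMF.uniformOfFintype α).map e = PMF.uniformOfFintype β := by
  ext b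
  rw [PMF.map_apply, tsum_eq_single (e.symm b)]
  · simp [Fintype.card_congr e]
  · intro a ha
    rw [if_neg]
    rintro rfl
    simp at ha

theorem PMF.uniformOfFintype_prod (α β : Type) [Fintype α] [Nonempty α] [Fintype β] [Nonempty β] :
    PMF.uniformOfFintype (α × β) =
      (PMF.uniformOfFintype α).bind fun a => (PMF.uniformOfFintype β).map fun b => (a, b) := by
  classical
  ext ⟨a, b⟩
  rw [PMF.bind_apply, tsum_eq_single a]
  · rw [PMF.map_apply, tsum_eq_single b]
    · simp [ENNReal.mul_inv]
    · intro b' hb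
      rw [if_neg]
      simpa using hb.symm
  · intro a' ha
    rw [PMF.map_apply]
    simp [ha.symm]

/-- Replacing one entry of a uniform vector by a uniform element. -/
theorem PMF.uniform_update {ι α β : Type} [Fintype ι] [DecidableEq ι] [Fintype α] [Nonempty α]
    (u : ι) (F : α → (ι → α) → PMF β) :
    ((PMF.uniformOfFintype α).bind fun a => (PMF.uniformOfFintype (ι → α)).bind fun f =>
      F a (Function.update f u a)) =
    (PMF.uniformOfFintype (ι → α)).bind fun f => F (f u) f := by
  -- Exchanging the separate element with entry `u` of the vector is an involution, hence preserves
  -- the uniform distribution on pairs.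
  have h1 := PMF.uniformOfFintype_map_equiv (α := α × (ι → α))
    { toFun := fun x => (x.2 u, Function.update x.2 u x.1)
      invFun := fun x => (x.2 u, Function.update x.2 u x.1)
      left_inv := fun x => by simp
      right_inv := fun x => by simp }
  have h2 : ∀ G : α × (ι → α) → PMF β, (PMF.uniformOfFintype (α × (ι → α))).bind G =
      (PMF.uniformOfFintype α).bind fun a => (PMF.uniformOfFintype (ι → α)).bind fun f => G (a, f) := by
    intro G
    rw [PMF.uniformOfFintype_prod, PMF.bind_bind]
    simp only [PMF.bind_map, Function.comp_def]
  have h3 := h2 fun x => F (x.2 u) x.2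
  rw [← h1, PMF.bind_map, h2] at h3
  simpa [Function.comp_def, PMF.bind_const] using h3

theorem uniformUpTo_map_cast {n m : ℕ} [NeZero m] (h : n + 1 = m) :
    (uniformUpTo n).map (Fin.cast h) = PMF.uniformOfFintype (Fin m) :=
  PMF.uniformOfFintype_map_equiv (finCongr h)

theorem uniformUpTo_map_decodeGuess [Nonempty (Guess pp)] :
    (uniformUpTo (Fintype.card (Guess pp) - 1)).map decodeGuess =
      PMF.uniformOfFintype (Guess pp) :=
  PMF.uniformOfFintype_map_equiv
    ((finCongr (Nat.sub_add_cancel Fintype.card_pos)).trans (Fintype.equivFin (Guess pp)).symm)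

/-! ### Runs of the reductions -/

theorem Primitives.powEncoded_encode (P : Primitives pp) (h : P.G) (x : ℕ) :
    P.powEncoded (P.encode h) x = some (P.encode (h ^ x)) := by
  have hh : ∃ e, P.encode e = P.encode h := ⟨h, rfl⟩
  have h1 : hh.choose = h := P.encode_injective hh.choose_spec
  unfold Primitives.powEncoded
  rw [dif_pos hh, h1]

/-- The encoded public keys. -/
def Primitives.pubs (P : Primitives pp) {n : ℕ} (sk : Fin n → Fin pp.q) :
    Fin n → BStr pp.elemLen := fun u => P.encode (P.pub (sk u))

section Runs

variable {C : Type} {R : C → Type} {σ : Type}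

theorem run_sampleKeys (P : Primitives pp) (chal : (c : C) → σ → PMF (R c × σ)) (n : ℕ) (t : σ) :
    (sampleKeys C R (P.encode P.g) n).run (redOracle P chal) t =
      (PMF.uniformOfFintype (Fin n → Fin pp.q)).map fun sk => ((sk, P.pubs sk), t) := by
  induction n with
  | zero =>
    have h : PMF.uniformOfFintype (Fin 0 → Fin pp.q) = PMF.pure Fin.elim0 := by
      ext f
      simp [Subsingleton.elim f Fin.elim0]
    rw [h, PMF.pure_map]
    exact congrArg (fun x => PMF.pure ((Fin.elim0, x), t)) (Subsingleton.elim _ _)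
  | succ n ih =>
    -- A uniform vector is a uniform head together with an independent uniform tail, which is the
    -- order in which the keys are drawn.
    rw [← PMF.uniformOfFintype_map_equiv (Fin.consEquiv fun _ : Fin (n + 1) => Fin pp.q),
      PMF.uniformOfFintype_prod, ← uniformUpTo_map_cast (Nat.sub_add_cancel pp.q_prime.one_le)]
    simp only [PMF.map_bind, PMF.bind_map, PMF.map_comp]
    refine (PMF.bind_map _ _ _).trans ?_
    refine congrArg _ (funext fun x => (PMF.pure_bind _ _).trans ?_)
    change OracleComp.run _ (OracleComp.bind _ _) _ = _
    rw [OracleComp.run_bind, ih, PMF.bind_map]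
    change _ = PMF.map _ (PMF.map _ _)
    rw [PMF.map_comp]
    refine congrArg (PMF.bind _) (funext fun sk => ?_)
    change PMF.pure _ = PMF.pure _
    refine congrArg PMF.pure (Prod.ext (Prod.ext rfl ?_) rfl)
    change Fin.cons _ (P.pubs sk) = P.pubs (Fin.cons _ sk)
    funext u
    refine Fin.cases ?_ (fun u => ?_) u
    · simp only [Fin.cons_zero, P.powEncoded_encode]
      rfl
    · rfl

/-- The reduction works query by query, whereas the analysis needs the adversary compiled first into
simulator operations and then into operations of the service. Both orders agree because the element
`z` stays constant. -/
theorem simulate_answerOp {In Out : Type} [Nonempty (Guess pp)]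
    (V : BStr pp.elemLen → PairService pp C R) (out : Bool → Out)
    (setup : In → Algorithm pp C R
      (((Fin pp.nP → Fin pp.q) × (Fin pp.nP → BStr pp.elemLen)) × BStr pp.elemLen))
    (embed : In → Guess pp → (Fin pp.nP → BStr pp.elemLen) → (Fin pp.nP → BStr pp.elemLen))
    {α : Type} (c : OracleComp (AdvOp pp) AdvOp.Answer α) (s : SimState pp) (k : Track × BStr pp.κ)
    (z : BStr pp.elemLen) :
    c.simulate (pairReduction V out setup embed).answerOp (s, k, z) =
      ((c.simulate simAdvAnswer s).simulate (V z).answer k).bind fun x =>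
        .pure (x.1.1, (x.1.2, x.2, z)) := by
  induction c generalizing s k with
  | pure a => rfl
  | query q f ih =>
    cases q with
    | coin n =>
      exact congrArg (OracleComp.query (RedOp.coin n)) (funext fun r => ih r s k)
    | game q =>
      change ((((simAnswer q s).simulate (V z).answer k).bind fun x =>
        .pure (x.1.1, (x.1.2, x.2, z))).bind fun x => (f x.1).simulate _ x.2) =
          (((simAnswer q s).bind fun x => (f x.1).simulate simAdvAnswer x.2).simulate
            (V z).answer k).bind _
      rw [OracleComp.bind_assoc, OracleComp.simulate_bind, OracleComp.bind_assoc]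
      exact congrArg _ (funext fun x => ih _ _ _)

/-- The flag for a forgery at the end of the idealized run. -/
def simWin (P : Primitives pp) (A : Adversary pp) (K L : BStr 128 → BStr pp.κ) (g : Guess pp)
    (sk : Fin pp.nP → Fin pp.q) : PMF Bool :=
  (((A (P.pubs sk)).simulate simAdvAnswer (simInit g sk (P.pubs sk))).run (simOracle P K L)
    Track.init).map fun x => x.2.win

theorem run_apply_pairReduction {In Out : Type} [Nonempty (Guess pp)]
    (V : BStr pp.elemLen → PairService pp C R) (out : Bool → Out)
    (setup : In → Algorithm pp C R
      (((Fin pp.nP → Fin pp.q) × (Fin pp.nP → BStr pp.elemLen)) × BStr pp.elemLen))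
    (embed : In → Guess pp → (Fin pp.nP → BStr pp.elemLen) → (Fin pp.nP → BStr pp.elemLen))
    (P : Primitives pp) (chal : (c : C) → σ → PMF (R c × σ)) (A : Adversary pp) (x : In) (t : σ) :
    ((pairReduction V out setup embed).apply A x).run (redOracle P chal) t =
      (PMF.uniformOfFintype (Guess pp)).bind fun g =>
        ((setup x).run (redOracle P chal) t).bind fun y =>
          ((((A (embed x g y.1.1.2)).simulate simAdvAnswer
            (simInit g y.1.1.1 (embed x g y.1.1.2))).simulate (V y.1.2).answer
              (Track.init, fun _ => false)).run (redOracle P chal) y.2).map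
                fun w => (out w.1.2.1.win, w.2) := by
  rw [← uniformUpTo_map_decodeGuess, PMF.bind_map]
  refine (PMF.bind_map _ _ _).trans ?_
  refine congrArg _ (funext fun g => ?_)
  change OracleComp.run _ (((setup x).bind fun y => .pure _).bind _) t = _
  rw [OracleComp.bind_assoc, OracleComp.run_bind]
  refine congrArg _ (funext fun y => ?_)
  change OracleComp.run _ (((A _).simulate _ (_, _, _)).bind _) _ = _
  refine (congrArg (fun c => OracleComp.run (redOracle P chal) (OracleComp.bind c _) y.2)
    (simulate_answerOp V out setup embed (A (embed x (decodeGuess g) y.1.1.2)) _ _ _)).trans ?_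
  exact (congrArg (fun c => OracleComp.run (redOracle P chal) c y.2)
    (OracleComp.bind_assoc _ _ _)).trans (OracleComp.run_bind _ _ _ _)

theorem PairService.Realizes.map_win {V : PairService pp C R} {P : Primitives pp}
    {chal : (c : C) → σ → PMF (R c × σ)} {K L : BStr 128 → BStr pp.κ}
    {I : Track → BStr pp.κ → σ → Prop} (hV : V.Realizes P chal K L I) {α : Type}
    (c : OracleComp (SimOp pp) SimOp.Answer α) {s k t} (h : I s k t) :
    ((c.simulate V.answer (s, k)).run (redOracle P chal) t).map (fun w => w.1.2.1.win) =
      (c.run (simOracle P K L) s).map fun x => x.2.win := by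
  rw [← (hV.run_simulate c h).1, PMF.map_comp]
  rfl

end Runs

/-- The bookkeeping never sees the secret keys of the guessed parties, so unknown DDH exponents may
take their place. -/
theorem Guess.mask_congr (g : Guess pp) {sk sk' : Fin pp.nP → Fin pp.q}
    (h : ∀ x, ¬ g.Mem x → sk x = sk' x) : g.mask sk = g.mask sk' := by
  funext x
  unfold Guess.mask
  split
  · rfl
  · exact h x ‹_›

/-- The message keys that belong to the group element with exponent `n`. -/
def Primitives.expKey (P : Primitives pp) (n : ℕ) : BStr 128 → BStr pp.κ :=
  P.messageKey (P.encode (P.g ^ n))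

/-! ### Sampling the random PRF answer in advance. -/

section LazyChallenge

variable (P : Primitives pp)

/-- Only an admissible challenge query consumes the random answer. All other operations, refused
challenges included, agree for both oracles and leave `challenged` alone. -/
theorem redOracle_prf_eq (k : P.G) (z : BStr pp.κ) (op : RedOp pp PRFQuery) (s : PRFState)
    (h : ∀ y, op = .chal (.challenge y) → s.challenged.isSome ∨ y ∈ s.queried) :
    redOracle P (prfOracle P k false) op s = redOracle P (prfOracleWith P k fun _ => z) op s ∧
      ∀ x ∈ (redOracle P (prfOracleWith P k fun _ => z) op s).support,
        x.2.challenged = s.challenged := by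
  cases op with
  | chal c =>
    cases c with
    | eval x =>
      refine ⟨rfl, fun y hy => ?_⟩
      by_cases hx : s.challenged = some x
      · have e : redOracle P (prfOracleWith P k fun _ => z) (.chal (.eval x)) s =
          PMF.pure (none, s) := if_pos hx
        rw [e] at hy
        rw [(PMF.mem_support_pure_iff _ _).1 hy]
      · have e : redOracle P (prfOracleWith P k fun _ => z) (.chal (.eval x)) s =
          PMF.pure (some (P.prf k x), { s with queried := x :: s.queried }) := if_neg hx
        rw [e] at hy
        rw [(PMF.mem_support_pure_iff _ _).1 hy]
    | challenge y =>
      have e : redOracle P (prfOracleWith P k fun _ => z) (.chal (.challenge y)) s =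
        PMF.pure (none, s) := if_pos (h y rfl)
      have e' : redOracle P (prfOracle P k false) (.chal (.challenge y)) s =
        PMF.pure (none, s) := if_pos (h y rfl)
      refine ⟨e'.trans e.symm, fun x hx => ?_⟩
      rw [e] at hx
      rw [(PMF.mem_support_pure_iff _ _).1 hx]
  | coin n => exact ⟨rfl, fun x hx => by
      obtain ⟨y, -, rfl⟩ := (PMF.mem_support_map_iff _ _ _).1 hx; rfl⟩
  | stageRand => exact ⟨rfl, fun x hx => by
      obtain ⟨y, -, rfl⟩ := (PMF.mem_support_map_iff _ _ _).1 hx; rfl⟩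
  | _ => exact ⟨rfl, fun x hx => by
      rw [(PMF.mem_support_pure_iff _ _).1 hx]⟩

/-- After the challenge has been answered no further challenge is admissible, so the value `z` has
no influence any more. -/
theorem run_prfOracle_challenged {α : Type}
    (c : Algorithm pp PRFQuery (fun _ => Option (BStr pp.κ)) α)
    (k : P.G) (z : BStr pp.κ) (s : PRFState) (hs : s.challenged.isSome) :
    c.run (redOracle P (prfOracle P k false)) s =
      c.run (redOracle P (prfOracleWith P k fun _ => z)) s := by
  induction c generalizing s with
  | pure a => rfl
  | query q f ih =>
    obtain ⟨h1, h2⟩ := redOracle_prf_eq P k z q s fun _ _ => .inl hs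
    rw [OracleComp.run, OracleComp.run, h1]
    exact PMF.bind_congr_support fun x hx => ih _ _ (by rw [h2 x hx]; exact hs)

/-- The uniform answer to the challenge query can be drawn in advance. -/
theorem run_prfOracle_false {α : Type} (c : Algorithm pp PRFQuery (fun _ => Option (BStr pp.κ)) α)
    (k : P.G) (s : PRFState) (hs : s.challenged = none) :
    c.run (redOracle P (prfOracle P k false)) s =
      (PMF.uniformOfFintype (BStr pp.κ)).bind fun z =>
        c.run (redOracle P (prfOracleWith P k fun _ => z)) s := by
  induction c generalizing s with
  | pure a => exact (PMF.bind_const _ _).symm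
  | query q f ih =>
    by_cases hq : ∀ y, q = .chal (.challenge y) → s.challenged.isSome ∨ y ∈ s.queried
    · have h1 := fun z => redOracle_prf_eq P k z q s hq
      simp only [OracleComp.run]
      -- The present operation does not depend on `z`, so drawing `z` can be postponed past it.
      rw [← funext fun z => congrArg (fun p => PMF.bind p _) (h1 z).1, PMF.bind_comm]
      refine PMF.bind_congr_support fun x hx => ih _ _ ?_
      rw [(h1 fun _ => false).1] at hx
      rw [(h1 _).2 x hx, hs]
    · push Not at hq
      obtain ⟨y, rfl, h1, h2⟩ := hq
      have h3 : ¬ (s.challenged.isSome ∨ y ∈ s.queried) := by tauto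
      simp only [OracleComp.run, redOracle, prfOracle, prfOracleWith, if_neg h3,
        Bool.false_eq_true, if_false]
      -- This is the first admissible challenge: the answer drawn now is identified with the `z`
      -- drawn in advance.
      refine (PMF.bind_map _ _ _).trans (congrArg _ (funext fun z => ?_))
      exact (run_prfOracle_challenged P (f (some z)) k z _ rfl).trans
        (PMF.pure_bind (some z, { s with challenged := some y }) fun x =>
          (f x.1).run (redOracle P (prfOracleWith P k fun _ => z)) x.2).symm

end LazyChallenge

/-! ### The security experiments of the primitives in terms of `simWin`. -/

section Experiments

variable [Nonempty (Guess pp)] (P : Primitives pp) (A : Adversary pp)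

/-- The challenge elements overwrite the public keys of the guessed parties. Since `a` and `b` are
uniform, this amounts to making them the honest secret keys of these parties. -/
theorem ddhExp_eq (real : Bool) :
    ddhExp P ((ddhReduction pp).apply A) real =
      (PMF.uniformOfFintype (Guess pp)).bind fun g =>
        (PMF.uniformOfFintype (Fin pp.nP → Fin pp.q)).bind fun sk =>
          (uniformExp pp).bind fun c =>
            let n : ℕ := if real then (sk g.1.1.1 : ℕ) * sk g.1.1.2 else c
            simWin P A (P.expKey n) (P.expKey n) g sk := by
  let W : Guess pp → Fin pp.q → Fin pp.q → Fin pp.q → (Fin pp.nP → Fin pp.q) → PMF Bool :=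
    fun g a b c sk => simWin P A (P.expKey (if real then (a : ℕ) * b else c))
      (P.expKey (if real then (a : ℕ) * b else c)) g sk
  have h1 : ∀ a b c : Fin pp.q,
      (((ddhReduction pp).apply A (P.encode P.g, P.encode (P.g ^ (a : ℕ)), P.encode (P.g ^ (b : ℕ)),
        P.encode (P.g ^ (if real then (a : ℕ) * (b : ℕ) else (c : ℕ))))).run
          (redOracle P fun c (_ : Unit) => c.elim) ()).map Prod.fst =
      (PMF.uniformOfFintype (Guess pp)).bind fun g =>
        (PMF.uniformOfFintype (Fin pp.nP → Fin pp.q)).bind fun sk =>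
          W g a b c (Function.update (Function.update sk g.1.1.1 a) g.1.1.2 b) := by
    intro a b c
    rw [ddhReduction, run_apply_pairReduction, PMF.map_bind]
    refine congrArg _ (funext fun g => ?_)
    rw [OracleComp.run_bind, run_sampleKeys, PMF.bind_map, PMF.bind_bind, PMF.map_bind]
    refine congrArg _ (funext fun sk => ?_)
    refine (congrArg _ (PMF.pure_bind _ _)).trans ?_
    rw [PMF.map_comp]
    refine ((hashService_realizes P _ _).map_win _ (by simp [Track.init])).trans ?_
    have hpk : P.pubs (Function.update (Function.update sk g.1.1.1 a) g.1.1.2 b) =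
        Function.update (Function.update (P.pubs sk) g.1.1.1 (P.encode (P.g ^ (a : ℕ))))
          g.1.1.2 (P.encode (P.g ^ (b : ℕ))) := by
      funext x
      simp only [Primitives.pubs, Function.update_apply]
      split_ifs <;> rfl
    have hmask : g.mask (Function.update (Function.update sk g.1.1.1 a) g.1.1.2 b) = g.mask sk :=
      g.mask_congr fun x hx => by
        simp only [Guess.Mem, not_or] at hx
        simp [hx.1, hx.2]
    simp only [W, simWin, simInit, hpk, hmask]
    rfl
  simp only [ddhExp]
  rw [show (uniformExp pp).bind (fun a => (uniformExp pp).bind fun b => (uniformExp pp).bind fun c =>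
      (((ddhReduction pp).apply A (P.encode P.g, P.encode (P.g ^ (a : ℕ)), P.encode (P.g ^ (b : ℕ)),
        P.encode (P.g ^ (if real then (a : ℕ) * (b : ℕ) else (c : ℕ))))).run
          (redOracle P fun c (_ : Unit) => c.elim) ()).map Prod.fst) = _ from
    congrArg _ (funext fun a => congrArg _ (funext fun b => congrArg _ (funext fun c => h1 a b c)))]
  have h2 : ∀ g : Guess pp, ((uniformExp pp).bind fun a => (uniformExp pp).bind fun b =>
      (PMF.uniformOfFintype (Fin pp.nP → Fin pp.q)).bind fun sk => (uniformExp pp).bind fun c =>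
          W g a b c (Function.update (Function.update sk g.1.1.1 a) g.1.1.2 b)) =
      (PMF.uniformOfFintype (Fin pp.nP → Fin pp.q)).bind fun sk => (uniformExp pp).bind fun c =>
          W g (sk g.1.1.1) (sk g.1.1.2) c sk := by
    intro g
    have hg : g.1.1.1 ≠ g.1.1.2 := g.1.2
    have h3 : ∀ a : Fin pp.q, ((uniformExp pp).bind fun b =>
        (PMF.uniformOfFintype (Fin pp.nP → Fin pp.q)).bind fun sk => (uniformExp pp).bind fun c =>
          W g a b c (Function.update (Function.update sk g.1.1.1 a) g.1.1.2 b)) =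
        (PMF.uniformOfFintype (Fin pp.nP → Fin pp.q)).bind fun sk => (uniformExp pp).bind fun c =>
          W g a (sk g.1.1.2) c (Function.update sk g.1.1.1 a) := by
      intro a
      -- First `b` and later `a` are absorbed into the uniform key vector; the two updates commute
      -- because the guessed parties are distinct.
      rw [← PMF.uniform_update g.1.1.2 fun b f => (uniformExp pp).bind fun c =>
        W g a b c (Function.update f g.1.1.1 a)]
      simp only [Function.update_comm hg]
      rfl
    rw [funext h3, ← PMF.uniform_update g.1.1.1 fun a f => (uniformExp pp).bind fun c =>
      W g a (f g.1.1.2) c f]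
    simp only [Function.update_of_ne hg.symm]
    rfl
  refine Eq.trans ?_ (congrArg _ (funext h2))
  rw [PMF.bind_comm (PMF.uniformOfFintype (Guess pp))]
  refine congrArg _ (funext fun a => ?_)
  rw [PMF.bind_comm (PMF.uniformOfFintype (Guess pp))]
  refine congrArg _ (funext fun b => ?_)
  rw [PMF.bind_comm (uniformExp pp)]
  refine congrArg _ (funext fun g => ?_)
  rw [PMF.bind_comm (uniformExp pp)]

/-- The PRF key plays the premaster secret of the guessed parties, and `f`, which supplies the
challenge answer, gives the key of the star. -/
theorem prfExp_eq_of (k : P.G) (f : Bits → BStr pp.κ) :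
    (((prfReduction pp).apply A ()).run (redOracle P (prfOracleWith P k f))
      { queried := [], challenged := none }).map Prod.fst =
    (PMF.uniformOfFintype (Guess pp)).bind fun g =>
      (PMF.uniformOfFintype (Fin pp.nP → Fin pp.q)).bind fun sk =>
        simWin P A (P.messageKey (P.encode k)) (fun salt => f (salt.toBits ++ keyLabel)) g sk := by
  rw [prfReduction, run_apply_pairReduction, PMF.map_bind]
  refine congrArg _ (funext fun g => ?_)
  refine (congrArg (fun p => PMF.map Prod.fst (PMF.bind p _)) (PMF.pure_bind _ _)).trans ?_
  dsimp only
  rw [OracleComp.run_bind, run_sampleKeys, PMF.bind_map, PMF.bind_bind, PMF.map_bind]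
  refine congrArg _ (funext fun sk => ?_)
  refine (congrArg _ (PMF.pure_bind _ _)).trans ?_
  rw [PMF.map_comp]
  exact (prfService_realizes P k f).map_win _ (by simp [Track.init])

theorem prfExp_true :
    prfExp P ((prfReduction pp).apply A ()) true =
      (uniformExp pp).bind fun c => (PMF.uniformOfFintype (Guess pp)).bind fun g =>
        (PMF.uniformOfFintype (Fin pp.nP → Fin pp.q)).bind fun sk =>
          simWin P A (P.expKey c) (P.expKey c) g sk := by
  refine congrArg _ (funext fun c => ?_)
  refine Eq.trans ?_ (prfExp_eq_of P A (P.g ^ (c : ℕ)) (P.prf (P.g ^ (c : ℕ))))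
  have : prfOracle P (P.g ^ (c : ℕ)) true =
      prfOracleWith P (P.g ^ (c : ℕ)) (P.prf (P.g ^ (c : ℕ))) := by
    funext q s
    cases q with
    | eval x => rfl
    | challenge y => simp [prfOracle, prfOracleWith, PMF.pure_map]
  rw [this]

theorem prfExp_false :
    prfExp P ((prfReduction pp).apply A ()) false =
      (uniformExp pp).bind fun c => (PMF.uniformOfFintype (BStr pp.κ)).bind fun z =>
        (PMF.uniformOfFintype (Guess pp)).bind fun g =>
          (PMF.uniformOfFintype (Fin pp.nP → Fin pp.q)).bind fun sk =>
            simWin P A (P.expKey c) (fun _ => z) g sk := by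
  refine congrArg _ (funext fun c => ?_)
  rw [run_prfOracle_false P _ _ _ rfl, PMF.map_bind]
  exact congrArg _ (funext fun z => prfExp_eq_of P A (P.g ^ (c : ℕ)) fun _ => z)

/-- The forger wins whenever the idealized run ends with a forgery. -/
theorem aeadExp_eq (z : BStr pp.κ) :
    (((aeadReduction pp).apply A ()).run (redOracle P (aeadOracle P.aead z))
      { produced := [], win := false }).map (fun x => x.2.win) =
    (PMF.uniformOfFintype (Guess pp)).bind fun g => (uniformExp pp).bind fun c =>
      (PMF.uniformOfFintype (Fin pp.nP → Fin pp.q)).bind fun sk =>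
        simWin P A (P.expKey c) (fun _ => z) g sk := by
  rw [aeadReduction, run_apply_pairReduction, PMF.map_bind]
  refine congrArg _ (funext fun g => ?_)
  have hs : OracleComp.run (redOracle P (aeadOracle P.aead z)) (.query .gen fun g =>
      .query (.coin (pp.q - 1)) fun c => .query (.pow g (Fin.val (n := pp.q - 1 + 1) c)) fun z =>
        (sampleKeys _ _ g pp.nP).bind fun y => .pure (y, Option.getD z fun _ => false))
      (⟨[], false⟩ : AEADState) =
      (uniformExp pp).bind fun c => (PMF.uniformOfFintype (Fin pp.nP → Fin pp.q)).bind fun sk =>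
        PMF.pure (((sk, P.pubs sk), P.encode (P.g ^ (c : ℕ))), ⟨[], false⟩) := by
    rw [uniformExp, ← uniformUpTo_map_cast (Nat.sub_add_cancel pp.q_prime.one_le), PMF.bind_map]
    refine (PMF.pure_bind _ _).trans ((PMF.bind_map _ _ _).trans ?_)
    refine congrArg (PMF.bind _) (funext fun c => (PMF.pure_bind _ _).trans ?_)
    change OracleComp.run _ (OracleComp.bind _ _) _ = _
    rw [OracleComp.run_bind, run_sampleKeys, PMF.bind_map]
    refine congrArg (PMF.bind _) (funext fun sk => ?_)
    simp only [P.powEncoded_encode]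
    rfl
  rw [hs, PMF.bind_bind, PMF.map_bind]
  refine congrArg _ (funext fun c => ?_)
  rw [PMF.bind_bind, PMF.map_bind]
  refine congrArg _ (funext fun sk => ?_)
  rw [PMF.pure_bind, PMF.map_comp]
  have hV := aeadService_realizes P (P.encode (P.g ^ (c : ℕ))) z
  have h1 := hV.map_win ((A (P.pubs sk)).simulate simAdvAnswer (simInit g sk (P.pubs sk)))
    (s := Track.init) (k := fun _ => false) (t := ⟨[], false⟩) (by simp [Track.init])
  -- `map_win` speaks about the flag of the simulator; the invariant at the end of the run
  -- identifies it with the flag of the challenger.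
  have h2 := (hV.run_simulate ((A (P.pubs sk)).simulate simAdvAnswer (simInit g sk (P.pubs sk)))
    (s := Track.init) (k := fun _ => false) (t := ⟨[], false⟩) (by simp [Track.init])).2
  refine Eq.trans ?_ h1
  exact PMF.bind_congr_support fun x hx => congrArg PMF.pure (h2 x hx).2

end Experiments

end

noncomputable section

variable {pp : Params}

/-! ### Evolution of the authentication experiment -/

namespace GameState

/-- `S'` arises from `S` by the progress of the experiment. -/
def Extends (S S' : GameState pp) : Prop :=
  S.revLongTermKey ⊆ S'.revLongTermKey ∧ ∀ x j π, S.sessions x j = some π →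
    ∃ π', S'.sessions x j = some π' ∧ π'.peer = π.peer ∧ π.stages <+: π'.stages ∧
      π.revSessKey ⊆ π'.revSessKey ∧ (π.revState → π'.revState)

theorem _root_.List.IsPrefix.getElem?_eq_some {α : Type*} {l l' : List α} (h : l <+: l') {n : ℕ}
    {a : α} (ha : l[n]? = some a) : l'[n]? = some a := by
  obtain ⟨m, rfl⟩ := h
  obtain ⟨hn, -⟩ := List.getElem?_eq_some_iff.1 ha
  rw [List.getElem?_append_left hn, ha]

variable {S S' : GameState pp}

theorem Extends.refl (S : GameState pp) : S.Extends S :=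
  ⟨subset_rfl, fun _ _ π h => ⟨π, h, rfl, List.prefix_rfl, subset_rfl, id⟩⟩

theorem Fresh.symm {u v : Fin pp.nP} {salt : BStr 128} (h : S.Fresh u v salt) :
    S.Fresh v u salt := by
  refine ⟨h.2.1, h.1, fun π ⟨x, j, hπ, hx⟩ => h.2.2 π ⟨x, j, hπ, hx.symm⟩⟩

/-- Reveals only accumulate and stages are only appended, so freshness can be lost but never gained.
-/
theorem Fresh.of_extends {u v : Fin pp.nP} {salt : BStr 128} (hS : S.Extends S')
    (h : S'.Fresh u v salt) : S.Fresh u v salt := by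
  refine ⟨fun hu => h.1 (hS.1 hu), fun hv => h.2.1 (hS.1 hv), fun π ⟨x, j, hπ, hx⟩ => ?_⟩
  obtain ⟨π', h1, h2, h3, h4, h5⟩ := hS.2 x j π hπ
  obtain ⟨h6, h7⟩ := h.2.2 π' ⟨x, j, h1, by rwa [h2]⟩
  exact ⟨fun h => h6 (h5 h), fun s hs r hr => h7 s (h4 hs) r (h3.getElem?_eq_some hr)⟩

theorem Produced.of_extends {v u : Fin pp.nP} {p : Packet pp} (hS : S.Extends S')
    (h : S.Produced v u p) : S'.Produced v u p := by
  obtain ⟨j, π, h1, h2, r, h3, h4⟩ := h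
  obtain ⟨π', h5, h6, h7, -⟩ := hS.2 v j π h1
  exact ⟨j, π', h5, h6.trans h2, r, h7.subset h3, h4⟩

/-- `S'` arises from `S` by putting `π` in place of session `i` of `u`. -/
structure Updates (S S' : GameState pp) (u : Fin pp.nP) (i : Fin pp.nS) (π : Session pp) :
    Prop where
  sessions : ∀ x j, S'.sessions x j = if x = u ∧ j = i then some π else S.sessions x j
  revLongTermKey : S'.revLongTermKey = S.revLongTermKey
  sk : S'.sk = S.sk

theorem setSession_updates (S : GameState pp) (u : Fin pp.nP) (i : Fin pp.nS) (π : Session pp) :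
    S.Updates (S.setSession u i π) u i π := by
  refine ⟨fun x j => ?_, rfl, rfl⟩
  by_cases hx : x = u
  · subst hx
    by_cases hj : j = i <;> simp [setSession, hj]
  · simp [setSession, hx]

theorem Updates.same {u i π} (h : S.Updates S' u i π) : S'.sessions u i = some π := by
  simp [h.sessions]

theorem Updates.extends_new {u i π} (h : S.Updates S' u i π) (hn : S.sessions u i = none) :
    S.Extends S' := by
  refine ⟨h.revLongTermKey ▸ subset_rfl, fun x j ρ hρ => ⟨ρ, ?_, rfl, List.prefix_rfl, subset_rfl, id⟩⟩
  rw [h.sessions, if_neg, hρ]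
  rintro ⟨rfl, rfl⟩
  simp [hn] at hρ

theorem Updates.extends {u i π π'} (h : S.Updates S' u i π') (hn : S.sessions u i = some π)
    (hp : π'.peer = π.peer) (hs : π.stages <+: π'.stages) (hr : π.revSessKey ⊆ π'.revSessKey)
    (hst : π.revState → π'.revState) : S.Extends S' := by
  refine ⟨h.revLongTermKey ▸ subset_rfl, fun x j ρ hρ => ?_⟩
  by_cases hx : x = u ∧ j = i
  · obtain ⟨rfl, rfl⟩ := hx
    obtain rfl : π = ρ := by simpa [hn] using hρ
    exact ⟨π', h.same, hp, hs, hr, hst⟩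
  · exact ⟨ρ, by rw [h.sessions, if_neg hx, hρ], rfl, List.prefix_rfl, subset_rfl, id⟩

end GameState

namespace Guess

theorem Pair.symm {g : Guess pp} {x y : Fin pp.nP} (h : g.Pair x y) : g.Pair y x := by
  unfold Pair at *; tauto

theorem Pair.fresh_iff {g : Guess pp} {x y u v : Fin pp.nP} (h : g.Pair x y) (h' : g.Pair u v)
    {S : GameState pp} {salt : BStr 128} : S.Fresh x y salt ↔ S.Fresh u v salt := by
  obtain ⟨rfl, rfl⟩ | ⟨rfl, rfl⟩ := h <;> obtain ⟨rfl, rfl⟩ | ⟨rfl, rfl⟩ := h' <;>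
    first | rfl | exact ⟨.symm, .symm⟩

theorem Pair.of_between {g : Guess pp} {x y u v : Fin pp.nP} (h : g.Pair u v)
    (hx : (x = u ∧ y = v) ∨ (x = v ∧ y = u)) : g.Pair x y := by
  obtain ⟨rfl, rfl⟩ | ⟨rfl, rfl⟩ := hx
  · exact h
  · exact h.symm

theorem Pair.between {g : Guess pp} {x y u v : Fin pp.nP} (h : g.Pair u v) (hx : g.Pair x y) :
    (x = u ∧ y = v) ∨ (x = v ∧ y = u) := by
  obtain ⟨rfl, rfl⟩ | ⟨rfl, rfl⟩ := h <;> obtain ⟨rfl, rfl⟩ | ⟨rfl, rfl⟩ := hx <;> simp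

theorem IsStage.pair {g : Guess pp} {u v : Fin pp.nP} {i : Fin pp.nS} {n : ℕ}
    (h : g.IsStage u v i n) : g.Pair u v := .inl ⟨h.1, h.2.1⟩

/-- A stage of a session between the guessed parties has used the salt. -/
def UsedIn (g : Guess pp) (S : GameState pp) (salt : BStr 128) : Prop :=
  ∃ x j π, S.sessions x j = some π ∧ g.Pair x π.peer ∧ ∃ r ∈ π.stages, r.packet.salt = salt

/-- No secret of the guessed parties is revealed, except for message keys. -/
def Clear (g : Guess pp) (S : GameState pp) : Prop :=
  (∀ x, g.Mem x → x ∉ S.revLongTermKey) ∧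
    ∀ x j π, S.sessions x j = some π → g.Pair x π.peer → ¬ π.revState

/-- The guessed stage has been completed. -/
def Executed (g : Guess pp) (S : GameState pp) : Prop :=
  ∃ π, S.sessions g.1.1.1 g.2.1 = some π ∧ π.peer = g.1.1.2 ∧ (g.2.2 : ℕ) < π.stages.length

/-- `Clear` can only be lost and `Executed` only gained. A guess whose stage is still ahead was
therefore in the same situation before, which propagates the `pending` clause of `Coupled`. -/
theorem Clear.of_extends {g : Guess pp} {S S' : GameState pp} (hS : S.Extends S')
    (h : g.Clear S') : g.Clear S := by
  refine ⟨fun x hx hx' => h.1 x hx (hS.1 hx'), fun x j π hπ hp hr => ?_⟩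
  obtain ⟨π', h1, h2, -, -, h3⟩ := hS.2 x j π hπ
  exact h.2 x j π' h1 (by rwa [h2]) (h3 hr)

theorem Executed.of_extends {g : Guess pp} {S S' : GameState pp} (hS : S.Extends S')
    (h : g.Executed S) : g.Executed S' := by
  obtain ⟨π, h1, h2, h3⟩ := h
  obtain ⟨π', h4, h5, h6, -⟩ := hS.2 _ _ π h1
  exact ⟨π', h4, h5.trans h2, h3.trans_le h6.length_le⟩

/-- Freshness for any one salt rules out the reveals that concern the whole pair; only reveals of
message keys depend on the salt. -/
theorem Clear.of_fresh {g : Guess pp} {S : GameState pp} {u v : Fin pp.nP} {salt : BStr 128}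
    (hg : g.Pair u v) (h : S.Fresh u v salt) : g.Clear S := by
  refine ⟨fun x hx => ?_, fun x j π hπ hp => (h.2.2 π ⟨x, j, hπ, hg.between hp⟩).1⟩
  obtain ⟨rfl, rfl⟩ | ⟨rfl, rfl⟩ := hg <;> obtain rfl | rfl := hx
  · exact h.1
  · exact h.2.1
  · exact h.2.1
  · exact h.1

theorem usedIn_update {g : Guess pp} {S S' : GameState pp} {u i π π'} {l : List (StageRecord pp)}
    (h : S.Updates S' u i π') (hn : S.sessions u i = some π) (hp : π'.peer = π.peer)
    (hs : π'.stages = π.stages ++ l) (salt : BStr 128) :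
    g.UsedIn S' salt ↔ g.UsedIn S salt ∨ (g.Pair u π.peer ∧ ∃ r ∈ l, r.packet.salt = salt) := by
  constructor
  · rintro ⟨x, j, ρ, h1, h2, r, h3, h4⟩
    by_cases hx : x = u ∧ j = i
    · obtain ⟨rfl, rfl⟩ := hx
      obtain rfl : π' = ρ := by simpa [h.same] using h1
      rw [hs, List.mem_append] at h3
      rw [hp] at h2
      obtain h3 | h3 := h3
      · exact .inl ⟨x, j, π, hn, h2, r, h3, h4⟩
      · exact .inr ⟨h2, r, h3, h4⟩
    · rw [h.sessions, if_neg hx] at h1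
      exact .inl ⟨x, j, ρ, h1, h2, r, h3, h4⟩
  · rintro (⟨x, j, ρ, h1, h2, r, h3, h4⟩ | ⟨h2, r, h3, h4⟩)
    · by_cases hx : x = u ∧ j = i
      · obtain ⟨rfl, rfl⟩ := hx
        obtain rfl : π = ρ := by simpa [hn] using h1
        exact ⟨x, j, π', h.same, by rwa [hp], r, by simp [hs, h3], h4⟩
      · exact ⟨x, j, ρ, by rw [h.sessions, if_neg hx, h1], h2, r, h3, h4⟩
    · exact ⟨u, i, π', h.same, by rwa [hp], r, by simp [hs, h3], h4⟩

theorem usedIn_new {g : Guess pp} {S S' : GameState pp} {u i π'}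
    (h : S.Updates S' u i π') (hn : S.sessions u i = none) (hs : π'.stages = [])
    (salt : BStr 128) : g.UsedIn S' salt ↔ g.UsedIn S salt := by
  constructor
  · rintro ⟨x, j, ρ, h1, h2, r, h3, h4⟩
    by_cases hx : x = u ∧ j = i
    · obtain ⟨rfl, rfl⟩ := hx
      obtain rfl : π' = ρ := by simpa [h.same] using h1
      simp [hs] at h3
    · rw [h.sessions, if_neg hx] at h1
      exact ⟨x, j, ρ, h1, h2, r, h3, h4⟩
  · rintro ⟨x, j, ρ, h1, h2, r, h3, h4⟩
    obtain ⟨ρ', h5, h6, h7, -⟩ := (h.extends_new hn).2 x j ρ h1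
    exact ⟨x, j, ρ', h5, by rwa [h6], r, h7.subset h3, h4⟩

/-- What the simulator knows of a session of `x`. -/
def view (g : Guess pp) (x : Fin pp.nP) (π : Session pp) : SimSession pp where
  peer := π.peer
  rand := π.rand
  pms := if g.Pair x π.peer then fun _ => false else π.pms
  ctr := π.ctr
  stages := π.stages.map fun r => (r.packet.salt, r.ctr, r.key.isSome)

end Guess

/-! ### The invariant relating the experiment to a single simulator. -/

section Coupling

variable (P : Primitives pp) (sk : Fin pp.nP → Fin pp.q)

/-- The message keys of the guessed parties. -/
def pairKey (g : Guess pp) : BStr 128 → BStr pp.κ :=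
  P.expKey ((sk g.1.1.1 : ℕ) * sk g.1.1.2)

/-- The data in a session of `x` are those that the protocol prescribes. -/
structure SessionWF (x : Fin pp.nP) (π : Session pp) : Prop where
  peer_ne : π.peer ≠ x
  pms : π.pms = P.encode (P.g ^ ((sk x : ℕ) * sk π.peer))
  key : ∀ r ∈ π.stages, ∀ k, r.key = some k → k = P.messageKey π.pms r.packet.salt

/-- The data in the state of the challenger are those that the protocol prescribes. -/
structure GameWF (S : GameState pp) : Prop where
  sk_eq : S.sk = sk
  session : ∀ x j π, S.sessions x j = some π → SessionWF P sk x π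

/-- The entry `e` of the log stems from a packet that one of the guessed parties has sent to the other
one, with the salt `star`. -/
def LogOK (g : Guess pp) (S : GameState pp) (star : Option (BStr 128))
    (e : (Bits × Bits × Bits) × Bits) : Prop :=
  ∃ x y p, star = some p.salt ∧ g.Pair x y ∧ S.Produced x y p ∧
    e.1 = (p.ct, p.nonce.toBits, assocData y x p.kidA p.kidB p.vers p.ctype) ∧
    P.aead.decrypt (pairKey P sk g p.salt) p.nonce.toBits
      (assocData y x p.kidA p.kidB p.vers p.ctype) p.ct = some e.2

/-- The state of a simulator that has answered all queries correctly, without having failed or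
observed a forgery. -/
structure Tracks (g : Guess pp) (S : GameState pp) (s : SimState pp) (t : Track) : Prop where
  guess_eq : s.guess = g
  pk_eq : s.pk = P.pubs sk
  sk_eq : s.sk = g.mask sk
  sessions : ∀ x j, s.sessions x j = (S.sessions x j).map (g.view x)
  not_done : ¬ t.Done
  used : ∀ salt, salt ∈ t.used ↔ g.UsedIn S salt
  star_used : ∀ salt, t.star = some salt → salt ∈ t.used
  star_executed : ∀ salt, t.star = some salt → g.Executed S
  log : ∀ e ∈ t.log, LogOK P sk g S t.star e

/-- The result of one step of a simulator, when the challenger answers by `a` and moves from `S` to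
`S'`: a forgery, a failure for a good reason, or the same answer. -/
def StepOK {α : Type} (g : Guess pp) (S' : GameState pp) (a : α) (t : Track)
    (y : (α × SimState pp) × Track) : Prop :=
  y.2.win = true ∨
  (y.2.dead = true ∧ (∀ salt, t.star = some salt → ∀ u v, g.Pair u v → ¬ S'.Fresh u v salt) ∧
    (g.Clear S' → g.Executed S')) ∨
  (y.1.1 = a ∧ Tracks P sk g S' y.1.2 y.2 ∧ ∀ salt, t.star = some salt → y.2.star = some salt)

variable {P sk} {g : Guess pp} {S S' : GameState pp} {s : SimState pp} {t : Track}

/-- Diffie-Hellman secrets are symmetric, so the sessions of both guessed parties with each other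
share one family of message keys. -/
theorem pairKey_eq {x : Fin pp.nP} {π : Session pp} (h : SessionWF P sk x π)
    (hg : g.Pair x π.peer) : P.messageKey π.pms = pairKey P sk g := by
  rw [h.pms]
  obtain ⟨h1, h2⟩ | ⟨h1, h2⟩ := hg
  · rw [h1, h2]; rfl
  · rw [h1, h2, mul_comm]; rfl

theorem SimState.setSession_sessions (s : SimState pp) (u : Fin pp.nP) (i : Fin pp.nS)
    (π : SimSession pp) (x : Fin pp.nP) (j : Fin pp.nS) :
    (s.setSession u i π).sessions x j = if x = u ∧ j = i then some π else s.sessions x j := by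
  by_cases hx : x = u
  · subst hx
    by_cases hj : j = i <;> simp [setSession, hj]
  · simp [setSession, hx]

theorem Tracks.log_mono {e} (h : Tracks P sk g S s t) (hS : S.Extends S') (he : e ∈ t.log) :
    LogOK P sk g S' t.star e := by
  obtain ⟨x, y, p, h1, h2, h3, h4⟩ := h.log e he
  exact ⟨x, y, p, h1, h2, h3.of_extends hS, h4⟩

theorem Tracks.start {u i} {π : Session pp} (h : Tracks P sk g S s t)
    (hn : S.sessions u i = none) (hu : S.Updates S' u i π) (hs : π.stages = []) :
    Tracks P sk g S' (s.setSession u i (g.view u π)) t where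
  guess_eq := h.guess_eq
  pk_eq := h.pk_eq
  sk_eq := h.sk_eq
  sessions x j := by
    rw [SimState.setSession_sessions, hu.sessions]
    split
    · rename_i hx; simp [hx.1]
    · exact h.sessions x j
  not_done := h.not_done
  used salt := by rw [h.used, Guess.usedIn_new hu hn hs]
  star_used := h.star_used
  star_executed salt hst := (h.star_executed salt hst).of_extends (hu.extends_new hn)
  log e he := h.log_mono (hu.extends_new hn) he

/-- Reveal queries do not change what the simulator knows. -/
theorem Tracks.reveal {u i} {π π' : Session pp} (h : Tracks P sk g S s t)
    (hn : S.sessions u i = some π) (hu : S.Updates S' u i π') (hv : g.view u π' = g.view u π)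
    (hs : π'.stages = π.stages) (hS : S.Extends S') : Tracks P sk g S' s t where
  guess_eq := h.guess_eq
  pk_eq := h.pk_eq
  sk_eq := h.sk_eq
  sessions x j := by
    rw [hu.sessions]
    split
    · rename_i hx; rw [hx.1, hx.2, h.sessions, hn]; simp [hv]
    · exact h.sessions x j
  not_done := h.not_done
  used salt := by
    rw [h.used, Guess.usedIn_update (l := []) hu hn (congrArg SimSession.peer hv) (by simp [hs])]
    simp
  star_used := h.star_used
  star_executed salt hst := (h.star_executed salt hst).of_extends hS
  log e he := h.log_mono hS he

/-- Collects what a completed stage may do to the bookkeeping: record its salt if the session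
belongs to the pair, set the star once and in the guessed stage only, and log a packet sent with the
star. -/
theorem Tracks.stage {u i} {π π' : Session pp} {t' : Track} {r : StageRecord pp}
    (h : Tracks P sk g S s t) (hn : S.sessions u i = some π) (hu : S.Updates S' u i π')
    (hS : S.Extends S') (hp : π'.peer = π.peer) (hs : π'.stages = π.stages ++ [r])
    (hd : ¬ t'.Done)
    (hused : ∀ salt, salt ∈ t'.used ↔ salt ∈ t.used ∨ (g.Pair u π.peer ∧ r.packet.salt = salt))
    (hstar : t'.star = t.star ∨ (t.star = none ∧ t'.star = some r.packet.salt ∧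
      g.IsStage u π.peer i π.stages.length))
    (hlog : t'.log = t.log ∨ ∃ m, t'.star = some r.packet.salt ∧ g.Pair u π.peer ∧
      r.dir = .sent ∧ t'.log = ((r.packet.ct, r.packet.nonce.toBits, assocData π.peer u
        r.packet.kidA r.packet.kidB r.packet.vers r.packet.ctype), m) :: t.log ∧
      P.aead.decrypt (pairKey P sk g r.packet.salt) r.packet.nonce.toBits
        (assocData π.peer u r.packet.kidA r.packet.kidB r.packet.vers r.packet.ctype)
          r.packet.ct = some m) :
    Tracks P sk g S' (s.setSession u i (g.view u π')) t' where
  guess_eq := h.guess_eq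
  pk_eq := h.pk_eq
  sk_eq := h.sk_eq
  sessions x j := by
    rw [SimState.setSession_sessions, hu.sessions]
    split
    · rename_i hx; simp [hx.1]
    · exact h.sessions x j
  not_done := hd
  used salt := by
    rw [hused, h.used, Guess.usedIn_update hu hn hp hs]
    simp
  star_used salt hst := by
    rw [hused]
    obtain h1 | ⟨-, h1, h2⟩ := hstar
    · exact .inl (h.star_used salt (h1 ▸ hst))
    · rw [hst] at h1
      exact .inr ⟨h2.pair, (Option.some.inj h1).symm⟩
  star_executed salt hst := by
    obtain h1 | ⟨-, -, h2⟩ := hstar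
    · exact (h.star_executed salt (h1 ▸ hst)).of_extends hS
    · obtain ⟨rfl, h3, rfl, h4⟩ := h2
      -- The guessed index equals the length of the old list, hence is smaller than the length of
      -- the new one.
      exact ⟨π', hu.same, hp.trans h3, by simp [hs, ← h4]⟩
  log e he := by
    have old : e ∈ t.log → LogOK P sk g S' t'.star e := fun he => by
      obtain ⟨x, y, p, h1, h2⟩ := h.log_mono hS he
      refine ⟨x, y, p, ?_, h2⟩
      -- If the star changes, it was `none` before, and then the log cannot have had an entry.
      obtain h3 | ⟨h3, -⟩ := hstar
      · rwa [h3]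
      · simp [h3] at h1
    obtain h1 | ⟨m, h1, h2, h3, h4, h5⟩ := hlog
    · exact old (h1 ▸ he)
    · rw [h4, List.mem_cons] at he
      obtain rfl | he := he
      · exact ⟨u, π.peer, r.packet, h1, h2, ⟨i, π', hu.same, hp, r, by simp [hs], h3, rfl⟩, rfl, h5⟩
      · exact old he

end Coupling

end

/-! ### Correctness of a simulator in a single stage. -/

noncomputable section

variable {pp : Params}

theorem List.mem_of_lookup_eq_some {α β : Type*} [BEq α] [LawfulBEq α] {l : List (α × β)} {a : α}
    {b : β} (h : l.lookup a = some b) : (a, b) ∈ l := by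
  obtain ⟨l₁, l₂, rfl, -⟩ := List.lookup_eq_some_iff.1 h
  simp

theorem BStr.length_toBits {n : ℕ} (x : BStr n) : x.toBits.length = n := List.length_ofFn

/-- All fields have fixed lengths, so the concatenation can be parsed uniquely, and user identifiers
are distinct. This lets a log entry determine the packet and its direction. -/
theorem assocData_inj {u v u' v' : Fin pp.nP} {a b a' b' : BStr pp.kidLen}
    {c c' : BStr pp.versLen} {d d' : BStr pp.ctypeLen}
    (h : assocData u v a b c d = assocData u' v' a' b' c' d') :
    u = u' ∧ v = v' ∧ a = a' ∧ b = b' ∧ c = c' ∧ d = d' := by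
  simp only [assocData] at h
  obtain ⟨h, h1⟩ := List.append_inj h (by simp [BStr.length_toBits])
  obtain ⟨h, h2⟩ := List.append_inj h (by simp [BStr.length_toBits])
  obtain ⟨h, h3⟩ := List.append_inj h (by simp [BStr.length_toBits])
  obtain ⟨h, h4⟩ := List.append_inj h (by simp [BStr.length_toBits])
  obtain ⟨h, h5⟩ := List.append_inj h (by simp [BStr.length_toBits])
  exact ⟨pp.uid_injective (BStr.toBits_injective h), pp.uid_injective (BStr.toBits_injective h5),
    BStr.toBits_injective h4, BStr.toBits_injective h3, BStr.toBits_injective h2,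
    BStr.toBits_injective h1⟩

section Steps

variable {P : Primitives pp} {sk : Fin pp.nP → Fin pp.q}
  {g : Guess pp} {S S' : GameState pp} {s : SimState pp} {t : Track}

theorem StepOK.unchanged {α : Type} {a : α} (h : Tracks P sk g S' s t) :
    StepOK P sk g S' a t ((a, s), t) := .inr (.inr ⟨rfl, h, fun _ h => h⟩)

/-- A star presupposes that the guessed stage has been completed, but here this stage is only about
to run. -/
theorem Tracks.star_eq_none {u i} {π : Session pp} (h : Tracks P sk g S s t)
    (hn : S.sessions u i = some π) (hg : g.IsStage u π.peer i π.stages.length) :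
    t.star = none := by
  obtain ⟨rfl, h1, rfl, h2⟩ := hg
  by_contra hne
  obtain ⟨salt, hs⟩ := Option.ne_none_iff_exists'.1 hne
  obtain ⟨π', h3, -, h4⟩ := h.star_executed salt hs
  obtain rfl : π = π' := by simpa [hn] using h3
  omega

theorem Tracks.log_eq_nil (h : Tracks P sk g S s t) (hs : t.star = none) : t.log = [] := by
  rw [List.eq_nil_iff_forall_not_mem]
  intro e he
  obtain ⟨x, y, p, h1, -⟩ := h.log e he
  simp [hs] at h1

/-- Failure at the guessed stage is harmless: no salt was fixed, so no fresh stage relied on this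
simulator, and the stage no longer lies ahead. -/
theorem StepOK.kill {α : Type} {a b : α} {u i} {π π' : Session pp} {r : StageRecord pp}
    {s' : SimState pp} (h : Tracks P sk g S s t) (hn : S.sessions u i = some π)
    (hu : S.Updates S' u i π') (hp : π'.peer = π.peer) (hs : π'.stages = π.stages ++ [r])
    (hg : g.IsStage u π.peer i π.stages.length) : StepOK P sk g S' a t ((b, s'), t.kill) := by
  refine .inr (.inl ⟨rfl, fun salt hst => ?_, fun _ => ?_⟩)
  · simp [h.star_eq_none hn hg] at hst
  · obtain ⟨rfl, h1, rfl, h2⟩ := hg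
    exact ⟨π', hu.same, hp.trans h1, by simp [hs, ← h2]⟩

/-- The stage index is a separate variable `n`, so that the index computed from the list of the
challenger can be used in the dependent access to the randomness. -/
theorem simAnswer_plaintext {u i} {ρ : SimSession pp} (hs : s.sessions u i = some ρ) {n : ℕ}
    (hn : ρ.stages.length = n) (hlt : n < pp.nT) (vers ctype m) :
    simAnswer (.send u i (.plaintext vers ctype m)) s =
      let r := ρ.rand ⟨n, hlt⟩
      let nc := mkNonce ρ.ctr r.2
      let ad := assocData ρ.peer u (pp.kid u) (pp.kid ρ.peer) vers ctype
      let fin : Bits → Option (Output pp) × SimState pp := fun c =>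
        (some (.packet ⟨vers, ctype, r.1, c, nc, pp.kid u, pp.kid ρ.peer⟩),
          s.setSession u i { ρ with
            ctr := ρ.ctr + 1, stages := ρ.stages ++ [(r.1, ρ.ctr, true)] })
      if s.guess.Pair u ρ.peer then
        .query (.pairEnc (s.guess.IsStage u ρ.peer i n) r.1 nc.toBits ad m) fun c => .pure (fin c)
      else
        .query (.hash (keyInput ρ.pms r.1)) fun k =>
          .query (.encrypt k nc.toBits ad m) fun c => .pure (fin c) := by
  subst hn
  simp only [simAnswer, hs, dif_pos hlt]

theorem simAnswer_packet {u i} {ρ : SimSession pp} (hs : s.sessions u i = some ρ) {n : ℕ}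
    (hn : ρ.stages.length = n) (hlt : n < pp.nT) (p : Packet pp) :
    simAnswer (.send u i (.packet p)) s =
      let ad := assocData u ρ.peer p.kidA p.kidB p.vers p.ctype
      let fin : Option Bits → Option (Output pp) × SimState pp := fun m =>
        (m.map .plaintext, s.setSession u i { ρ with
          stages := ρ.stages ++ [(p.salt, ρ.ctr, m.isSome)] })
      if s.guess.Pair u ρ.peer then
        .query (.pairDec (s.guess.IsStage u ρ.peer i n) p.salt p.nonce.toBits ad p.ct)
          fun m => .pure (fin m)
      else
        .query (.hash (keyInput ρ.pms p.salt)) fun k =>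
          .query (.decrypt k p.nonce.toBits ad p.ct) fun m => .pure (fin m) := by
  subst hn
  simp only [simAnswer, hs, dif_pos hlt]

theorem runStage_packet (P : Primitives pp) (u : Fin pp.nP) (π : Session pp) (r : StageRand)
    (p : Packet pp) :
    P.runStage u π r (.packet p) =
      let k := P.messageKey π.pms p.salt
      let m := P.aead.decrypt k p.nonce.toBits
        (assocData u π.peer p.kidA p.kidB p.vers p.ctype) p.ct
      ({ π with stages := π.stages ++ [⟨.received, p, π.ctr, m.map fun _ => k⟩] },
        m.map .plaintext) := by
  simp only [Primitives.runStage]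
  cases P.aead.decrypt (P.messageKey π.pms p.salt) p.nonce.toBits
    (assocData u π.peer p.kidA p.kidB p.vers p.ctype) p.ct <;> rfl

theorem run_query_pure {α : Type} {o : (op : SimOp pp) → Track → PMF (op.Answer × Track)}
    {op : SimOp pp} {c : OracleComp (SimOp pp) SimOp.Answer α} {f : op.Answer → α} {b t'}
    (hc : c = .query op fun x => .pure (f x)) (h : o op t = PMF.pure (b, t')) :
    c.run o t = PMF.pure (f b, t') := by
  rw [hc, OracleComp.run, h, PMF.pure_bind]; rfl

/-- The bookkeeping after a successful operation with the salt. -/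
structure TrackStep (first : Prop) (salt : BStr 128) (t t' : Track) : Prop where
  not_done : ¬ t'.Done
  used : ∀ x, x ∈ t'.used ↔ x ∈ t.used ∨ salt = x
  star : t'.star = t.star ∨ (t.star = none ∧ t'.star = some salt ∧ first)
  star_of_first : first → t'.star = some salt

/-- With equal key families, fixing a salt affects the bookkeeping only. The answer is the genuine
ciphertext unless the guessed stage finds its salt used or a star already set. -/
theorem simOracle_pairEnc (P : Primitives pp) (K : BStr 128 → BStr pp.κ) {t : Track}
    (hd : ¬ t.Done) (hs : ∀ salt, t.star = some salt → salt ∈ t.used) (first : Prop)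
    [Decidable first] (salt : BStr 128) (n ad m : Bits) :
    ∃ c t', simOracle P K K (.pairEnc first salt n ad m) t = PMF.pure (c, t') ∧
      ((first ∧ (t.star ≠ none ∨ salt ∈ t.used) ∧ t' = t.kill) ∨
      (c = P.aead.encrypt (K salt) n ad m ∧ TrackStep first salt t t' ∧
        (t'.log = t.log ∨ (t'.star = some salt ∧
          t'.log = ((P.aead.encrypt (K salt) n ad m, n, ad), m) :: t.log)))) := by
  by_cases hf : first
  · by_cases hu : t.star = none ∧ salt ∉ t.used
    · refine ⟨_, _, congrArg PMF.pure ((if_neg hd).trans ((if_pos (by simpa using hf)).trans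
        (if_pos hu))), .inr ⟨rfl, ⟨hd, fun x => ?_, .inr ⟨hu.1, rfl, hf⟩, fun _ => rfl⟩,
        .inr ⟨rfl, rfl⟩⟩⟩
      simp [Track.add, Track.fix, or_comm, eq_comm]
    · refine ⟨_, _, congrArg PMF.pure ((if_neg hd).trans ((if_pos (by simpa using hf)).trans
        (if_neg hu))), .inl ⟨hf, by tauto, rfl⟩⟩
  · by_cases hu : t.star = some salt
    · refine ⟨_, _, congrArg PMF.pure ((if_neg hd).trans ((if_neg (by simpa using hf)).trans
        (if_pos hu))), .inr ⟨rfl, ⟨hd, fun x => ?_, .inl rfl, fun h => absurd h hf⟩,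
        .inr ⟨hu, rfl⟩⟩⟩
      simp only [Track.add, iff_self_or]
      rintro rfl; exact hs _ hu
    · refine ⟨_, _, congrArg PMF.pure ((if_neg hd).trans ((if_neg (by simpa using hf)).trans
        (if_neg hu))), .inr ⟨rfl, ⟨hd, fun x => ?_, .inl rfl, fun h => absurd h hf⟩, .inl rfl⟩⟩
      simp [Track.use, or_comm, eq_comm]

/-- Answers from the log are genuine by `hl`. Outside the log, success is a win, and rejection
leaves the flag at its old value false. -/
theorem Track.starDec_cases (P : Primitives pp) (k : BStr pp.κ) {t : Track} (hd : ¬ t.Done)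
    (n ad c : Bits) (hl : ∀ m, ((c, n, ad), m) ∈ t.log → P.aead.decrypt k n ad c = some m) :
    (t.starDec P k n ad c).2.win = true ∨
      ((t.starDec P k n ad c).1 = P.aead.decrypt k n ad c ∧ (t.starDec P k n ad c).2 = t ∧
        ((P.aead.decrypt k n ad c).isSome → ∃ m, ((c, n, ad), m) ∈ t.log)) := by
  unfold Track.starDec
  cases h : t.log.lookup (c, n, ad) with
  | some m =>
    have := List.mem_of_lookup_eq_some h
    exact .inr ⟨(hl m this).symm, rfl, fun _ => ⟨m, this⟩⟩
  | none =>
    cases hc : P.aead.decrypt k n ad c with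
    | some m => exact .inl rfl
    | none =>
      refine .inr ⟨rfl, ?_, by simp⟩
      simp only [Done, not_or, Bool.not_eq_true] at hd
      simp [accept, ← hd.2]

theorem simOracle_pairDec (P : Primitives pp) (K : BStr 128 → BStr pp.κ) {t : Track}
    (hd : ¬ t.Done) (hs : ∀ salt, t.star = some salt → salt ∈ t.used) (first : Prop)
    [Decidable first] (salt : BStr 128) (n ad c : Bits)
    (hl : ∀ m, ((c, n, ad), m) ∈ t.log → t.star = some salt →
      P.aead.decrypt (K salt) n ad c = some m) (hnil : t.star = none → t.log = []) :
    ∃ m t', simOracle P K K (.pairDec first salt n ad c) t = PMF.pure (m, t') ∧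
      ((first ∧ (t.star ≠ none ∨ salt ∈ t.used) ∧ t' = t.kill) ∨ t'.win = true ∨
      (m = P.aead.decrypt (K salt) n ad c ∧ TrackStep first salt t t' ∧ t'.log = t.log ∧
        (t'.star = some salt → (P.aead.decrypt (K salt) n ad c).isSome →
          ∃ m, ((c, n, ad), m) ∈ t.log))) := by
  by_cases hf : first
  · by_cases hu : t.star = none ∧ salt ∉ t.used
    · refine ⟨(Track.starDec P (K salt) n ad c (t.fix salt)).1, (Track.starDec P (K salt) n ad c (t.fix salt)).2,
        congrArg PMF.pure ((if_neg hd).trans ((if_pos (by simpa using hf)).trans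
        (if_pos hu))), .inr ?_⟩
      obtain h | ⟨h1, h2, h3⟩ := Track.starDec_cases P (K salt) (t := t.fix salt) hd n ad c
        fun m hm => by simp [Track.fix, hnil hu.1] at hm
      · exact .inl h
      · rw [h2]
        refine .inr ⟨h1, ⟨hd, fun x => ?_, .inr ⟨hu.1, rfl, hf⟩, fun _ => rfl⟩, rfl, fun _ => h3⟩
        simp [Track.fix, or_comm, eq_comm]
    · refine ⟨_, _, congrArg PMF.pure ((if_neg hd).trans ((if_pos (by simpa using hf)).trans
        (if_neg hu))), .inl ⟨hf, by tauto, rfl⟩⟩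
  · by_cases hu : t.star = some salt
    · refine ⟨(Track.starDec P (K salt) n ad c t).1, (Track.starDec P (K salt) n ad c t).2,
        congrArg PMF.pure ((if_neg hd).trans ((if_neg (by simpa using hf)).trans
        (if_pos hu))), .inr ?_⟩
      obtain h | ⟨h1, h2, h3⟩ := Track.starDec_cases P (K salt) hd n ad c
        fun m hm => hl m hm hu
      · exact .inl h
      · rw [h2]
        refine .inr ⟨h1, ⟨hd, fun x => ?_, .inl rfl, fun h => absurd h hf⟩, rfl, fun _ => h3⟩
        simp only [iff_self_or]
        rintro rfl; exact hs _ hu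
    · refine ⟨_, _, congrArg PMF.pure ((if_neg hd).trans ((if_neg (by simpa using hf)).trans
        (if_neg hu))), .inr (.inr ⟨rfl, ⟨hd, fun x => ?_, .inl rfl, fun h => absurd h hf⟩, rfl,
          fun h => absurd h hu⟩)⟩
      simp [Track.use, or_comm, eq_comm]

/-- After the guessed stage, if its salt is new, the simulator has fixed this salt. -/
def FixOK (g : Guess pp) (u v : Fin pp.nP) (i : Fin pp.nS) (n : ℕ) (salt : BStr 128)
    (t t' : Track) : Prop :=
  g.IsStage u v i n → t.star = none → salt ∉ t.used →
    t'.win = true ∨ (t'.dead = false ∧ t'.star = some salt)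

theorem stepOK_plaintext {u i} {π π' : Session pp} {out} {vers ctype m}
    (h : Tracks P sk g S s t) (hwf : SessionWF P sk u π) (hn : S.sessions u i = some π)
    (hlt : π.stages.length < pp.nT)
    (hr : P.runStage u π (π.rand ⟨_, hlt⟩) (.plaintext vers ctype m) = (π', out))
    (hu : S.Updates S' u i π') :
    ∃ y, (simAnswer (.send u i (.plaintext vers ctype m)) s).run
        (simOracle P (pairKey P sk g) (pairKey P sk g)) t = PMF.pure y ∧
      StepOK P sk g S' out t y ∧
      FixOK g u π.peer i π.stages.length (π.rand ⟨_, hlt⟩).1 t y.2 := by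
  have hs : s.sessions u i = some (g.view u π) := by rw [h.sessions, hn]; rfl
  rw [simAnswer_plaintext hs (n := π.stages.length) (by simp [Guess.view]) hlt, h.guess_eq]
  simp only [Primitives.runStage, Prod.mk.injEq] at hr
  obtain ⟨hπ, hout⟩ := hr
  set r := π.rand ⟨π.stages.length, hlt⟩ with hrdef
  set ad := assocData π.peer u (pp.kid u) (pp.kid π.peer) vers ctype with had
  set nc := (mkNonce π.ctr r.2).toBits with hnc
  set ct := P.aead.encrypt (P.messageKey π.pms r.1) nc ad m with hct
  let rec' : StageRecord pp := ⟨.sent, ⟨vers, ctype, r.1, ct, mkNonce π.ctr r.2, pp.kid u,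
    pp.kid π.peer⟩, π.ctr, some (P.messageKey π.pms r.1)⟩
  have hp : π'.peer = π.peer := by rw [← hπ]
  have hst : π'.stages = π.stages ++ [rec'] := by rw [← hπ]
  have hS : S.Extends S' := hu.extends hn hp (hst ▸ List.prefix_append _ _) (by rw [← hπ])
    (by rw [← hπ]; exact id)
  have hv : s.setSession u i { g.view u π with
      ctr := π.ctr + 1, stages := (g.view u π).stages ++ [(r.1, π.ctr, true)] } =
      s.setSession u i (g.view u π') := by
    rw [← hπ]; simp [Guess.view]
  have hnd := h.not_done
  by_cases hg : g.Pair u π.peer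
  · have hk : P.messageKey π.pms = pairKey P sk g := pairKey_eq hwf hg
    -- Correctness of the AEAD scheme is what makes later answers from the log agree with real
    -- decryption.
    have hdec : P.aead.decrypt (pairKey P sk g r.1) nc ad ct = some m := by
      rw [hct, hk]; exact P.aead.decrypt_encrypt _ _ _ _
    obtain ⟨c, t', h1, h2⟩ := simOracle_pairEnc P (pairKey P sk g) hnd h.star_used
      (g.IsStage u π.peer i π.stages.length) r.1 nc ad m
    refine ⟨_, run_query_pure (if_pos hg) h1, ?_⟩
    obtain ⟨h2, h3, rfl⟩ | ⟨rfl, h3, h4⟩ := h2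
    · exact ⟨.kill h hn hu hp hst h2, fun _ h4 h5 => by tauto⟩
    · refine ⟨.inr (.inr ⟨?_, ?_, fun salt h0 => ?_⟩), fun h5 _ _ => .inr ⟨?_, h3.star_of_first h5⟩⟩
      · rw [← hout, hct, hk]; rfl
      · refine Eq.mpr (congrArg (fun s => Tracks P sk g S' s t') hv)
          (h.stage hn hu hS hp hst h3.not_done ?_ h3.star ?_)
        · intro x; rw [h3.used]; simp [hg, rec']
        · refine h4.imp_right fun ⟨h4, h5⟩ => ⟨m, h4, hg, rfl, ?_, hdec⟩
          rw [h5, ← hk]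
      · obtain h6 | ⟨h6, -⟩ := h3.star
        · exact h6.trans h0
        · simp [h6] at h0
      · simpa using fun hd => h3.not_done (.inl hd)
  -- Outside the guessed pair the simulator holds the actual premaster secret and computes the stage
  -- itself.
  · have h1 : simOracle P (pairKey P sk g) (pairKey P sk g) (.hash (keyInput π.pms r.1)) t =
      PMF.pure (P.messageKey π.pms r.1, t) := rfl
    have h2 : simOracle P (pairKey P sk g) (pairKey P sk g)
      (.encrypt (P.messageKey π.pms r.1) nc ad m) t = PMF.pure (ct, t) := rfl
    refine ⟨((out, s.setSession u i (g.view u π')), t), ?_, ?_,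
      fun h3 => absurd h3.pair hg⟩
    · refine (congrArg (fun c => OracleComp.run _ c t) (if_neg hg)).trans ?_
      nth_rw 1 [show (g.view u π).pms = π.pms from if_neg hg]
      refine (PMF.pure_bind _ _).trans ((PMF.pure_bind _ _).trans ?_)
      exact congrArg (fun x => PMF.pure (x, t)) (Prod.ext hout hv)
    · refine .inr (.inr ⟨rfl, h.stage hn hu hS hp hst hnd ?_ (.inl rfl) (.inl rfl), fun _ h => h⟩)
      simp [hg]

/-- An entry of the log for a packet that is accepted belongs to a packet that was sent. -/
theorem LogOK.produced {x y : Fin pp.nP} {p : Packet pp} {star : Option (BStr 128)} {m : Bits}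
    (h : LogOK P sk g S star ((p.ct, p.nonce.toBits,
      assocData x y p.kidA p.kidB p.vers p.ctype), m)) :
    ∃ p' : Packet pp, star = some p'.salt ∧
      P.aead.decrypt (pairKey P sk g p'.salt) p.nonce.toBits
        (assocData x y p.kidA p.kidB p.vers p.ctype) p.ct = some m ∧
      (p'.salt = p.salt → S.Produced y x p) := by
  obtain ⟨x', y', p', h1, -, h2, h3, h4⟩ := h
  simp only [Prod.mk.injEq] at h3
  obtain ⟨h5, h6, h7⟩ := h3
  refine ⟨p', h1, by rw [h5, h6, h7]; exact h4, fun h8 => ?_⟩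
  obtain ⟨rfl, rfl, h9, h10, h11, h12⟩ := assocData_inj h7
  have : p = p' := by
    cases p; cases p'
    simp_all [BStr.toBits_injective.eq_iff]
  exact this ▸ h2

/-- The last clause detects the forgery: if the salt of an accepted, unsent packet is the star
already or becomes it in this stage, the simulator wins. The first of its alternatives covers later
uses of the salt, the second its first use. -/
theorem stepOK_packet {u i} {π π' : Session pp} {out} {p : Packet pp} {r : StageRand}
    (h : Tracks P sk g S s t) (hwf : SessionWF P sk u π) (hn : S.sessions u i = some π)
    (hlt : π.stages.length < pp.nT) (hr : P.runStage u π r (.packet p) = (π', out))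
    (hu : S.Updates S' u i π') :
    ∃ y, (simAnswer (.send u i (.packet p)) s).run
        (simOracle P (pairKey P sk g) (pairKey P sk g)) t = PMF.pure y ∧
      StepOK P sk g S' out t y ∧ FixOK g u π.peer i π.stages.length p.salt t y.2 ∧
      ((P.aead.decrypt (P.messageKey π.pms p.salt) p.nonce.toBits
        (assocData u π.peer p.kidA p.kidB p.vers p.ctype) p.ct).isSome →
        ¬ S.Produced π.peer u p → g.Pair u π.peer →
        (t.star = some p.salt ∧ ¬ g.IsStage u π.peer i π.stages.length ∨
          g.IsStage u π.peer i π.stages.length ∧ p.salt ∉ t.used) → y.2.win = true) := by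
  have hs : s.sessions u i = some (g.view u π) := by rw [h.sessions, hn]; rfl
  rw [simAnswer_packet hs (n := π.stages.length) (by simp [Guess.view]) hlt, h.guess_eq]
  rw [runStage_packet, Prod.mk.injEq] at hr
  obtain ⟨hπ, hout⟩ := hr
  set ad := assocData u π.peer p.kidA p.kidB p.vers p.ctype with had
  set D := P.aead.decrypt (P.messageKey π.pms p.salt) p.nonce.toBits ad p.ct with hD
  let rec' : StageRecord pp := ⟨.received, p, π.ctr, D.map fun _ => P.messageKey π.pms p.salt⟩
  have hp : π'.peer = π.peer := by rw [← hπ]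
  have hst : π'.stages = π.stages ++ [rec'] := by rw [← hπ]
  have hS : S.Extends S' := hu.extends hn hp (hst ▸ List.prefix_append _ _) (by rw [← hπ])
    (by rw [← hπ]; exact id)
  have hv : s.setSession u i { g.view u π with
      stages := (g.view u π).stages ++ [(p.salt, π.ctr, D.isSome)] } =
      s.setSession u i (g.view u π') := by
    rw [← hπ]; simp [Guess.view]
  have hnd := h.not_done
  by_cases hg : g.Pair u π.peer
  · have hk : P.messageKey π.pms = pairKey P sk g := pairKey_eq hwf hg
    obtain ⟨c, t', h1, h2⟩ := simOracle_pairDec P (pairKey P sk g) hnd h.star_used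
      (g.IsStage u π.peer i π.stages.length) p.salt p.nonce.toBits ad p.ct
      (fun m hm hst => by
        obtain ⟨p', h2, h3, -⟩ := (h.log _ hm).produced
        rw [hst] at h2
        rwa [Option.some.inj h2]) h.log_eq_nil
    refine ⟨_, run_query_pure (if_pos hg) h1, ?_⟩
    obtain ⟨h2, h3, rfl⟩ | h2 | ⟨rfl, h3, h4, h5⟩ := h2
    · refine ⟨.kill h hn hu hp hst h2, fun _ h4 h5 => by tauto, fun _ _ _ h4 => ?_⟩
      have := h.star_eq_none hn h2
      tauto
    · exact ⟨.inl h2, fun _ _ _ => .inl h2, fun _ _ _ _ => h2⟩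
    · rw [← hk, ← hD] at h5 ⊢
      refine ⟨.inr (.inr ⟨?_, ?_, fun salt h0 => ?_⟩),
        fun h6 _ _ => .inr ⟨?_, h3.star_of_first h6⟩, fun h6 h7 _ h8 => ?_⟩
      · exact hout
      · refine Eq.mpr (congrArg (fun s => Tracks P sk g S' s t') hv)
          (h.stage hn hu hS hp hst h3.not_done ?_ h3.star (.inl h4))
        intro x; rw [h3.used]; simp [hg, rec']
      · obtain h6 | ⟨h6, -⟩ := h3.star
        · exact h6.trans h0
        · simp [h6] at h0
      · simpa using fun hd => h3.not_done (.inl hd)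
      · have hst' : t'.star = some p.salt := by
          obtain ⟨h9, h10⟩ | ⟨h9, -⟩ := h8
          · obtain h11 | ⟨h11, -⟩ := h3.star
            · exact h11.trans h9
            · simp [h11] at h9
          · exact h3.star_of_first h9
        -- Without a win, acceptance under the star key means that the triple is logged. Log entries
        -- carry the salt of the star, so the packet would have been sent.
        obtain ⟨m, hm⟩ := h5 hst' h6
        obtain ⟨p', h9, -, h10⟩ := (h.log _ hm).produced
        refine absurd (h10 ?_) h7
        obtain h11 | ⟨h11, -⟩ := h3.star
        · rw [← h11, hst'] at h9
          exact (Option.some.inj h9).symm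
        · simp [h11] at h9
  · refine ⟨((out, s.setSession u i (g.view u π')), t), ?_, ?_,
      fun h3 => absurd h3.pair hg, fun _ _ h3 => absurd h3 hg⟩
    · refine (congrArg (fun c => OracleComp.run _ c t) (if_neg hg)).trans ?_
      nth_rw 1 [show (g.view u π).pms = π.pms from if_neg hg]
      refine (PMF.pure_bind _ _).trans ((PMF.pure_bind _ _).trans ?_)
      exact congrArg (fun x => PMF.pure (x, t)) (Prod.ext hout hv)
    · refine .inr (.inr ⟨rfl, h.stage hn hu hS hp hst hnd ?_ (.inl rfl) (.inl rfl), fun _ h => h⟩)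
      simp [hg]

end Steps

end

/-! ### All simulators at once: the coupled invariant and reveal queries. -/

noncomputable section

variable {pp : Params}

section Coupling

variable (P : Primitives pp) (sk : Fin pp.nP → Fin pp.q)

/-- The experiment together with the simulators for the guesses in `Γ` that are still alive: whenever a
fresh stage has used a salt, some simulator has fixed this salt, and the simulators whose guessed stage
is yet to come are alive unless a secret has been revealed. -/
structure Coupled (S : GameState pp) (Γ : Finset (Guess pp))
    (t : Guess pp → SimState pp × Track) : Prop where
  not_forged : ¬ S.forged
  wf : GameWF P sk S
  tracks : ∀ g ∈ Γ, Tracks P sk g S (t g).1 (t g).2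
  fixed : ∀ x j π r, S.sessions x j = some π → r ∈ π.stages →
    S.Fresh x π.peer r.packet.salt →
      ∃ g ∈ Γ, g.Pair x π.peer ∧ (t g).2.star = some r.packet.salt
  pending : ∀ g, g.Clear S → ¬ g.Executed S → g ∈ Γ

/-- Either a simulator has observed a forgery, or those that have not failed continue. -/
def Continues {α : Type} (Γ : Finset (Guess pp)) (a : α) (S' : GameState pp)
    (y : Guess pp → (α × SimState pp) × Track) : Prop :=
  (∃ g ∈ Γ, (y g).2.win = true) ∨
    ∃ Γ' ⊆ Γ, (∀ g ∈ Γ', (y g).1.1 = a) ∧ Coupled P sk S' Γ' fun g => ((y g).1.2, (y g).2)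

variable {P sk} {S S' : GameState pp} {Γ : Finset (Guess pp)} {t : Guess pp → SimState pp × Track}

/-- Dead simulators are discarded. The two conditions on a failure in `StepOK` are what this
requires: a salt fixed by the failed simulator is no longer fresh, and its guessed stage is over
unless a secret has been revealed. -/
theorem Coupled.next {α : Type} {a : α} (hJ : Coupled P sk S Γ t) (hS : S.Extends S')
    (hwf : GameWF P sk S') {y : Guess pp → (α × SimState pp) × Track}
    (hy : ∀ g ∈ Γ, StepOK P sk g S' a (t g).2 (y g))
    (hnew : ∀ x j π r, S'.sessions x j = some π → r ∈ π.stages → S'.Fresh x π.peer r.packet.salt →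
      (∃ g ∈ Γ, g.Pair x π.peer ∧ (t g).2.star = some r.packet.salt) ∨
      ∃ g ∈ Γ, g.Pair x π.peer ∧
        ((y g).2.win = true ∨ ((y g).2.dead = false ∧ (y g).2.star = some r.packet.salt)))
    (hforged : S'.forged → ∃ g ∈ Γ, (y g).2.win = true) :
    Continues P sk Γ a S' y := by
  by_cases hw : ∃ g ∈ Γ, (y g).2.win = true
  · exact .inl hw
  have hw' : ∀ g ∈ Γ, ¬ (y g).2.win = true := fun g hg h => hw ⟨g, hg, h⟩
  refine .inr ⟨Γ.filter fun g => (y g).2.dead = false, Finset.filter_subset _ _, fun g hg => ?_,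
    fun h => hw (hforged h), hwf, fun g hg => ?_, fun x j π r h1 h2 h3 => ?_, fun g h1 h2 => ?_⟩
  · rw [Finset.mem_filter] at hg
    obtain h | ⟨h, -⟩ | h := hy g hg.1
    · exact absurd h (hw' g hg.1)
    · simp [hg.2] at h
    · exact h.1
  · rw [Finset.mem_filter] at hg
    obtain h | ⟨h, -⟩ | h := hy g hg.1
    · exact absurd h (hw' g hg.1)
    · simp [hg.2] at h
    · exact h.2.1
  · obtain ⟨g, hg, h4, h5⟩ | ⟨g, hg, h4, h5 | h5⟩ := hnew x j π r h1 h2 h3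
    · obtain h | ⟨-, h, -⟩ | h := hy g hg
      · exact absurd h (hw' g hg)
      · exact absurd h3 (h _ h5 _ _ h4)
      · refine ⟨g, ?_, h4, h.2.2 _ h5⟩
        rw [Finset.mem_filter]
        refine ⟨hg, ?_⟩
        simpa using fun hd => h.2.1.not_done (.inl hd)
    · exact absurd h5 (hw' g hg)
    · exact ⟨g, Finset.mem_filter.2 ⟨hg, h5.1⟩, h4, h5.2⟩
  · have hg : g ∈ Γ := hJ.pending g (h1.of_extends hS) fun h => h2 (h.of_extends hS)
    rw [Finset.mem_filter]
    refine ⟨hg, ?_⟩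
    obtain h | ⟨-, -, h⟩ | h := hy g hg
    · exact absurd h (hw' g hg)
    · exact absurd (h h1) h2
    · simpa using fun hd => h.2.1.not_done (.inl hd)

/-- The case that no stage is added. -/
theorem Coupled.next_of_stages {α : Type} {a : α} (hJ : Coupled P sk S Γ t) (hS : S.Extends S')
    (hwf : GameWF P sk S') {y : Guess pp → (α × SimState pp) × Track}
    (hy : ∀ g ∈ Γ, StepOK P sk g S' a (t g).2 (y g))
    (hold : ∀ x j π r, S'.sessions x j = some π → r ∈ π.stages →
      ∃ π', S.sessions x j = some π' ∧ π'.peer = π.peer ∧ r ∈ π'.stages)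
    (hforged : ¬ S'.forged) : Continues P sk Γ a S' y := by
  refine hJ.next hS hwf hy (fun x j π r h1 h2 h3 => .inl ?_) fun h => absurd h hforged
  obtain ⟨π', h4, h5, h6⟩ := hold x j π r h1 h2
  obtain ⟨g, hg, h7, h8⟩ := hJ.fixed x j π' r h4 h6 (h5 ▸ h3.of_extends hS)
  exact ⟨g, hg, h5 ▸ h7, h8⟩

theorem GameState.Updates.mem_stages {u i} {π : Session pp} (hu : S.Updates S' u i π)
    (h : ∀ r ∈ π.stages, ∃ π', S.sessions u i = some π' ∧ π'.peer = π.peer ∧ r ∈ π'.stages)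
    (x j ρ r) (hρ : S'.sessions x j = some ρ) (hr : r ∈ ρ.stages) :
    ∃ π', S.sessions x j = some π' ∧ π'.peer = ρ.peer ∧ r ∈ π'.stages := by
  rw [hu.sessions] at hρ
  split at hρ
  · rename_i hx
    obtain ⟨rfl, rfl⟩ := hx
    obtain rfl := Option.some.inj hρ
    exact h r hr
  · exact ⟨ρ, hρ, rfl, hr⟩

theorem GameWF.update {u i} {π : Session pp} (h : GameWF P sk S) (hu : S.Updates S' u i π)
    (hπ : SessionWF P sk u π) : GameWF P sk S' := by
  refine ⟨hu.sk.trans h.sk_eq, fun x j ρ hρ => ?_⟩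
  rw [hu.sessions] at hρ
  split at hρ
  · rename_i hx
    obtain ⟨rfl, rfl⟩ := hx
    obtain rfl := Option.some.inj hρ
    exact hπ
  · exact h.session x j ρ hρ

/-- One operation of the adversary, answered by the challenger and by all simulators. -/
def StepCoupled (S : GameState pp) (Γ : Finset (Guess pp)) (t : Guess pp → SimState pp × Track)
    (P : Primitives pp) (sk : Fin pp.nP → Fin pp.q) (q : AdvOp pp) : Prop :=
  ∃ (Ω : Type) (D : PMF Ω) (f : Ω → q.Answer × GameState pp)
    (h : Guess pp → Ω → q.Answer × (SimState pp × Track)), advOracle P q S = D.map f ∧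
    (∀ g ∈ Γ, OracleComp.compOracle (simOracle P (pairKey P sk g) (pairKey P sk g)) simAdvAnswer q
      (t g) = D.map (h g)) ∧
    ∀ ω, (∃ g ∈ Γ, (h g ω).2.2.win = true) ∨
      ∃ Γ' ⊆ Γ, (∀ g ∈ Γ', (h g ω).1 = (f ω).1) ∧ Coupled P sk (f ω).2 Γ' fun g => (h g ω).2

theorem StepCoupled.of_pure {q : Query pp} {a S'} (hq : gameOracle P q S = PMF.pure (a, S'))
    (E : Guess pp → Track → Prop)
    (h : ∀ g ∈ Γ, ∃ y, (simAnswer q (t g).1).run (simOracle P (pairKey P sk g) (pairKey P sk g))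
      (t g).2 = PMF.pure y ∧ StepOK P sk g S' a (t g).2 y ∧ E g y.2)
    (hc : ∀ y : Guess pp → (q.Answer × SimState pp) × Track,
      (∀ g ∈ Γ, StepOK P sk g S' a (t g).2 (y g)) → (∀ g ∈ Γ, E g (y g).2) →
        Continues P sk Γ a S' y) :
    StepCoupled S Γ t P sk (.game q) := by
  have h' : ∀ g, ∃ y : (q.Answer × SimState pp) × Track, g ∈ Γ →
      (simAnswer q (t g).1).run (simOracle P (pairKey P sk g) (pairKey P sk g))
      (t g).2 = PMF.pure y ∧ StepOK P sk g S' a (t g).2 y ∧ E g y.2 := fun g => by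
    by_cases hg : g ∈ Γ
    · obtain ⟨y, hy⟩ := h g hg
      exact ⟨y, fun _ => hy⟩
    -- Simulators outside `Γ` are irrelevant and get an arbitrary result.
    · exact ⟨((a, (t g).1), (t g).2), fun h => absurd h hg⟩
  choose y hy using h'
  refine ⟨Unit, PMF.pure (), fun _ => (a, S'), fun g _ => ((y g).1.1, ((y g).1.2, (y g).2)),
    by rw [PMF.pure_map]; exact hq, fun g hg => ?_,
    fun _ => hc y (fun g hg => (hy g hg).2.1) fun g hg => (hy g hg).2.2⟩
  rw [PMF.pure_map]
  exact (congrArg (PMF.map _) (hy g hg).1).trans (PMF.pure_map _ _)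

theorem Coupled.step_unchanged (hJ : Coupled P sk S Γ t) {q : Query pp} {a}
    (hq : gameOracle P q S = PMF.pure (a, S))
    (h : ∀ g ∈ Γ, simAnswer q (t g).1 = .pure (a, (t g).1)) : StepCoupled S Γ t P sk (.game q) := by
  refine .of_pure hq (fun _ _ => True) (fun g hg => ⟨_, by rw [h g hg]; rfl,
    .unchanged (hJ.tracks g hg), trivial⟩) fun y hy _ => ?_
  exact hJ.next_of_stages (.refl S) hJ.wf hy (fun x j π r h1 h2 => ⟨π, h1, rfl, h2⟩) hJ.not_forged

theorem Tracks.congr {g : Guess pp} {s : SimState pp} {t : Track} (h : Tracks P sk g S s t)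
    (hs : S'.sessions = S.sessions) (hS : S.Extends S') : Tracks P sk g S' s t where
  guess_eq := h.guess_eq
  pk_eq := h.pk_eq
  sk_eq := h.sk_eq
  sessions := by rw [hs]; exact h.sessions
  not_done := h.not_done
  used salt := by rw [h.used]; simp only [Guess.UsedIn, hs]
  star_used := h.star_used
  star_executed salt hst := (h.star_executed salt hst).of_extends hS
  log e he := h.log_mono hS he

theorem Tracks.use {g : Guess pp} {s : SimState pp} {t : Track} (h : Tracks P sk g S s t)
    {salt : BStr 128} (hs : salt ∈ t.used) : Tracks P sk g S s (t.use salt) where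
  guess_eq := h.guess_eq
  pk_eq := h.pk_eq
  sk_eq := h.sk_eq
  sessions := h.sessions
  not_done := h.not_done
  used x := by
    rw [← h.used]
    simp only [Track.use, List.mem_cons, or_iff_right_iff_imp]
    rintro rfl; exact hs
  star_used x hx := List.mem_cons_of_mem _ (h.star_used x hx)
  star_executed := h.star_executed
  log := h.log

theorem Coupled.step_revRand (hJ : Coupled P sk S Γ t) (u i s) :
    StepCoupled S Γ t P sk (.game (.revRand u i s)) := by
  refine hJ.step_unchanged rfl fun g hg => ?_
  simp only [simAnswer, (hJ.tracks g hg).sessions, Option.map_map]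
  rfl

theorem Coupled.step_revLongTermKey (hJ : Coupled P sk S Γ t) (u) :
    StepCoupled S Γ t P sk (.game (.revLongTermKey u)) := by
  have hS : S.Extends { S with revLongTermKey := insert u S.revLongTermKey } :=
    ⟨Set.subset_insert _ _, (GameState.Extends.refl S).2⟩
  refine .of_pure rfl (fun _ _ => True) (fun g hg => ?_) fun y hy _ => ?_
  · have h := hJ.tracks g hg
    by_cases hm : g.Mem u
    · refine ⟨(((t g).1.sk u, (t g).1), (t g).2.kill), ?_, .inr (.inl ⟨rfl, ?_, ?_⟩), trivial⟩
      · simp only [simAnswer, h.guess_eq, if_pos hm, OracleComp.run, simOracle, if_neg h.not_done]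
        exact PMF.pure_bind _ _
      -- With a long-term key of the pair revealed, no stage between the guessed parties is fresh
      -- and `Clear` fails, so giving up is permitted.
      · intro salt _ x y hp hf
        obtain ⟨rfl, rfl⟩ | ⟨rfl, rfl⟩ := hp <;> obtain rfl | rfl := hm
        · exact hf.1 (Set.mem_insert _ _)
        · exact hf.2.1 (Set.mem_insert _ _)
        · exact hf.2.1 (Set.mem_insert _ _)
        · exact hf.1 (Set.mem_insert _ _)
      · exact fun hc => absurd (Set.mem_insert _ _) (hc.1 u hm)
    · refine ⟨((S.sk u, (t g).1), (t g).2), ?_, .unchanged (h.congr rfl hS), trivial⟩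
      have : (t g).1.sk u = S.sk u := by
        rw [h.sk_eq, hJ.wf.sk_eq]
        exact if_neg hm
      simp only [simAnswer, h.guess_eq, if_neg hm, this, OracleComp.run]
  · exact hJ.next_of_stages hS ⟨hJ.wf.sk_eq, hJ.wf.session⟩ hy
      (fun x j π r h1 h2 => ⟨π, h1, rfl, h2⟩) hJ.not_forged

theorem Coupled.step_revState (hJ : Coupled P sk S Γ t) (u i s) :
    StepCoupled S Γ t P sk (.game (.revState u i s)) := by
  cases hn : S.sessions u i with
  | none =>
    refine hJ.step_unchanged (a := none) (by simp only [gameOracle, hn]) fun g hg => ?_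
    simp only [simAnswer, (hJ.tracks g hg).sessions, hn, Option.map_none]
  | some π =>
    have hu := S.setSession_updates u i { π with revState := True }
    have hS := hu.extends hn rfl List.prefix_rfl subset_rfl fun _ => trivial
    have hπ := hJ.wf.session u i π hn
    refine .of_pure (a := π.stateAt s) (S' := S.setSession u i { π with revState := True })
      (by simp only [gameOracle, hn]) (fun _ _ => True) (fun g hg => ?_) fun y hy _ => ?_
    · have h := hJ.tracks g hg
      have hs : (t g).1.sessions u i = some (g.view u π) := by rw [h.sessions, hn]; rfl
      by_cases hp : g.Pair u π.peer
      · refine ⟨((none, (t g).1), (t g).2.kill), ?_, .inr (.inl ⟨rfl, ?_, ?_⟩), trivial⟩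
        · simp only [simAnswer, hs, h.guess_eq]
          refine (congrArg (fun c => OracleComp.run _ c _) (if_pos hp)).trans ?_
          simp only [OracleComp.run, simOracle, if_neg h.not_done]
          exact PMF.pure_bind _ _
        · intro salt _ x y hxy hf
          exact (hf.2.2 _ ⟨u, i, hu.same, hxy.between hp⟩).1 trivial
        · exact fun hc => absurd trivial (hc.2 u i _ hu.same hp)
      · refine ⟨((π.stateAt s, (t g).1), (t g).2), ?_,
          .unchanged (h.reveal hn hu rfl rfl hS), trivial⟩
        simp only [simAnswer, hs, h.guess_eq]
        refine (congrArg (fun c => OracleComp.run _ c _) (if_neg hp)).trans ?_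
        rw [show (g.view u π).pms = π.pms from if_neg hp]
        simp only [OracleComp.run, Guess.view, Session.stateAt, List.length_map,
          List.getElem?_map, Option.map_map]
        rfl
    · exact hJ.next_of_stages hS (hJ.wf.update hu ⟨hπ.1, hπ.2, hπ.3⟩) hy
        (hu.mem_stages fun r hr => ⟨π, hn, rfl, hr⟩) hJ.not_forged

theorem Coupled.step_revSessKey (hJ : Coupled P sk S Γ t) (u i s) :
    StepCoupled S Γ t P sk (.game (.revSessKey u i s)) := by
  cases hn : S.sessions u i with
  | none =>
    refine hJ.step_unchanged (a := none) (by simp only [gameOracle, hn]) fun g hg => ?_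
    simp only [simAnswer, (hJ.tracks g hg).sessions, hn, Option.map_none]
  | some π =>
    have hu := S.setSession_updates u i { π with revSessKey := insert s π.revSessKey }
    have hS := hu.extends hn rfl List.prefix_rfl (Set.subset_insert _ _) id
    have hπ := hJ.wf.session u i π hn
    refine .of_pure (a := (π.stages[(s : ℕ)]?).bind StageRecord.key)
      (S' := S.setSession u i { π with revSessKey := insert s π.revSessKey })
      (by simp only [gameOracle, hn]) (fun _ _ => True) (fun g hg => ?_) fun y hy _ => ?_
    · have h := hJ.tracks g hg
      have hs : (t g).1.sessions u i = some (g.view u π) := by rw [h.sessions, hn]; rfl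
      have h' := h.reveal hn hu rfl rfl hS
      have hst : (g.view u π).stages[(s : ℕ)]? =
          (π.stages[(s : ℕ)]?).map fun r => (r.packet.salt, r.ctr, r.key.isSome) := by
        simp [Guess.view]
      cases hr : π.stages[(s : ℕ)]? with
      | none =>
        refine ⟨((none, (t g).1), (t g).2), ?_, .unchanged h', trivial⟩
        simp only [simAnswer, hs, hst, hr, Option.map_none, OracleComp.run]
      | some r =>
        have hmem : r ∈ π.stages := List.mem_of_getElem? hr
        cases hk : r.key with
        | none =>
          refine ⟨((none, (t g).1), (t g).2), ?_, ?_, trivial⟩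
          · simp only [simAnswer, hs, hst, hr, Option.map_some, hk, Option.isSome_none,
              OracleComp.run]
          · rw [Option.bind_some, hk]; exact .unchanged h'
        | some k =>
          have hkk := hπ.key r hmem k hk
          by_cases hp : g.Pair u π.peer
          · have hused : r.packet.salt ∈ (t g).2.used :=
              (h.used _).2 ⟨u, i, π, hn, hp, r, hmem, rfl⟩
            -- Revealing the key of the star ends the freshness of all stages with this salt, so the
            -- simulator may give up. The key of any other salt it can compute; that salt is in use
            -- already, so recording it again is harmless.
            by_cases hstar : (t g).2.star = some r.packet.salt
            · refine ⟨((some fun _ => false, (t g).1), (t g).2.kill), ?_,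
                .inr (.inl ⟨rfl, ?_, ?_⟩), trivial⟩
              · simp only [simAnswer, hs, hst, hr, Option.map_some, hk, Option.isSome_some,
                  h.guess_eq]
                refine (congrArg (fun c => OracleComp.run _ c _) (if_pos hp)).trans ?_
                simp only [OracleComp.run, simOracle, if_neg h.not_done, if_pos hstar]
                exact PMF.pure_bind _ _
              · intro salt hsalt x y hxy hf
                rw [hstar] at hsalt
                exact (hf.2.2 _ ⟨u, i, hu.same, hxy.between hp⟩).2 s (Set.mem_insert _ _) r hr
                  (Option.some.inj hsalt)
              · exact fun _ => (h.star_executed _ hstar).of_extends hS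
            · refine ⟨((some k, (t g).1), (t g).2.use r.packet.salt), ?_, ?_, trivial⟩
              · simp only [simAnswer, hs, hst, hr, Option.map_some, hk, Option.isSome_some,
                  h.guess_eq]
                refine (congrArg (fun c => OracleComp.run _ c _) (if_pos hp)).trans ?_
                rw [hkk, pairKey_eq hπ hp]
                simp only [OracleComp.run, simOracle, if_neg h.not_done, if_neg hstar]
                exact PMF.pure_bind _ _
              · rw [Option.bind_some, hk]
                exact .inr (.inr ⟨rfl, h'.use hused, fun _ h => h⟩)
          · refine ⟨((some k, (t g).1), (t g).2), ?_, ?_, trivial⟩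
            · simp only [simAnswer, hs, hst, hr, Option.map_some, hk, Option.isSome_some,
                h.guess_eq]
              refine (congrArg (fun c => OracleComp.run _ c _) (if_neg hp)).trans ?_
              rw [show (g.view u π).pms = π.pms from if_neg hp, hkk]
              exact PMF.pure_bind _ _
            · rw [Option.bind_some, hk]; exact .unchanged h'
    · exact hJ.next_of_stages hS (hJ.wf.update hu ⟨hπ.1, hπ.2, hπ.3⟩) hy
        (hu.mem_stages fun r hr => ⟨π, hn, rfl, hr⟩) hJ.not_forged

end Coupling

end

/-! ### The coupled invariant under send queries, and the resulting union bound. -/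

noncomputable section

variable {pp : Params}

section Coupling

variable {P : Primitives pp} {sk : Fin pp.nP → Fin pp.q} {S S' : GameState pp}
  {Γ : Finset (Guess pp)} {t : Guess pp → SimState pp × Track}

/-- The coupling gives the challenger and all simulators the same stage randomness. Outside the
guessed pair the premaster secret is computable from one secret key. -/
theorem Coupled.step_start (hJ : Coupled P sk S Γ t) {u i role peer}
    (hn : S.sessions u i = none) (hpeer : peer ≠ u) :
    StepCoupled S Γ t P sk (.game (.send u i (.start role peer))) := by
  let π := fun rand => P.activate (S.sk u) role peer (P.pub (S.sk peer)) rand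
  have hwf : ∀ rand, SessionWF P sk u (π rand) := fun rand => by
    refine ⟨hpeer, ?_, fun r hr => by simp [π, Primitives.activate] at hr⟩
    simp only [π, Primitives.activate, Primitives.pub, hJ.wf.sk_eq, ← pow_mul, mul_comm]
  have hu := fun rand => S.setSession_updates u i (π rand)
  refine ⟨Fin pp.nT → StageRand, PMF.uniformOfFintype _, fun rand => (none, S.setSession u i (π rand)),
    fun g rand => (none, ((t g).1.setSession u i (g.view u (π rand)), (t g).2)), ?_, fun g hg => ?_,
    fun rand => ?_⟩
  · simp only [advOracle, gameOracle, hn, if_neg hpeer]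
    rfl
  · have h := hJ.tracks g hg
    have hs : (t g).1.sessions u i = none := by rw [h.sessions, hn]; rfl
    simp only [OracleComp.compOracle, simAdvAnswer, simAnswer, hs, if_neg hpeer, h.guess_eq]
    refine (congrArg (PMF.map _) (a₂ := (PMF.uniformOfFintype (Fin pp.nT → StageRand)).bind
      fun rand => PMF.pure ((none, (t g).1.setSession u i (g.view u (π rand))), (t g).2)) ?_).trans ?_
    · refine (PMF.bind_map _ _ _).trans (congrArg (PMF.bind _) (funext fun rand => ?_))
      by_cases hp : g.Pair u peer
      · refine (congrArg (fun c => OracleComp.run _ c _) (if_pos hp)).trans ?_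
        have : g.view u (π rand) = ⟨peer, rand, fun _ => false, 0, []⟩ := by
          simp [Guess.view, π, Primitives.activate, hp]
        rw [this]
        rfl
      · refine (congrArg (fun c => OracleComp.run _ c _) (if_neg hp)).trans ?_
        have : g.view u (π rand) = ⟨peer, rand, (π rand).pms, 0, []⟩ := by
          simp [Guess.view, π, Primitives.activate, hp]
        rw [this]
        have hpow : P.powEncoded (if g.Mem u then (t g).1.pk u else (t g).1.pk peer)
            (if g.Mem u then (t g).1.sk peer else (t g).1.sk u : Fin pp.q) = some (π rand).pms := by
          rw [(hwf rand).pms, h.pk_eq, h.sk_eq]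
          by_cases hm : g.Mem u
          · have hm' : ¬ g.Mem peer := by
              unfold Guess.Mem Guess.Pair at *
              rintro (rfl | rfl) <;> obtain rfl | rfl := hm <;> simp_all
            rw [if_pos hm, if_pos hm]
            simp only [Primitives.pubs, P.powEncoded_encode, Primitives.pub, ← pow_mul, Guess.mask,
              if_neg hm']
            rfl
          · rw [if_neg hm, if_neg hm]
            simp only [Primitives.pubs, P.powEncoded_encode, Primitives.pub, ← pow_mul, Guess.mask,
              if_neg hm]
            rw [mul_comm]
            rfl
        refine (PMF.pure_bind _ _).trans ?_
        have hguess := h.guess_eq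
        refine congrArg (fun z => PMF.pure ((none, (t g).1.setSession u i
          ⟨peer, rand, Option.getD z fun _ => false, 0, []⟩), (t g).2)) (a₂ := some (π rand).pms) ?_
        rw [hguess]
        exact hpow
    · refine (PMF.map_bind _ _ _).trans (congrArg _ (funext fun rand => ?_))
      exact PMF.pure_map _ _
  · refine Coupled.next_of_stages (y := fun g => ((none, (t g).1.setSession u i
      (g.view u (π rand))), (t g).2)) hJ ((hu rand).extends_new hn) (hJ.wf.update (hu rand) (hwf rand))
      (fun g hg => .inr (.inr ⟨rfl, (hJ.tracks g hg).start hn (hu rand) rfl, fun _ h => h⟩))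
      ((hu rand).mem_stages fun r hr => by simp [π, Primitives.activate] at hr) hJ.not_forged

/-- The current stage of a session of `u`, as a guess. -/
def stageGuess (u v : Fin pp.nP) (h : v ≠ u) (i : Fin pp.nS) (n : Fin pp.nT) : Guess pp :=
  (⟨(u, v), h.symm⟩, i, n)

/-- If a stage between the two parties has used the salt before, the `fixed` clause yields a live
simulator having this star. Otherwise the current stage is the first use, and its own guess is alive
because its stage is pending. -/
theorem Coupled.exists_guess (hJ : Coupled P sk S Γ t) {u i} {π : Session pp}
    (hn : S.sessions u i = some π) (hlt : π.stages.length < pp.nT) {salt : BStr 128}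
    (hf : S.Fresh u π.peer salt) :
    ∃ g ∈ Γ, g.Pair u π.peer ∧ ((t g).2.star = some salt ∨
      (g.IsStage u π.peer i π.stages.length ∧ (t g).2.star = none ∧ salt ∉ (t g).2.used)) := by
  let g := stageGuess u π.peer (hJ.wf.session u i π hn).peer_ne i ⟨_, hlt⟩
  have hg : g.Pair u π.peer := .inl ⟨rfl, rfl⟩
  have hst : g.IsStage u π.peer i π.stages.length := ⟨rfl, rfl, rfl, rfl⟩
  by_cases hu : g.UsedIn S salt
  · obtain ⟨x, j, ρ, h1, h2, r, h3, rfl⟩ := hu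
    obtain ⟨g', hg', h4, h5⟩ := hJ.fixed x j ρ r h1 h3 ((h2.fresh_iff hg).2 hf)
    exact ⟨g', hg', h4.of_between (h2.between hg), .inl h5⟩
  · have hgΓ : g ∈ Γ := hJ.pending g (.of_fresh hg hf) fun ⟨ρ, h1, h2, h3⟩ => by
      obtain rfl : π = ρ := Option.some.inj (hn.symm.trans h1)
      exact lt_irrefl _ h3
    have h := hJ.tracks g hgΓ
    exact ⟨g, hgΓ, hg, .inr ⟨hst, h.star_eq_none hn hst, fun hm => hu ((h.used _).1 hm)⟩⟩

theorem Coupled.step_stage (hJ : Coupled P sk S Γ t) {u i} {π π' : Session pp} {m out}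
    {r : StageRecord pp} (hn : S.sessions u i = some π) (hlt : π.stages.length < pp.nT)
    (hrun : P.runStage u π (π.rand ⟨_, hlt⟩) m = (π', out)) (hp : π'.peer = π.peer)
    (hpms : π'.pms = π.pms) (hst : π'.stages = π.stages ++ [r])
    (hrev : π'.revSessKey = π.revSessKey) (hrs : π'.revState = π.revState)
    (hkey : ∀ k, r.key = some k → k = P.messageKey π.pms r.packet.salt)
    (h : ∀ g ∈ Γ, ∀ S', S.Updates S' u i π' → ∃ y, (simAnswer (.send u i m) (t g).1).run
        (simOracle P (pairKey P sk g) (pairKey P sk g)) (t g).2 = PMF.pure y ∧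
      StepOK P sk g S' out (t g).2 y ∧
      FixOK g u π.peer i π.stages.length r.packet.salt (t g).2 y.2 ∧
      (r.dir = .received → r.key.isSome → ¬ S.Produced π.peer u r.packet → g.Pair u π.peer →
        ((t g).2.star = some r.packet.salt ∧ ¬ g.IsStage u π.peer i π.stages.length ∨
          g.IsStage u π.peer i π.stages.length ∧ r.packet.salt ∉ (t g).2.used) →
            y.2.win = true)) :
    StepCoupled S Γ t P sk (.game (.send u i m)) := by
  set S' : GameState pp := { S.setSession u i π' with
    forged := S.forged ∨ (S.setSession u i π').IsForgery u i ⟨π.stages.length, hlt⟩ } with hS'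
  have hu₁ := S.setSession_updates u i π'
  have hu : S.Updates S' u i π' := ⟨hu₁.sessions, hu₁.revLongTermKey, hu₁.sk⟩
  have hS : S.Extends S' := hu.extends hn hp (hst ▸ List.prefix_append _ _) (hrev ▸ subset_rfl)
    (hrs ▸ id)
  have hπ := hJ.wf.session u i π hn
  have hwf : GameWF P sk S' := by
    refine hJ.wf.update hu ⟨hp ▸ hπ.peer_ne, by rw [hpms, hp]; exact hπ.pms, fun ρ hρ => ?_⟩
    rw [hst, List.mem_append, List.mem_singleton] at hρ
    rw [hpms]
    obtain hρ | rfl := hρ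
    · exact hπ.key ρ hρ
    · exact hkey
  refine .of_pure (a := out) (S' := S') ?_
    (fun g t' => FixOK g u π.peer i π.stages.length r.packet.salt (t g).2 t' ∧
      (r.dir = .received → r.key.isSome → ¬ S.Produced π.peer u r.packet → g.Pair u π.peer →
        ((t g).2.star = some r.packet.salt ∧ ¬ g.IsStage u π.peer i π.stages.length ∨
          g.IsStage u π.peer i π.stages.length ∧ r.packet.salt ∉ (t g).2.used) →
            t'.win = true))
    (fun g hg => h g hg S' hu) fun y hy hE => ?_
  · simp only [gameOracle, hn, dif_pos hlt, hrun, hS']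
  refine hJ.next hS hwf hy (fun x j ρ r' h1 h2 h3 => ?_) fun hf => ?_
  · by_cases hold : ∃ ρ', S.sessions x j = some ρ' ∧ ρ'.peer = ρ.peer ∧ r' ∈ ρ'.stages
    · obtain ⟨ρ', h4, h5, h6⟩ := hold
      obtain ⟨g, hg, h7, h8⟩ := hJ.fixed x j ρ' r' h4 h6 (h5 ▸ h3.of_extends hS)
      exact .inl ⟨g, hg, h5 ▸ h7, h8⟩
    · have hxj : x = u ∧ j = i := by
        by_contra hxj
        rw [hu.sessions, if_neg hxj] at h1
        exact hold ⟨ρ, h1, rfl, h2⟩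
      obtain ⟨rfl, rfl⟩ := hxj
      obtain rfl : π' = ρ := Option.some.inj (hu.same.symm.trans h1)
      have hr : r' = r := by
        rw [hst, List.mem_append, List.mem_singleton] at h2
        exact h2.resolve_left fun h2 => hold ⟨π, hn, hp.symm, h2⟩
      rw [hr] at h3 ⊢
      rw [hp] at h3 ⊢
      obtain ⟨g, hg, h4, h5 | ⟨h5, h6, h7⟩⟩ := hJ.exists_guess hn hlt (h3.of_extends hS)
      · exact .inl ⟨g, hg, h4, h5⟩
      · exact .inr ⟨g, hg, h4, (hE g hg).1 h5 h6 h7⟩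
  -- The experiment records forgeries at the newly completed stage, so the simulator found for its
  -- salt must win in this very step.
  · obtain hf | ⟨ρ, r', h1, h2, -, h3, h4, h5, h6⟩ := hf
    · exact absurd hf hJ.not_forged
    · obtain rfl : π' = ρ := Option.some.inj (hu₁.same.symm.trans h1)
      obtain rfl : r = r' := by simpa [hst] using h2
      rw [hp] at h5 h6
      obtain ⟨g, hg, h7, h8⟩ := hJ.exists_guess hn hlt (GameState.Fresh.of_extends hS h6)
      refine ⟨g, hg, (hE g hg).2 h3 h4 (fun h9 => h5 (h9.of_extends hS)) h7 ?_⟩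
      obtain h8 | ⟨h8, -, h9⟩ := h8
      · refine .inl ⟨h8, fun h9 => ?_⟩
        rw [(hJ.tracks g hg).star_eq_none hn h9] at h8
        cases h8
      · exact .inr ⟨h8, h9⟩

theorem Coupled.step_send (hJ : Coupled P sk S Γ t) (u i m) :
    StepCoupled S Γ t P sk (.game (.send u i m)) := by
  cases hn : S.sessions u i with
  | none =>
    have hs : ∀ g ∈ Γ, (t g).1.sessions u i = none := fun g hg => by
      rw [(hJ.tracks g hg).sessions, hn]; rfl
    cases m with
    | start role peer =>
      by_cases hpeer : peer = u
      · exact hJ.step_unchanged (a := none) (by simp only [gameOracle, hn, if_pos hpeer])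
          fun g hg => by simp only [simAnswer, hs g hg, if_pos hpeer]
      · exact hJ.step_start hn hpeer
    | plaintext _ _ _ =>
      exact hJ.step_unchanged (a := none) (by simp only [gameOracle, hn])
        fun g hg => by simp only [simAnswer, hs g hg]
    | packet _ =>
      exact hJ.step_unchanged (a := none) (by simp only [gameOracle, hn])
        fun g hg => by simp only [simAnswer, hs g hg]
  | some π =>
    have hs : ∀ g ∈ Γ, (t g).1.sessions u i = some (g.view u π) := fun g hg => by
      rw [(hJ.tracks g hg).sessions, hn]; rfl
    have hlen : ∀ g : Guess pp, (g.view u π).stages.length = π.stages.length := fun g => by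
      simp [Guess.view]
    have hπ := hJ.wf.session u i π hn
    by_cases hlt : π.stages.length < pp.nT
    · cases m with
      | start role peer =>
        have hu₁ := S.setSession_updates u i π
        -- Restarting an existing session appends no record, so nothing is stored at the index that
        -- is tested for a forgery.
        have hnf : ¬ (S.setSession u i π).IsForgery u i ⟨π.stages.length, hlt⟩ := by
          rintro ⟨ρ, r, h1, h2, -⟩
          obtain rfl : π = ρ := Option.some.inj (hu₁.same.symm.trans h1)
          simp at h2
        set S' : GameState pp := { S.setSession u i π with
          forged := S.forged ∨ (S.setSession u i π).IsForgery u i ⟨π.stages.length, hlt⟩ } with hS'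
        have hu : S.Updates S' u i π := ⟨hu₁.sessions, hu₁.revLongTermKey, hu₁.sk⟩
        have hS := hu.extends hn rfl List.prefix_rfl subset_rfl id
        refine .of_pure (a := none) (S' := S') ?_ (fun _ _ => True) (fun g hg => ?_) fun y hy _ => ?_
        · simp only [gameOracle, hn, dif_pos hlt, Primitives.runStage, hS']
        · refine ⟨((none, (t g).1), (t g).2), ?_,
            .unchanged ((hJ.tracks g hg).reveal hn hu rfl rfl hS), trivial⟩
          simp only [simAnswer, hs g hg, hlen, dif_pos hlt, OracleComp.run]
        · exact hJ.next_of_stages hS (hJ.wf.update hu hπ) hy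
            (hu.mem_stages fun r hr => ⟨π, hn, rfl, hr⟩) fun hf => hf.elim hJ.not_forged hnf
      | plaintext vers ctype m =>
        refine hJ.step_stage hn hlt rfl rfl rfl rfl rfl rfl
          (fun k hk => (Option.some.inj hk).symm) fun g hg S' hu => ?_
        obtain ⟨y, h1, h2, h3⟩ := stepOK_plaintext (hJ.tracks g hg) hπ hn hlt rfl hu
        exact ⟨y, h1, h2, h3, fun h => nomatch h⟩
      | packet p =>
        refine hJ.step_stage hn hlt (runStage_packet _ _ _ _ _) rfl rfl rfl rfl rfl
          (fun k hk => ?_) fun g hg S' hu => ?_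
        · simp only [Option.map_eq_some_iff] at hk
          obtain ⟨_, -, rfl⟩ := hk
          rfl
        · obtain ⟨y, h1, h2, h3, h4⟩ := stepOK_packet (hJ.tracks g hg) hπ hn hlt
            (runStage_packet P u π (π.rand ⟨_, hlt⟩) p) hu
          exact ⟨y, h1, h2, h3, fun _ h => h4 (by simpa using h)⟩
    · exact hJ.step_unchanged (a := none) (by simp only [gameOracle, hn, dif_neg hlt])
        fun g hg => by simp only [simAnswer, hs g hg, hlen, dif_neg hlt]

theorem Coupled.step (hJ : Coupled P sk S Γ t) (q : AdvOp pp) : StepCoupled S Γ t P sk q := by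
  cases q with
  | coin n =>
    refine ⟨Fin (n + 1), uniformUpTo n, fun x => (x, S), fun g x => (x, t g), rfl, fun g _ => ?_,
      fun x => .inr ⟨Γ, subset_rfl, fun _ _ => rfl, hJ⟩⟩
    refine (congrArg (PMF.map _) (a₂ := (uniformUpTo n).bind fun x =>
      PMF.pure ((x, (t g).1), (t g).2)) (PMF.bind_map _ _ _)).trans ?_
    exact (PMF.map_bind _ _ _).trans (congrArg _ (funext fun x => PMF.pure_map _ _))
  | game q =>
    cases q with
    | send u i m => exact hJ.step_send u i m
    | revSessKey u i s => exact hJ.step_revSessKey u i s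
    | revLongTermKey u => exact hJ.step_revLongTermKey u
    | revRand u i s => exact hJ.step_revRand u i s
    | revState u i s => exact hJ.step_revState u i s

theorem simOracle_win {K L : BStr 128 → BStr pp.κ} (op : SimOp pp) (t : Track)
    (ht : t.win = true) : ∀ x ∈ (simOracle P K L op t).support, x.2.win = true := by
  have hd : t.Done := .inr ht
  intro x hx
  cases op with
  | coin n =>
    obtain ⟨y, -, rfl⟩ := (PMF.mem_support_map_iff _ _ _).1 hx; exact ht
  | stageRand =>
    obtain ⟨y, -, rfl⟩ := (PMF.mem_support_map_iff _ _ _).1 hx; exact ht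
  | pairEnc first salt n ad m =>
    simp only [simOracle, if_pos hd] at hx
    rw [(PMF.mem_support_pure_iff _ _).1 hx]; exact ht
  | pairDec first salt n ad c =>
    simp only [simOracle, if_pos hd] at hx
    rw [(PMF.mem_support_pure_iff _ _).1 hx]; exact ht
  | reveal salt =>
    simp only [simOracle, if_pos hd] at hx
    rw [(PMF.mem_support_pure_iff _ _).1 hx]; exact ht
  | abort =>
    simp only [simOracle, if_pos hd] at hx
    rw [(PMF.mem_support_pure_iff _ _).1 hx]; exact ht
  | _ => rw [(PMF.mem_support_pure_iff _ _).1 hx]; exact ht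

/-- Initially every guess is alive and nothing has been used, so the invariant starts with all
guesses. The bound holds for each fixed choice of secret keys. -/
theorem forged_le_sum (P : Primitives pp) (A : Adversary pp) (sk : Fin pp.nP → Fin pp.q) :
    ((A (P.pubs sk)).run (advOracle P) ⟨sk, fun _ _ => none, ∅, False⟩).toOuterMeasure
      {x | x.2.forged} ≤
    ∑ g : Guess pp, simWin P A (pairKey P sk g) (pairKey P sk g) g sk true := by
  have hJ : Coupled P sk ⟨sk, fun _ _ => none, ∅, False⟩ Finset.univ
      fun g => (simInit g sk (P.pubs sk), Track.init) := by
    refine ⟨id, ⟨rfl, (fun _ _ _ h => (nomatch h))⟩, fun g _ => ?_, (fun _ _ _ _ h => (nomatch h)),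
      fun g _ _ => Finset.mem_univ g⟩
    refine ⟨rfl, rfl, rfl, fun _ _ => rfl, ?_, fun salt => ?_, (fun _ h => (nomatch h)),
      (fun _ h => (nomatch h)), (fun _ h => (nomatch h))⟩
    · simp [Track.Done, Track.init]
    · simp [Track.init, Guess.UsedIn]
  have h := OracleComp.run_le_sum (advOracle P) {S | S.forged}
    (fun g => OracleComp.compOracle (simOracle P (pairKey P sk g) (pairKey P sk g)) simAdvAnswer)
    {x | x.2.win = true} (Coupled P sk) ?_ (fun S Γ t h => h.not_forged)
    (fun S Γ t h q => h.step q) (A (P.pubs sk)) _ _ _ hJ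
  · refine h.trans (le_of_eq (Finset.sum_congr rfl fun g _ => ?_))
    rw [simWin, OracleComp.run_simulate, PMF.map_comp, ← PMF.toOuterMeasure_apply_singleton,
      PMF.toOuterMeasure_map_apply]
    rfl
  · rintro g q ⟨s, t⟩ ht x hx
    obtain ⟨y, hy, rfl⟩ := (PMF.mem_support_map_iff _ _ _).1 hx
    exact OracleComp.run_support _ (fun t : Track => t.win = true)
      (fun op t ht => simOracle_win op t ht) _ _ ht y hy

end Coupling

end

/-! ### Advantages, the chain of experiments and the asymptotic form. -/

noncomputable section

section Advantage

variable {pp : Params} (P : Primitives pp) (A : Adversary pp)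

/-- A random DDH element is a uniform group element, hence a properly distributed PRF key. -/
theorem ddhExp_false_eq_prfExp_true [Nonempty (Guess pp)] :
    ddhExp P ((ddhReduction pp).apply A) false = prfExp P ((prfReduction pp).apply A ()) true := by
  rw [ddhExp_eq, prfExp_true, PMF.bind_comm (uniformExp pp)]
  exact congrArg _ (funext fun g => PMF.bind_comm _ _ _)

theorem aeadAuthAdv_eq_prfExp_false [Nonempty (Guess pp)] :
    aeadAuthAdv P ((aeadReduction pp).apply A ()) =
      (prfExp P ((prfReduction pp).apply A ()) false true).toReal := by
  have h : ∀ p : PMF (Unit × AEADState),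
      p.toOuterMeasure {x | x.2.win = true} = p.map (fun x => x.2.win) true := fun p => by
    rw [← PMF.toOuterMeasure_apply_singleton, PMF.toOuterMeasure_map_apply]
    rfl
  rw [aeadAuthAdv, h, PMF.map_bind]
  simp only [aeadExp_eq]
  rw [prfExp_false, PMF.bind_comm (uniformExp pp)]
  refine congrArg (fun p : PMF Bool => (p true).toReal) (congrArg _ (funext fun z => ?_))
  rw [PMF.bind_comm (uniformExp pp)]

/-- A forgery occurs at some stage, and each stage is guessed with the same probability. -/
theorem lineAuthAdv_le_ddhExp [Nonempty (Guess pp)] :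
    lineAuthAdv P A ≤
      Fintype.card (Guess pp) * (ddhExp P ((ddhReduction pp).apply A) true true).toReal := by
  have h : (lineAuthExp P A).toOuterMeasure {S | S.forged} ≤
      Fintype.card (Guess pp) * ddhExp P ((ddhReduction pp).apply A) true true := by
    rw [lineAuthExp, PMF.toOuterMeasure_bind_apply, ddhExp_eq, PMF.bind_apply, tsum_fintype,
      tsum_fintype]
    simp only [if_true, PMF.bind_const, PMF.uniformOfFintype_apply, PMF.bind_apply,
      PMF.toOuterMeasure_map_apply]
    -- The probability `1 / card` of each guess cancels against the factor in front, leaving the sum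
    -- over all guesses.
    rw [← Finset.mul_sum (Finset.univ : Finset (Guess pp)), ← mul_assoc,
      ENNReal.mul_inv_cancel (Nat.cast_ne_zero.2 Fintype.card_ne_zero) (ENNReal.natCast_ne_top _),
      one_mul]
    simp only [tsum_fintype]
    rw [Finset.sum_comm]
    refine Finset.sum_le_sum fun sk _ => ?_
    rw [← Finset.mul_sum]
    exact mul_le_mul_right (forged_le_sum P A sk) _
  have h' := ENNReal.toReal_mono (ENNReal.mul_ne_top (ENNReal.natCast_ne_top _) (PMF.apply_ne_top _ _)) h
  rwa [ENNReal.toReal_mul, ENNReal.toReal_natCast] at h'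

theorem lineAuthAdv_of_isEmpty [IsEmpty (Guess pp)] : lineAuthAdv P A = 0 := by
  have h : (lineAuthExp P A).toOuterMeasure {S | S.forged} = 0 := by
    rw [lineAuthExp, PMF.toOuterMeasure_bind_apply, tsum_fintype]
    refine Finset.sum_eq_zero fun sk _ => ?_
    rw [PMF.toOuterMeasure_map_apply]
    have h := forged_le_sum P A sk
    rw [Finset.univ_eq_empty, Finset.sum_empty] at h
    exact mul_eq_zero_of_right _ (le_antisymm h bot_le)
  rw [lineAuthAdv, h, ENNReal.toReal_zero]

theorem card_guess_le (pp : Params) : Fintype.card (Guess pp) ≤ pp.nP ^ 2 * pp.nS * pp.nT := by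
  have h := Fintype.card_subtype_le fun x : Fin pp.nP × Fin pp.nP => x.1 ≠ x.2
  simp only [Fintype.card_prod, Fintype.card_fin] at h ⊢
  rw [sq, mul_assoc]
  exact Nat.mul_le_mul_right _ h

theorem ddhAdv_nonneg (B : DDHDistinguisher pp) : 0 ≤ ddhAdv P B := abs_nonneg _

theorem prfAdv_nonneg (B : PRFDistinguisher pp) : 0 ≤ prfAdv P B := abs_nonneg _

theorem aeadAuthAdv_nonneg (B : AEADForger pp) : 0 ≤ aeadAuthAdv P B := ENNReal.toReal_nonneg

theorem collAdv_nonneg (B : CollFinder pp) : 0 ≤ collAdv P B := ENNReal.toReal_nonneg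

theorem lineAuthAdv_nonneg : 0 ≤ lineAuthAdv P A := ENNReal.toReal_nonneg

theorem lineAuthAdv_le [Nonempty (Guess pp)] :
    lineAuthAdv P A ≤ (pp.nP : ℝ) ^ 2 * pp.nS * pp.nT *
      (ddhAdv P ((ddhReduction pp).apply A) + prfAdv P ((prfReduction pp).apply A ()) +
        aeadAuthAdv P ((aeadReduction pp).apply A ())) := by
  have h : (Fintype.card (Guess pp) : ℝ) ≤ (pp.nP : ℝ) ^ 2 * pp.nS * pp.nT := by
    exact_mod_cast card_guess_le pp
  refine (lineAuthAdv_le_ddhExp P A).trans (mul_le_mul h ?_ ENNReal.toReal_nonneg (by positivity))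
  -- The three advantages telescope, since neighbouring experiments coincide and the last one has
  -- exactly the AEAD advantage as its probability.
  rw [ddhAdv, prfAdv, aeadAuthAdv_eq_prfExp_false, ddhExp_false_eq_prfExp_true]
  linarith [le_abs_self ((ddhExp P ((ddhReduction pp).apply A) true true).toReal -
      (prfExp P ((prfReduction pp).apply A ()) true true).toReal),
    le_abs_self ((prfExp P ((prfReduction pp).apply A ()) true true).toReal -
      (prfExp P ((prfReduction pp).apply A ()) false true).toReal)]

/-- The bound needs no terms for collisions of the hash function or of salts: the guess points to the
first stage between the two parties that uses the salt of the forgery, and all stages with this salt are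
answered under the challenge key. A packet is determined by the salt together with the ciphertext, the
nonce and the associated data, so a forged packet is one that the AEAD oracle has not produced. -/
theorem exists_reductions (pp : Params) :
    ∃ (B₂ : DDHReduction pp) (B₃ : PRFReduction pp) (B₄ : AEADReduction pp),
      (B₂.Efficient 4 ∧ B₃.Efficient 4 ∧ B₄.Efficient 4) ∧
      ∀ (P : Primitives pp) (A : Adversary pp), lineAuthAdv P A ≤
        (pp.nP : ℝ) ^ 2 * pp.nS * pp.nT *
          (ddhAdv P (B₂.apply A) + prfAdv P (B₃.apply A ()) + aeadAuthAdv P (B₄.apply A ())) := by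
  -- Sampling a guess requires one to exist. If there is none, the union bound is an empty sum and
  -- trivial reductions suffice.
  obtain h | h := isEmpty_or_nonempty (Guess pp)
  · refine ⟨trivialReduction false, trivialReduction false, trivialReduction (),
      ⟨trivialReduction_efficient _ _, trivialReduction_efficient _ _,
        trivialReduction_efficient _ _⟩, fun P A => ?_⟩
    rw [lineAuthAdv_of_isEmpty]
    exact mul_nonneg (by positivity)
      (add_nonneg (add_nonneg (ddhAdv_nonneg _ _) (prfAdv_nonneg _ _)) (aeadAuthAdv_nonneg _ _))
  · exact ⟨ddhReduction pp, prfReduction pp, aeadReduction pp,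
      ⟨ddhReduction_efficient pp, prfReduction_efficient pp, aeadReduction_efficient pp⟩,
      fun P A => lineAuthAdv_le P A⟩

end Advantage

theorem Negligible.of_le_polynomial_mul {f g : ℕ → ℝ} (hg : Negligible g)
    (p : Polynomial ℕ) (hf₀ : ∀ l, 0 ≤ f l) (hf : ∀ l, f l ≤ (p.eval l : ℕ) * g l) :
    Negligible f := by
  refine (hg.polynomial_mul (p.map (Nat.castRingHom ℝ))).trans_abs_le fun l => ?_
  rw [abs_of_nonneg (hf₀ l)]
  refine (hf l).trans (le_trans (le_of_eq ?_) (le_abs_self _))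
  simp [Polynomial.eval_natCast_map]

end

theorem mainTheorem3 :
    ∃ (B₁ : (pp : Params) → CollReduction pp) (B₂ : (pp : Params) → DDHReduction pp)
      (B₃ : (pp : Params) → PRFReduction pp) (B₄ : (pp : Params) → AEADReduction pp),
      (∃ c : ℕ, ∀ pp, (B₁ pp).Efficient c ∧ (B₂ pp).Efficient c ∧ (B₃ pp).Efficient c ∧
        (B₄ pp).Efficient c) ∧
      (∀ (pp : Params) (P : Primitives pp) (A : Adversary pp),
        lineAuthAdv P A ≤ collAdv P ((B₁ pp).apply A ()) +
          (pp.nP : ℝ) ^ 2 * pp.nS * pp.nT *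
            (ddhAdv P ((B₂ pp).apply A) + prfAdv P ((B₃ pp).apply A ()) +
              aeadAuthAdv P ((B₄ pp).apply A ()) + 2 * pp.nT * (2 : ℝ) ^ (-160 : ℤ))) ∧
      (∀ (pp : ℕ → Params) (P : (l : ℕ) → Primitives (pp l)) (A : (l : ℕ) → Adversary (pp l)),
        (∃ p : Polynomial ℕ, ∀ l, (pp l).nP + (pp l).nS + (pp l).nT ≤ p.eval l) →
        Negligible (fun l => collAdv (P l) ((B₁ (pp l)).apply (A l) ())) →
        Negligible (fun l => ddhAdv (P l) ((B₂ (pp l)).apply (A l))) →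
        Negligible (fun l => prfAdv (P l) ((B₃ (pp l)).apply (A l) ())) →
        Negligible (fun l => aeadAuthAdv (P l) ((B₄ (pp l)).apply (A l) ())) →
        Negligible (fun l => lineAuthAdv (P l) (A l))) := by
  choose B₂ B₃ B₄ he hB using exists_reductions
  refine ⟨fun _ => trivialReduction ([], []), B₂, B₃, B₄,
    ⟨4, fun pp => ⟨trivialReduction_efficient _ _, he pp⟩⟩, fun pp P A => ?_,
    fun pp P A ⟨p, hp⟩ _ h₂ h₃ h₄ => ?_⟩
  -- The collision and salt terms are nonnegative and only weaken the bound, so a trivial collision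
  -- finder suffices.
  · refine (hB pp P A).trans (le_add_of_nonneg_of_le (collAdv_nonneg _ _) ?_)
    exact mul_le_mul_of_nonneg_left (le_add_of_nonneg_right (by positivity)) (by positivity)
  · have h₀ : ∀ l, 0 ≤ ddhAdv (P l) ((B₂ (pp l)).apply (A l)) +
        prfAdv (P l) ((B₃ (pp l)).apply (A l) ()) + aeadAuthAdv (P l) ((B₄ (pp l)).apply (A l) ()) :=
      fun l => add_nonneg (add_nonneg (ddhAdv_nonneg _ _) (prfAdv_nonneg _ _)) (aeadAuthAdv_nonneg _ _)
    -- The exponent 4 is the total degree of `nP ^ 2 * nS * nT`, each factor being at most `p`.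
    refine Negligible.of_le_polynomial_mul ((h₂.add h₃).add h₄) (p ^ 4)
      (fun l => lineAuthAdv_nonneg _ _) fun l => (hB _ _ _).trans
        (mul_le_mul_of_nonneg_right ?_ (h₀ l))
    have h := hp l
    have hN : (pp l).nP ^ 2 * (pp l).nS * (pp l).nT ≤ (p ^ 4).eval l := by
      rw [Polynomial.eval_pow]
      calc _ ≤ p.eval l ^ 2 * p.eval l * p.eval l := by gcongr <;> omega
        _ = _ := by ring
    exact_mod_cast hN
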